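/- Let $\alpha\in[1,2)$ and $\beta\in[-1,1]$, with $\beta=0$ if $\alpha=1$. Let $M=M_{\alpha,\beta}$ be an $\alpha$-stable random measure on $\mathbb R$ with Lebesgue control measure $\lambda$ and constant skewness intensity $\beta$. That is, on some probability space, $M$ is an independently scattered, almost surely $\sigma$-additive family of real random variables $M(A)$, indexed by the Borel sets $A\subset\mathbb R$ with $\lambda(A)<\infty$, such that $$\mathbb E\,e^{i\theta M(A)}=\begin{cases}\exp\{-\lambda(A)|\theta|^\alpha(1-i\beta\,\mathrm{sign}(\theta)\tan(\alpha\pi/2))\}&\text{if }\alpha\in(1,2),\\ \exp\{-\lambda(A)|\theta|\}&\text{if }\alpha=1,\end{cases}\qquad \theta\in\mathbb R.$$ Write $x_+^p=x^p$ if $x>0$ and $x_+^p=0$ if $x\le 0$. For $f\in L^\alpha(\mathbb R)$, let $\int f\,dM$ denote the limit in probability of $\int g_n\,dM$, where the $g_n$ are simple functions converging to $f$ in $L^\alpha(\mathbb R)$. The process given by $L_t=M([0,t])$ for $t\ge 0$ and $L_t=-M([t,0])$ for $t\le 0$ has a version with almost surely càdlàg paths. Let $L$ be any such version. Then $L$ is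 a (two-sided) $\alpha$-stable Lévy process: $L_0=0$ almost surely, its increments are independent, its paths are almost surely càdlàg, and for $s\le t$ the increment $L_t-L_s$ has the characteristic function above with $\lambda(A)$ replaced by $t-s$. Moreover, for all $t\in\mathbb R$ and $H\in(0,1)$, the stochastic integral $$X(t,H)=\int_{\mathbb R}\big\{(t-u)_+^{H-1/\alpha}-(-u)_+^{H-1/\alpha}\big\}\,M(du)$$ exists and, with $C_H=H-1/\alpha$, satisfies almost surely $$X(t,H)=\begin{cases}\displaystyle C_H\int_{\mathbb R}L_u\big\{(t-u)_+^{H-1/\alpha-1}-(-u)_+^{H-1/\alpha-1}\big\}\,du&\text{if }H\in(1/\alpha,1),\\[2mm] L_t&\text{if }H=1/\alpha,\\[1mm] \displaystyle C_H\int_{\mathbb R}\big\{(L_u-L_t)(t-u)_+^{H-1/\alpha-1}-L_u(-u)_+^{H-1/\alpha-1}\big\}\,du&\text{if }H\in(0,1/\alpha),\end{cases}$$ where the integrals in $du$ are almost surely absolutely convergent Lebesgue integrals. -/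

import Mathlib

open MeasureTheory ProbabilityTheory Filter Set
open scoped Topology ENNReal

noncomputable section

/-- The characteristic function at `θ` of the `α`-stable law with scale `ℓ ^ (1 / α)`, skewness
`β` and shift `0`. -/
def stableCharFun (α β ℓ θ : ℝ) : ℂ :=
  if α = 1 then Complex.exp (-((ℓ * |θ| : ℝ) : ℂ))
  else Complex.exp (-((ℓ * |θ| ^ α : ℝ) : ℂ) *
    (1 - Complex.I * ((β * Real.sign θ * Real.tan (α * Real.pi / 2) : ℝ) : ℂ)))

/-- `M` is an `α`-stable random measure on `ℝ` with Lebesgue control measure and constant skewness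
intensity `β`: an independently scattered, almost surely `σ`-additive family of random variables
indexed by the Borel sets of finite Lebesgue measure (the values of `M` on other sets play no
role). The series need not converge absolutely, so additivity is about the partial sums. -/
structure IsStableRandomMeasure {Ω : Type*} [MeasurableSpace Ω] (P : Measure Ω) (α β : ℝ)
    (M : Set ℝ → Ω → ℝ) : Prop where
  measurable : ∀ A : Set ℝ, MeasurableSet A → volume A < ∞ → Measurable (M A)
  charFun_eq : ∀ A : Set ℝ, MeasurableSet A → volume A < ∞ → ∀ θ : ℝ,
    charFun (P.map (M A)) θ = stableCharFun α β (volume A).toReal θ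
  indep : ∀ (n : ℕ) (A : Fin n → Set ℝ), (∀ i, MeasurableSet (A i)) → (∀ i, volume (A i) < ∞) →
    Pairwise (fun i j => Disjoint (A i) (A j)) → iIndepFun (fun i => M (A i)) P
  sigma_additive : ∀ A : ℕ → Set ℝ, (∀ i, MeasurableSet (A i)) → volume (⋃ i, A i) < ∞ →
    Pairwise (fun i j => Disjoint (A i) (A j)) →
    ∀ᵐ ω ∂P, Tendsto (fun n => ∑ i ∈ Finset.range n, M (A i) ω) atTop (𝓝 (M (⋃ i, A i) ω))

/-- The integral of a simple function against `M`, that is, `∑ c_i M(A_i)` for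
`g = ∑ c_i 1_{A_i}`. -/
def simpleStableIntegral {Ω : Type*} (M : Set ℝ → Ω → ℝ) (g : SimpleFunc ℝ ℝ) (ω : Ω) : ℝ :=
  ∑ c ∈ g.range, c * M (g ⁻¹' {c}) ω

/-- `Y` is (a version of) the stochastic integral `∫ f(u) M(du)` of `f ∈ L^α(ℝ)`: the limit in
probability of the integrals of simple functions that converge to `f` in `L^α(ℝ)`. -/
def IsStableIntegral {Ω : Type*} [MeasurableSpace Ω] (P : Measure Ω) (α : ℝ)
    (M : Set ℝ → Ω → ℝ) (f : ℝ → ℝ) (Y : Ω → ℝ) : Prop :=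
  MemLp f (ENNReal.ofReal α) volume ∧
  ∃ g : ℕ → SimpleFunc ℝ ℝ,
    (∀ n, MemLp (g n) (ENNReal.ofReal α) volume) ∧
    Tendsto (fun n => eLpNorm (fun u => f u - g n u) (ENNReal.ofReal α) volume) atTop (𝓝 0) ∧
    TendstoInMeasure P (fun n => simpleStableIntegral M (g n)) atTop Y

/-- The truncated power `x_+^p`, equal to `x ^ p` for `x > 0` and to `0` for `x ≤ 0`
(also when `p ≤ 0`). -/
def posPow (x p : ℝ) : ℝ := if 0 < x then x ^ p else 0

/-- The kernel `u ↦ (t - u)_+^{H - 1/α} - (-u)_+^{H - 1/α}` of linear fractional stable motion. -/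
def lfsmKernel (α H t u : ℝ) : ℝ := posPow (t - u) (H - 1 / α) - posPow (-u) (H - 1 / α)

/-- Right-continuous with left limits at every point of `ℝ`. -/
def IsCadlagPath (x : ℝ → ℝ) : Prop :=
  ∀ t, ContinuousWithinAt x (Ici t) t ∧ ∃ l, Tendsto x (𝓝[<] t) (𝓝 l)

/-- `L` is a two-sided `α`-stable Lévy process with skewness `β` and unit scale. -/
structure IsStableLevyProcess {Ω : Type*} [MeasurableSpace Ω] (P : Measure Ω) (α β : ℝ)
    (L : ℝ → Ω → ℝ) : Prop where
  aemeasurable : ∀ t, AEMeasurable (L t) P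
  zero : ∀ᵐ ω ∂P, L 0 ω = 0
  indep_increments : HasIndepIncrements L P
  charFun_increment : ∀ s t : ℝ, s ≤ t → ∀ θ : ℝ,
    charFun (P.map (fun ω => L t ω - L s ω)) θ = stableCharFun α β (t - s) θ
  cadlag : ∀ᵐ ω ∂P, IsCadlagPath (fun t => L t ω)

/-- `L` is a version with càdlàg paths of the process given by `L_t = M([0, t])` for `t ≥ 0` and
`L_t = -M([t, 0])` for `t ≤ 0`. -/
structure IsCadlagVersion {Ω : Type*} [MeasurableSpace Ω] (P : Measure Ω)
    (M : Set ℝ → Ω → ℝ) (L : ℝ → Ω → ℝ) : Prop where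
  nonneg : ∀ t : ℝ, 0 ≤ t → ∀ᵐ ω ∂P, L t ω = M (Icc 0 t) ω
  nonpos : ∀ t : ℝ, t ≤ 0 → ∀ᵐ ω ∂P, L t ω = -M (Icc t 0) ω
  cadlag : ∀ᵐ ω ∂P, IsCadlagPath (fun t => L t ω)

end

/-!
The proof rests on the fact that the kernel of linear fractional stable motion is a mixture of
indicators. Let `J_v = 1_{(0, v]} - 1_{(v, 0]}` (`levyKernel`), whose stochastic integral is
`L_v`. With `d = H - 1/α` and `a v = d ((t - v)_+ ^ (d - 1) - (-v)_+ ^ (d - 1))`, the kernel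
`(t - u)_+ ^ d - (-u)_+ ^ d` equals `∫ a v J_v(u) dv` for almost every `u` when `d > 0`. When `d < 0` it
equals `∫ (a v J_v(u) + b v J_t(u)) dv` with `b v = -d (t - v)_+ ^ (d - 1)`, where the second term
compensates the singularity at `t`; the one at `0` is compensated by `J_0 = 0`. The assertion is
therefore that stochastic integration commutes with the mixture
(`IsCadlagVersion.isStableIntegral_mixture`).

For `α = 1` first moments do not exist, so Fubini's theorem is not available. Instead, three
functions of `v` are treated in the same way: `v ↦ J_v` with values in `L^α`, `v ↦ J_v(u)` for
fixed `u`, and `v ↦ L_v(ω)` for fixed `ω`. Each is right-continuous, with increments around `0`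
and `t` bounded by a multiple of the envelope `|s| ^ γ₁ + |s| ^ γ₂`, for any `0 < γ₁ < 1/α < γ₂`
(`HasEnvelope`). Choosing `γ₁`, `γ₂` close enough to `1/α`, the mixtures converge absolutely in
all three cases, and they are iterated limits of the same finite linear combinations (`stepSum`).
As the stochastic integral is linear and closed under such limits (`IsStableIntegral.lincomb`,
`IsStableIntegral.of_tendsto`), the identity passes from the linear combinations to the mixture.
It determines every version of the integral because limits in probability of integrals of simple
functions are unique (`IsStableIntegral.ae_unique`), which follows from a tail bound by the `L^α`
norm, obtained from the characteristic function
(`IsStableRandomMeasure.measure_lt_abs_simpleStableIntegral_le`).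

The envelope for the paths of `L` comes from Ottaviani's maximal inequality
(`IsCadlagVersion.measure_exists_abs_sub_le`) and a union bound over geometric scales
(`IsCadlagVersion.ae_exists_envelope_bound`).

A càdlàg version exists because two adjacent increments over intervals of length `h` are both
large with probability `O(h ^ 2)`, by independence. Borel-Cantelli and a chaining argument over
the dyadic rationals (`min_abs_sub_le_of_chain`) then give one-sided limits everywhere, and the
process of right limits along the dyadic rationals is the required version.
-/

/-! ### Tails of stable laws -/

lemma norm_one_sub_exp_le_two_mul {z : ℂ} (hz : z.re ≤ 0) : ‖1 - Complex.exp z‖ ≤ 2 * ‖z‖ := by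
  rcases le_or_gt ‖z‖ 1 with h | h
  · rw [norm_sub_rev]
    exact Complex.norm_exp_sub_one_le h
  · have h1 : ‖Complex.exp z‖ ≤ 1 := by
      rw [Complex.norm_exp]
      exact Real.exp_le_one_iff.2 hz
    have h2 := norm_sub_le (1 : ℂ) (Complex.exp z)
    rw [norm_one] at h2
    linarith

/-- A constant `K` with `‖1 - φ(θ)‖ ≤ K ℓ |θ| ^ α` for the stable characteristic function `φ`. -/
noncomputable def stableConst (α : ℝ) : ℝ := 2 * (1 + |Real.tan (α * Real.pi / 2)|)

lemma stableConst_pos (α : ℝ) : 0 < stableConst α := by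
  unfold stableConst; positivity

lemma norm_one_sub_stableCharFun_le {α β ℓ : ℝ} (hβ : β ∈ Icc (-1 : ℝ) 1) (hℓ : 0 ≤ ℓ) (θ : ℝ) :
    ‖1 - stableCharFun α β ℓ θ‖ ≤ stableConst α * ℓ * |θ| ^ α := by
  unfold stableCharFun stableConst
  split_ifs with h
  · subst h
    refine (norm_one_sub_exp_le_two_mul ?_).trans ?_
    · simp only [Complex.neg_re, Complex.ofReal_re, Left.neg_nonpos_iff]
      positivity
    · rw [norm_neg, Complex.norm_real, Real.norm_of_nonneg (by positivity), Real.rpow_one]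
      have : 0 ≤ |Real.tan (1 * Real.pi / 2)| * (ℓ * |θ|) := by positivity
      nlinarith
  · set y : ℝ := β * Real.sign θ * Real.tan (α * Real.pi / 2) with hy
    have hy1 : |y| ≤ |Real.tan (α * Real.pi / 2)| := by
      rw [hy, abs_mul, abs_mul]
      have h1 : |β| ≤ 1 := abs_le.2 hβ
      have h2 : |Real.sign θ| ≤ 1 := by
        rcases Real.sign_apply_eq θ with h | h | h <;> simp [h]
      calc |β| * |Real.sign θ| * _ ≤ 1 * 1 * |Real.tan (α * Real.pi / 2)| := by gcongr
        _ = _ := by ring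
    have hx : 0 ≤ ℓ * |θ| ^ α := by positivity
    refine (norm_one_sub_exp_le_two_mul ?_).trans ?_
    · rw [neg_mul, Complex.neg_re, Complex.re_ofReal_mul]
      simp only [Complex.sub_re, Complex.one_re, Complex.mul_re, Complex.I_re, Complex.I_im,
        Complex.ofReal_im, Complex.ofReal_re]
      linarith
    · rw [norm_mul, norm_neg, Complex.norm_real, Real.norm_of_nonneg hx]
      have h1 : ‖1 - Complex.I * (y : ℂ)‖ ≤ 1 + |y| := by
        refine (norm_sub_le _ _).trans ?_
        simp
      nlinarith [mul_le_mul_of_nonneg_left (h1.trans (add_le_add_right hy1 1)) hx]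

lemma norm_charFun_map_le_one {Ω : Type*} [MeasurableSpace Ω] {P : Measure Ω}
    [IsProbabilityMeasure P] {Y : Ω → ℝ} (hY : AEMeasurable Y P) (θ : ℝ) :
    ‖charFun (P.map Y) θ‖ ≤ 1 := by
  have := Measure.isProbabilityMeasure_map hY
  exact norm_charFun_le_one θ

/-- A bound of order `|θ| ^ α` for the characteristic function near `0` gives tails of order
`r ^ (-α)`. -/
lemma measure_lt_abs_le_of_charFun {Ω : Type*} [MeasurableSpace Ω] {P : Measure Ω}
    [IsProbabilityMeasure P] {Y : Ω → ℝ} (hY : AEMeasurable Y P) {α c : ℝ} (hα : 0 < α)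
    (h : ∀ θ, ‖1 - charFun (P.map Y) θ‖ ≤ c * |θ| ^ α) {r : ℝ} (hr : 0 < r) :
    P {ω | r < |Y ω|} ≤ ENNReal.ofReal (2 * c * (2 / r) ^ α) := by
  have := Measure.isProbabilityMeasure_map hY
  have hc : 0 ≤ c := by
    have := (norm_nonneg _).trans (h 1)
    simpa using this
  have h1 := measureReal_abs_gt_le_integral_charFun (μ := P.map Y) hr
  have h2 : ‖∫ t in (-2 * r⁻¹)..(2 * r⁻¹), 1 - charFun (P.map Y) t‖
      ≤ c * (2 / r) ^ α * |2 * r⁻¹ - (-2 * r⁻¹)| := by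
    refine intervalIntegral.norm_integral_le_of_norm_le_const fun t ht => (h t).trans ?_
    have : |t| ≤ 2 / r := by
      have hr' : 0 < r⁻¹ := inv_pos.2 hr
      rw [uIoc_of_le (by linarith)] at ht
      rw [abs_le, div_eq_mul_inv]
      exact ⟨by linarith [ht.1], ht.2⟩
    gcongr
  rw [map_measureReal_apply_of_aemeasurable hY (s := {x : ℝ | r < |x|})
    (measurableSet_lt measurable_const measurable_abs)] at h1
  have h3 : P.real {ω | r < |Y ω|} ≤ 2 * c * (2 / r) ^ α := by
    refine h1.trans ?_
    have h4 : |2 * r⁻¹ - (-2 * r⁻¹)| = 4 * r⁻¹ := by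
      rw [abs_of_pos (by have := inv_pos.2 hr; linarith)]; ring
    rw [h4] at h2
    calc _ ≤ 2⁻¹ * r * (c * (2 / r) ^ α * (4 * r⁻¹)) := by gcongr
      _ = _ := by field_simp; ring
  rw [← ENNReal.ofReal_toReal (measure_ne_top P {ω | r < |Y ω|})]
  exact ENNReal.ofReal_le_ofReal h3

lemma ae_eq_zero_of_forall_measure_lt_abs {Ω : Type*} [MeasurableSpace Ω] {P : Measure Ω}
    {Y : Ω → ℝ} (h : ∀ r > 0, P {ω | r < |Y ω|} = 0) :
    ∀ᵐ ω ∂P, Y ω = 0 := by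
  have h1 : ∀ᵐ ω ∂P, ∀ n : ℕ, |Y ω| ≤ 1 / ((n : ℝ) + 1) := by
    rw [ae_all_iff]
    intro n
    have := h (1 / ((n : ℝ) + 1)) Nat.one_div_pos_of_nat
    rw [ae_iff]
    simpa only [not_le] using this
  filter_upwards [h1] with ω hω
  have : |Y ω| ≤ 0 := ge_of_tendsto' tendsto_one_div_add_atTop_nhds_zero_nat hω
  exact abs_nonpos_iff.1 this

lemma norm_one_sub_prod_le_sum {ι : Type*} (s : Finset ι) (z : ι → ℂ) (hz : ∀ i, ‖z i‖ ≤ 1) :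
    ‖1 - ∏ i ∈ s, z i‖ ≤ ∑ i ∈ s, ‖1 - z i‖ := by
  classical
  induction s using Finset.induction_on with
  | empty => simp
  | insert i s hi ih =>
    rw [Finset.prod_insert hi, Finset.sum_insert hi]
    have : 1 - z i * ∏ j ∈ s, z j = (1 - z i) + z i * (1 - ∏ j ∈ s, z j) := by ring
    rw [this]
    refine (norm_add_le _ _).trans (add_le_add_right ?_ _)
    rw [norm_mul]
    exact (mul_le_of_le_one_left (norm_nonneg _) (hz i)).trans ih

/-! ### Additivity of the random measure and of integrals of simple functions -/

section RandomMeasure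

variable {Ω : Type*} [MeasurableSpace Ω] {P : Measure Ω}
  {α β : ℝ} {M : Set ℝ → Ω → ℝ}

lemma IsStableRandomMeasure.measure_lt_abs_le [IsProbabilityMeasure P]
    (hM : IsStableRandomMeasure P α β M) (hα : 0 < α)
    (hβ : β ∈ Icc (-1 : ℝ) 1) {A : Set ℝ} (hA : MeasurableSet A) (hA' : volume A < ∞) {r : ℝ}
    (hr : 0 < r) :
    P {ω | r < |M A ω|} ≤
      ENNReal.ofReal (2 * (stableConst α * (volume A).toReal) * (2 / r) ^ α) := by
  refine measure_lt_abs_le_of_charFun (hM.measurable A hA hA').aemeasurable hα (fun θ => ?_) hr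
  rw [hM.charFun_eq A hA hA']
  exact norm_one_sub_stableCharFun_le hβ ENNReal.toReal_nonneg θ

lemma IsStableRandomMeasure.ae_eq_zero [IsProbabilityMeasure P]
    (hM : IsStableRandomMeasure P α β M) (hα : 0 < α)
    (hβ : β ∈ Icc (-1 : ℝ) 1) {A : Set ℝ} (hA : MeasurableSet A) (hA' : volume A = 0) :
    ∀ᵐ ω ∂P, M A ω = 0 := by
  refine ae_eq_zero_of_forall_measure_lt_abs fun r hr => ?_
  have := hM.measure_lt_abs_le hα hβ hA (by simp [hA']) hr
  simpa [hA'] using this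

lemma IsStableRandomMeasure.ae_union [IsProbabilityMeasure P]
    (hM : IsStableRandomMeasure P α β M) (hα : 0 < α)
    (hβ : β ∈ Icc (-1 : ℝ) 1) {A B : Set ℝ} (hA : MeasurableSet A) (hA' : volume A < ∞)
    (hB : MeasurableSet B) (hB' : volume B < ∞) (hAB : Disjoint A B) :
    ∀ᵐ ω ∂P, M (A ∪ B) ω = M A ω + M B ω := by
  let S : ℕ → Set ℝ := fun i => if i = 0 then A else if i = 1 then B else ∅
  have hS : (⋃ i, S i) = A ∪ B := by
    ext x
    simp only [mem_iUnion, mem_union, S]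
    constructor
    · rintro ⟨i, hi⟩
      split_ifs at hi
      · exact Or.inl hi
      · exact Or.inr hi
      · exact hi.elim
    · rintro (h | h)
      · exact ⟨0, by simpa using h⟩
      · exact ⟨1, by simpa using h⟩
  have h1 := hM.sigma_additive S
    (fun i => by simp only [S]; split_ifs <;> [exact hA; exact hB; exact MeasurableSet.empty])
    (by rw [hS]; exact measure_union_lt_top hA' hB')
    (by
      intro i j hij
      simp only [S]
      split_ifs <;> first | omega | exact hAB | exact hAB.symm | simp)
  rw [hS] at h1
  have h0 := hM.ae_eq_zero hα hβ MeasurableSet.empty (by simp)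
  filter_upwards [h1, h0] with ω h1 h0
  refine tendsto_nhds_unique h1 (tendsto_const_nhds.congr' ?_)
  filter_upwards [eventually_ge_atTop 2] with n hn
  obtain ⟨m, rfl⟩ := Nat.exists_eq_add_of_le hn
  rw [Finset.sum_range_add, Finset.sum_range_succ, Finset.sum_range_one]
  have h2 : ∀ x ∈ Finset.range m, M (S (2 + x)) ω = 0 := fun x _ => by
    simp only [S, if_neg (show 2 + x ≠ 0 by omega), if_neg (show 2 + x ≠ 1 by omega), h0]
  rw [Finset.sum_eq_zero h2]
  simp [S]

lemma IsStableRandomMeasure.ae_biUnion [IsProbabilityMeasure P]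
    (hM : IsStableRandomMeasure P α β M) (hα : 0 < α)
    (hβ : β ∈ Icc (-1 : ℝ) 1) {ι : Type*} (s : Finset ι) (A : ι → Set ℝ)
    (hA : ∀ i ∈ s, MeasurableSet (A i)) (hA' : ∀ i ∈ s, volume (A i) < ∞)
    (hd : (s : Set ι).PairwiseDisjoint A) :
    ∀ᵐ ω ∂P, M (⋃ i ∈ s, A i) ω = ∑ i ∈ s, M (A i) ω := by
  classical
  induction s using Finset.induction_on with
  | empty => simpa using hM.ae_eq_zero hα hβ MeasurableSet.empty (by simp)
  | insert i s hi ih =>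
    rw [Finset.coe_insert] at hd
    have ih := ih (fun j hj => hA j (Finset.mem_insert_of_mem hj))
      (fun j hj => hA' j (Finset.mem_insert_of_mem hj)) (hd.subset (subset_insert _ _))
    have h := hM.ae_union hα hβ (hA i (Finset.mem_insert_self _ _))
      (hA' i (Finset.mem_insert_self _ _))
      (B := ⋃ j ∈ s, A j)
      (Finset.measurableSet_biUnion s fun j hj => hA j (Finset.mem_insert_of_mem hj))
      ((measure_biUnion_finset_le s A).trans_lt (ENNReal.sum_lt_top.2
        fun j hj => hA' j (Finset.mem_insert_of_mem hj)))
      (by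
        simp only [disjoint_iUnion_right]
        intro j hj
        exact hd (mem_insert _ _) (mem_insert_of_mem _ hj) (by rintro rfl; exact hi hj))
    filter_upwards [ih, h] with ω h1 h2
    rw [Finset.set_biUnion_insert, h2, h1, Finset.sum_insert hi]

/-- The value of `simpleStableIntegral` may be computed along any finer partition. -/
lemma IsStableRandomMeasure.simpleStableIntegral_map [IsProbabilityMeasure P]
    (hM : IsStableRandomMeasure P α β M)
    (hα : 0 < α) (hβ : β ∈ Icc (-1 : ℝ) 1) {ι : Type*} (p : SimpleFunc ℝ ι) (φ : ι → ℝ)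
    (hp : ∀ b, φ b ≠ 0 → volume (p ⁻¹' {b}) < ∞) :
    ∀ᵐ ω ∂P, simpleStableIntegral M (p.map φ) ω = ∑ b ∈ p.range, φ b * M (p ⁻¹' {b}) ω := by
  classical
  have h : ∀ c : ℝ, ∀ᵐ ω ∂P, c * M ((p.map φ) ⁻¹' {c}) ω =
      ∑ b ∈ p.range with φ b = c, φ b * M (p ⁻¹' {b}) ω := by
    intro c
    rcases eq_or_ne c 0 with rfl | hc
    · refine Eventually.of_forall fun ω => ?_
      rw [zero_mul, Finset.sum_eq_zero]
      intro b hb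
      rw [(Finset.mem_filter.1 hb).2, zero_mul]
    · have h1 := hM.ae_biUnion hα hβ (p.range.filter fun b => φ b = c) (fun b => p ⁻¹' {b})
        (fun b _ => p.measurableSet_fiber b)
        (fun b hb => hp b (by rw [(Finset.mem_filter.1 hb).2]; exact hc))
        (fun i _ j _ hij => Disjoint.preimage _ (by simpa using hij))
      have h2 : (p.map φ) ⁻¹' {c} = ⋃ b ∈ p.range.filter fun b => φ b = c, p ⁻¹' {b} := by
        ext x
        simp
      filter_upwards [h1] with ω hω
      rw [h2, hω, Finset.mul_sum]
      refine Finset.sum_congr rfl fun b hb => ?_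
      rw [(Finset.mem_filter.1 hb).2]
  have h' : ∀ᵐ ω ∂P, ∀ c ∈ (p.map φ).range, c * M ((p.map φ) ⁻¹' {c}) ω =
      ∑ b ∈ p.range with φ b = c, φ b * M (p ⁻¹' {b}) ω :=
    (Finset.eventually_all _).2 fun c _ => h c
  filter_upwards [h'] with ω hω
  rw [simpleStableIntegral, Finset.sum_congr rfl hω, SimpleFunc.range_map]
  exact Finset.sum_fiberwise_of_maps_to (fun b hb => Finset.mem_image_of_mem φ hb) _

lemma simpleStableIntegral_eq_sum_filter {Ω : Type*} (M : Set ℝ → Ω → ℝ) (g : SimpleFunc ℝ ℝ)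
    (ω : Ω) :
    simpleStableIntegral M g ω = ∑ c ∈ g.range with c ≠ 0, c * M (g ⁻¹' {c}) ω := by
  rw [simpleStableIntegral, Finset.sum_filter_of_ne]
  intro c _ h
  exact left_ne_zero_of_mul h

lemma IsStableRandomMeasure.measurable_simpleStableIntegral (hM : IsStableRandomMeasure P α β M)
    (hα : 0 < α) {g : SimpleFunc ℝ ℝ} (hg : MemLp g (ENNReal.ofReal α) volume) :
    Measurable (simpleStableIntegral M g) := by
  have : simpleStableIntegral M g =
      fun ω => ∑ c ∈ g.range with c ≠ 0, c * M (g ⁻¹' {c}) ω :=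
    funext fun ω => simpleStableIntegral_eq_sum_filter M g ω
  rw [this]
  refine Finset.measurable_fun_sum _ fun c hc => ?_
  exact (hM.measurable _ (g.measurableSet_fiber c)
    (SimpleFunc.measure_preimage_lt_top_of_memLp (by simpa using hα) (by simp) g hg c
      (Finset.mem_filter.1 hc).2)).const_mul c

lemma IsStableRandomMeasure.iIndepFun_finset (hM : IsStableRandomMeasure P α β M)
    {ι : Type*} (s : Finset ι) (A : ι → Set ℝ) (hA : ∀ i ∈ s, MeasurableSet (A i))
    (hA' : ∀ i ∈ s, volume (A i) < ∞) (hd : (s : Set ι).PairwiseDisjoint A) :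
    iIndepFun (fun i : s => M (A i)) P := by
  have h := hM.indep s.card (fun k => A (s.equivFin.symm k)) (fun k => hA _ (s.equivFin.symm k).2)
    (fun k => hA' _ (s.equivFin.symm k).2) (fun i j hij => hd (s.equivFin.symm i).2
      (s.equivFin.symm j).2 (by simpa [Subtype.ext_iff] using hij))
  have h2 := h.precomp (g := s.equivFin) s.equivFin.injective
  simpa using h2

lemma sum_abs_rpow_mul_measure (hα : 0 < α) {g : SimpleFunc ℝ ℝ}
    (hg : MemLp g (ENNReal.ofReal α) volume) :
    ∑ c ∈ g.range with c ≠ 0, |c| ^ α * (volume (g ⁻¹' {c})).toReal =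
      (eLpNorm g (ENNReal.ofReal α) volume ^ α).toReal := by
  have h1 : eLpNorm g (ENNReal.ofReal α) volume ^ α = ∫⁻ x, ‖g x‖ₑ ^ α := by
    rw [eLpNorm_eq_lintegral_rpow_enorm_toReal (by simpa using hα) (by simp),
      ENNReal.toReal_ofReal hα.le, ← ENNReal.rpow_mul, one_div, inv_mul_cancel₀ hα.ne',
      ENNReal.rpow_one]
  have h2 : ∫⁻ x, ‖g x‖ₑ ^ α = ∑ c ∈ g.range, ‖c‖ₑ ^ α * volume (g ⁻¹' {c}) := by
    rw [← SimpleFunc.map_lintegral (fun c : ℝ => ‖c‖ₑ ^ α) g, ← SimpleFunc.lintegral_eq_lintegral]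
    rfl
  have h3 : ∑ c ∈ g.range, ‖c‖ₑ ^ α * volume (g ⁻¹' {c}) =
      ∑ c ∈ g.range with c ≠ 0, ‖c‖ₑ ^ α * volume (g ⁻¹' {c}) := by
    rw [Finset.sum_filter_of_ne]
    rintro c _ h rfl
    simp [hα] at h
  rw [h1, h2, h3, ENNReal.toReal_sum]
  · refine Finset.sum_congr rfl fun c _ => ?_
    rw [ENNReal.toReal_mul, ← ENNReal.toReal_rpow, toReal_enorm, Real.norm_eq_abs]
  · intro c hc
    refine ENNReal.mul_ne_top (ENNReal.rpow_ne_top_of_nonneg hα.le enorm_ne_top) ?_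
    exact (SimpleFunc.measure_preimage_lt_top_of_memLp (by simpa using hα) (by simp) g hg c
      (Finset.mem_filter.1 hc).2).ne

/-- The integral of a simple function has the tails of a stable law whose scale is its `L^α`
norm. -/
lemma IsStableRandomMeasure.measure_lt_abs_simpleStableIntegral_le [IsProbabilityMeasure P]
    (hM : IsStableRandomMeasure P α β M) (hα : 0 < α) (hβ : β ∈ Icc (-1 : ℝ) 1)
    {g : SimpleFunc ℝ ℝ} (hg : MemLp g (ENNReal.ofReal α) volume) {r : ℝ} (hr : 0 < r) :
    P {ω | r < |simpleStableIntegral M g ω|} ≤ ENNReal.ofReal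
      (2 * (stableConst α * (eLpNorm g (ENNReal.ofReal α) volume ^ α).toReal) * (2 / r) ^ α) := by
  refine measure_lt_abs_le_of_charFun
    (hM.measurable_simpleStableIntegral hα hg).aemeasurable hα (fun θ => ?_) hr
  set s := g.range.filter (fun c => c ≠ 0) with hs
  have hfin : ∀ c ∈ s, volume (g ⁻¹' {c}) < ∞ := fun c hc =>
    SimpleFunc.measure_preimage_lt_top_of_memLp (by simpa using hα) (by simp) g hg c
      (Finset.mem_filter.1 hc).2
  have hmeas : ∀ c ∈ s, Measurable (M (g ⁻¹' {c})) := fun c hc =>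
    hM.measurable _ (g.measurableSet_fiber c) (hfin c hc)
  have hind : iIndepFun (fun (c : s) ω => (c : ℝ) * M (g ⁻¹' {(c : ℝ)}) ω) P :=
    (hM.iIndepFun_finset s (fun c => g ⁻¹' {c}) (fun c _ => g.measurableSet_fiber c) hfin
      (fun i _ j _ hij => Disjoint.preimage _ (by simpa using hij))).comp
      (fun (c : s) x => (c : ℝ) * x) (fun c => measurable_const_mul _)
  have heq : simpleStableIntegral M g =
      fun ω => ∑ c : s, (c : ℝ) * M (g ⁻¹' {(c : ℝ)}) ω := by
    funext ω
    rw [simpleStableIntegral_eq_sum_filter, ← hs]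
    exact (Finset.sum_coe_sort s (fun c => c * M (g ⁻¹' {c}) ω)).symm
  have hcf := hind.charFun_map_fun_sum_eq_prod
    (fun c : s => ((hmeas c c.2).const_mul (c : ℝ)).aemeasurable)
  rw [heq, hcf, Finset.prod_apply]
  refine (norm_one_sub_prod_le_sum Finset.univ
    (fun c : s => charFun (P.map fun ω => (c : ℝ) * M (g ⁻¹' {(c : ℝ)}) ω) θ) fun c =>
    norm_charFun_map_le_one ((hmeas c c.2).const_mul _).aemeasurable θ).trans ?_
  rw [← sum_abs_rpow_mul_measure hα hg, ← hs, ← Finset.sum_coe_sort s, Finset.mul_sum,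
    Finset.sum_mul]
  refine Finset.sum_le_sum fun c _ => ?_
  rw [charFun_map_mul_comp (hmeas c c.2).aemeasurable,
    hM.charFun_eq _ (g.measurableSet_fiber _) (hfin c c.2)]
  refine (norm_one_sub_stableCharFun_le hβ ENNReal.toReal_nonneg _).trans_eq ?_
  rw [abs_mul, Real.mul_rpow (abs_nonneg _) (abs_nonneg _)]
  ring

lemma IsStableRandomMeasure.simpleStableIntegral_lincomb [IsProbabilityMeasure P]
    (hM : IsStableRandomMeasure P α β M)
    (hα : 0 < α) (hβ : β ∈ Icc (-1 : ℝ) 1) {g h : SimpleFunc ℝ ℝ}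
    (hg : MemLp g (ENNReal.ofReal α) volume) (hh : MemLp h (ENNReal.ofReal α) volume) (a b : ℝ) :
    ∀ᵐ ω ∂P, simpleStableIntegral M ((g.pair h).map fun x => a * x.1 + b * x.2) ω =
      a * simpleStableIntegral M g ω + b * simpleStableIntegral M h ω := by
  have hα' : ENNReal.ofReal α ≠ 0 := by simpa using hα
  have hfin : ∀ x : ℝ × ℝ, x.1 ≠ 0 ∨ x.2 ≠ 0 → volume ((g.pair h) ⁻¹' {x}) < ∞ := by
    rintro ⟨x, y⟩ hxy
    rw [SimpleFunc.pair_preimage_singleton]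
    rcases hxy with h1 | h1
    · exact (measure_mono inter_subset_left).trans_lt
        (SimpleFunc.measure_preimage_lt_top_of_memLp hα' (by simp) g hg x h1)
    · exact (measure_mono inter_subset_right).trans_lt
        (SimpleFunc.measure_preimage_lt_top_of_memLp hα' (by simp) h hh y h1)
  have h1 := hM.simpleStableIntegral_map hα hβ (g.pair h) (fun x => a * x.1 + b * x.2)
    (fun x hx => hfin x (by by_contra! hc; simp [hc.1, hc.2] at hx))
  have h2 := hM.simpleStableIntegral_map hα hβ (g.pair h) Prod.fst (fun x hx => hfin x (Or.inl hx))
  have h3 := hM.simpleStableIntegral_map hα hβ (g.pair h) Prod.snd (fun x hx => hfin x (Or.inr hx))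
  rw [SimpleFunc.map_fst_pair] at h2
  rw [SimpleFunc.map_snd_pair] at h3
  filter_upwards [h1, h2, h3] with ω h1 h2 h3
  rw [h1, h2, h3, Finset.mul_sum, Finset.mul_sum, ← Finset.sum_add_distrib]
  exact Finset.sum_congr rfl fun x _ => by ring

/-! ### The stochastic integral -/

lemma tendstoInMeasure_lincomb {F G : ℕ → Ω → ℝ} {f g : Ω → ℝ}
    (hF : TendstoInMeasure P F atTop f) (hG : TendstoInMeasure P G atTop g) (a b : ℝ) :
    TendstoInMeasure P (fun n ω => a * F n ω + b * G n ω) atTop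
      (fun ω => a * f ω + b * g ω) := by
  rw [tendstoInMeasure_iff_norm] at *
  intro ε hε
  set K := |a| + |b| + 1 with hK
  have hK0 : 0 < K := by positivity
  have h := (hF (ε / (2 * K)) (by positivity)).add (hG (ε / (2 * K)) (by positivity))
  rw [add_zero] at h
  refine tendsto_of_tendsto_of_tendsto_of_le_of_le tendsto_const_nhds h (fun _ => zero_le)
    (fun n => (measure_mono fun ω hω => ?_).trans (measure_union_le _ _))
  simp only [mem_ofPred_eq, mem_union, Real.norm_eq_abs] at hω ⊢
  by_contra! hc
  have h1 : a * F n ω + b * G n ω - (a * f ω + b * g ω) =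
      a * (F n ω - f ω) + b * (G n ω - g ω) := by ring
  have h2 : |a * (F n ω - f ω) + b * (G n ω - g ω)| ≤
      |a| * |F n ω - f ω| + |b| * |G n ω - g ω| := by
    rw [← abs_mul, ← abs_mul]; exact abs_add_le _ _
  have h3 : |a| * |F n ω - f ω| ≤ K * |F n ω - f ω| :=
    mul_le_mul_of_nonneg_right (by rw [hK]; linarith [abs_nonneg b]) (abs_nonneg _)
  have h4 : |b| * |G n ω - g ω| ≤ K * |G n ω - g ω| :=
    mul_le_mul_of_nonneg_right (by rw [hK]; linarith [abs_nonneg a]) (abs_nonneg _)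
  have h5 : K * |F n ω - f ω| < K * (ε / (2 * K)) := mul_lt_mul_of_pos_left hc.1 hK0
  have h6 : K * |G n ω - g ω| < K * (ε / (2 * K)) := mul_lt_mul_of_pos_left hc.2 hK0
  have h7 : K * (ε / (2 * K)) = ε / 2 := by field_simp
  rw [h1] at hω
  linarith

lemma IsStableIntegral.aemeasurable (hM : IsStableRandomMeasure P α β M) (hα : 0 < α)
    {f : ℝ → ℝ} {Y : Ω → ℝ} (h : IsStableIntegral P α M f Y) : AEMeasurable Y P := by
  obtain ⟨-, g, hg, -, hY⟩ := h
  exact hY.aemeasurable fun n => (hM.measurable_simpleStableIntegral hα (hg n)).aemeasurable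

lemma IsStableIntegral.congr {f f' : ℝ → ℝ} {Y Y' : Ω → ℝ} (h : IsStableIntegral P α M f Y)
    (hf : f =ᵐ[volume] f') (hY : Y =ᵐ[P] Y') : IsStableIntegral P α M f' Y' := by
  obtain ⟨hf1, g, hg, h1, h2⟩ := h
  refine ⟨hf1.ae_eq hf, g, hg, ?_, h2.congr_right hY⟩
  refine h1.congr fun n => eLpNorm_congr_ae ?_
  filter_upwards [hf] with u hu
  rw [hu]

lemma isStableIntegral_simpleFunc {g : SimpleFunc ℝ ℝ}
    (hg : MemLp g (ENNReal.ofReal α) volume) :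
    IsStableIntegral P α M g (simpleStableIntegral M g) := by
  refine ⟨hg, fun _ => g, fun _ => hg, by simp, ?_⟩
  rw [tendstoInMeasure_iff_norm]
  intro ε hε
  simp [hε.not_ge]

lemma IsStableIntegral.lincomb [IsProbabilityMeasure P] (hM : IsStableRandomMeasure P α β M)
    (hα : 1 ≤ α) (hβ : β ∈ Icc (-1 : ℝ) 1) {f f' : ℝ → ℝ} {Y Y' : Ω → ℝ}
    (h : IsStableIntegral P α M f Y) (h' : IsStableIntegral P α M f' Y') (a b : ℝ) :
    IsStableIntegral P α M (fun u => a * f u + b * f' u) (fun ω => a * Y ω + b * Y' ω) := by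
  obtain ⟨hf, g, hg, h1, h2⟩ := h
  obtain ⟨hf', g', hg', h1', h2'⟩ := h'
  have hα1 : 1 ≤ ENNReal.ofReal α := by simpa using hα
  refine ⟨(hf.const_mul a).add (hf'.const_mul b),
    fun n => ((g n).pair (g' n)).map fun x : ℝ × ℝ => a * x.1 + b * x.2,
    fun n => ?_, ?_, ?_⟩
  · exact ((hg n).const_mul a).add ((hg' n).const_mul b)
  · have h3 : Tendsto (fun n => ‖a‖ₑ * eLpNorm (fun u => f u - g n u) (ENNReal.ofReal α) volume +
        ‖b‖ₑ * eLpNorm (fun u => f' u - g' n u) (ENNReal.ofReal α) volume) atTop (𝓝 0) := by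
      have := (ENNReal.Tendsto.const_mul (a := ‖a‖ₑ) h1 (Or.inr enorm_ne_top)).add
        (ENNReal.Tendsto.const_mul (a := ‖b‖ₑ) h1' (Or.inr enorm_ne_top))
      simpa using this
    refine tendsto_of_tendsto_of_tendsto_of_le_of_le tendsto_const_nhds h3 (fun _ => zero_le)
      (fun n => ?_)
    have h4 : (fun u => a * f u + b * f' u -
        (((g n).pair (g' n)).map fun x => a * x.1 + b * x.2) u) =
        (a • fun u => f u - g n u) + (b • fun u => f' u - g' n u) := by
      funext u
      simp only [SimpleFunc.map_apply, SimpleFunc.pair_apply, Pi.add_apply, Pi.smul_apply,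
        smul_eq_mul]
      ring
    rw [h4]
    refine (eLpNorm_add_le ((hf.sub (hg n)).1.const_smul a) ((hf'.sub (hg' n)).1.const_smul b)
      hα1).trans_eq ?_
    rw [eLpNorm_const_smul, eLpNorm_const_smul]
    rfl
  · refine (tendstoInMeasure_lincomb h2 h2' a b).congr_left fun n => ?_
    filter_upwards [hM.simpleStableIntegral_lincomb (by linarith) hβ (hg n) (hg' n) a b] with ω hω
    exact hω.symm

/-- The stochastic integral is well defined: the limit does not depend on the approximation. -/
lemma IsStableIntegral.ae_unique [IsProbabilityMeasure P] (hM : IsStableRandomMeasure P α β M)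
    (hα : 1 ≤ α) (hβ : β ∈ Icc (-1 : ℝ) 1) {f : ℝ → ℝ} {Y Y' : Ω → ℝ}
    (h : IsStableIntegral P α M f Y) (h' : IsStableIntegral P α M f Y') : Y =ᵐ[P] Y' := by
  have hα0 : 0 < α := by linarith
  obtain ⟨-, g, hg, h1, h2⟩ := (h.lincomb hM hα hβ h' 1 (-1)).congr (f' := fun _ => 0)
    (Y' := fun ω => Y ω - Y' ω) (Eventually.of_forall fun u => by simp)
    (Eventually.of_forall fun ω => by simp [sub_eq_add_neg])
  have h1' : Tendsto (fun n => eLpNorm (g n) (ENNReal.ofReal α) volume) atTop (𝓝 0) := by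
    refine h1.congr fun n => ?_
    rw [← eLpNorm_neg]
    congr 1
    funext u
    simp
  have h3 : TendstoInMeasure P (fun n => simpleStableIntegral M (g n)) atTop (fun _ => 0) := by
    rw [tendstoInMeasure_iff_norm]
    intro ε hε
    have h4 : Tendsto (fun n => ENNReal.ofReal (2 * (stableConst α *
        (eLpNorm (g n) (ENNReal.ofReal α) volume ^ α).toReal) * (2 / (ε / 2)) ^ α))
        atTop (𝓝 0) := by
      have h5 := (ENNReal.continuous_rpow_const (y := α)).tendsto 0 |>.comp h1'
      rw [ENNReal.zero_rpow_of_pos hα0] at h5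
      have h6 := (ENNReal.tendsto_toReal ENNReal.zero_ne_top).comp h5
      have h7 := ENNReal.tendsto_ofReal
        (((h6.const_mul (stableConst α)).const_mul 2).mul_const ((2 / (ε / 2)) ^ α))
      simpa using h7
    refine tendsto_of_tendsto_of_tendsto_of_le_of_le tendsto_const_nhds h4 (fun _ => zero_le)
      (fun n => (measure_mono fun ω hω => ?_).trans
        (hM.measure_lt_abs_simpleStableIntegral_le hα0 hβ (hg n) (half_pos hε)))
    simp only [mem_ofPred_eq, sub_zero, Real.norm_eq_abs] at hω ⊢
    linarith
  filter_upwards [tendstoInMeasure_ae_unique h2 h3] with ω hω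
  exact sub_eq_zero.1 hω

/-- The stochastic integral is closed under `L^α` convergence of the integrands together with
almost sure convergence of the integrals. -/
lemma IsStableIntegral.of_tendsto [IsProbabilityMeasure P]
    (hM : IsStableRandomMeasure P α β M) (hα : 1 ≤ α)
    {f : ℕ → ℝ → ℝ} {f' : ℝ → ℝ} {Y : ℕ → Ω → ℝ} {Y' : Ω → ℝ}
    (h : ∀ n, IsStableIntegral P α M (f n) (Y n)) (hf' : MemLp f' (ENNReal.ofReal α) volume)
    (hf : Tendsto (fun n => eLpNorm (fun u => f' u - f n u) (ENNReal.ofReal α) volume)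
      atTop (𝓝 0))
    (hY : ∀ᵐ ω ∂P, Tendsto (fun n => Y n ω) atTop (𝓝 (Y' ω))) :
    IsStableIntegral P α M f' Y' := by
  have hα0 : 0 < α := by linarith
  have hα1 : 1 ≤ ENNReal.ofReal α := by simpa using hα
  have key : ∀ n : ℕ, ∃ g : SimpleFunc ℝ ℝ, MemLp g (ENNReal.ofReal α) volume ∧
      eLpNorm (fun u => f n u - g u) (ENNReal.ofReal α) volume ≤ ENNReal.ofReal (1 / (n + 1)) ∧
      P {ω | 1 / ((n : ℝ) + 1) ≤ ‖simpleStableIntegral M g ω - Y n ω‖} ≤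
        ENNReal.ofReal (1 / (n + 1)) := by
    intro n
    obtain ⟨-, g, hg, h1, h2⟩ := h n
    rw [tendstoInMeasure_iff_norm] at h2
    have hpos : (0 : ℝ) < 1 / ((n : ℝ) + 1) := Nat.one_div_pos_of_nat
    have hpos' : (0 : ℝ≥0∞) < ENNReal.ofReal (1 / ((n : ℝ) + 1)) := ENNReal.ofReal_pos.2 hpos
    obtain ⟨k, hk1, hk2⟩ := ((h1.eventually (Iic_mem_nhds hpos')).and
      ((h2 _ hpos).eventually (Iic_mem_nhds hpos'))).exists
    exact ⟨g k, hg k, hk1, hk2⟩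
  choose g hg hg1 hg2 using key
  have hz : Tendsto (fun n : ℕ => ENNReal.ofReal (1 / ((n : ℝ) + 1))) atTop (𝓝 0) := by
    simpa using ENNReal.tendsto_ofReal (tendsto_one_div_add_atTop_nhds_zero_nat (𝕜 := ℝ))
  refine ⟨hf', g, hg, ?_, ?_⟩
  · have h3 := hf.add hz
    rw [add_zero] at h3
    refine tendsto_of_tendsto_of_tendsto_of_le_of_le tendsto_const_nhds h3 (fun _ => zero_le)
      (fun n => ?_)
    have h4 : (fun u => f' u - g n u) = (fun u => f' u - f n u) + fun u => f n u - g n u := by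
      funext u; simp
    rw [h4]
    exact (eLpNorm_add_le (hf'.sub (h n).1).1 ((h n).1.sub (hg n)).1 hα1).trans
      (add_le_add le_rfl (hg1 n))
  · have h5 : TendstoInMeasure P Y atTop Y' :=
      tendstoInMeasure_of_tendsto_ae
        (fun n => ((h n).aemeasurable hM hα0).aestronglyMeasurable) hY
    have h6 : TendstoInMeasure P (fun n ω => simpleStableIntegral M (g n) ω - Y n ω) atTop
        (fun _ => 0) := by
      rw [tendstoInMeasure_iff_norm]
      intro ε hε
      refine tendsto_of_tendsto_of_tendsto_of_le_of_le' tendsto_const_nhds hz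
        (Eventually.of_forall fun _ => zero_le) ?_
      filter_upwards [(tendsto_one_div_add_atTop_nhds_zero_nat (𝕜 := ℝ)).eventually
        (Iic_mem_nhds hε)] with n hn
      refine (measure_mono fun ω hω => ?_).trans (hg2 n)
      simp only [mem_ofPred_eq, sub_zero] at hω hn ⊢
      exact hn.trans hω
    have h7 := tendstoInMeasure_lincomb h5 h6 1 1
    simpa using h7

end RandomMeasure

/-! ### One-sided limits along the dyadic rationals -/

/-- The dyadic rationals, as a set of real numbers. -/
def dyadicSet : Set ℝ := {x | ∃ (m : ℕ) (j : ℤ), x = j / 2 ^ m}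

lemma dense_dyadicSet : Dense dyadicSet := by
  refine dense_of_exists_between fun a b hab => ?_
  obtain ⟨m, hm⟩ := pow_unbounded_of_one_lt (1 / (b - a)) (one_lt_two (α := ℝ))
  have h2 : (0 : ℝ) < 2 ^ m := by positivity
  have hba : 0 < b - a := sub_pos.2 hab
  rw [div_lt_iff₀ hba] at hm
  refine ⟨(⌊a * 2 ^ m⌋ + 1 : ℤ) / 2 ^ m, ⟨m, _, rfl⟩, ?_, ?_⟩
  · rw [lt_div_iff₀ h2]
    push_cast
    exact Int.lt_floor_add_one _
  · rw [div_lt_iff₀ h2]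
    push_cast
    have := Int.floor_le (a * 2 ^ m)
    nlinarith

lemma neBot_nhdsWithin_dyadicSet_Ioi (t : ℝ) : (𝓝[dyadicSet ∩ Ioi t] t).NeBot := by
  rw [← mem_closure_iff_nhdsWithin_neBot, inter_comm]
  have := closure_mono (dense_dyadicSet.open_subset_closure_inter (isOpen_Ioi (a := t)))
  rw [closure_closure, closure_Ioi] at this
  exact this self_mem_Ici

lemma neBot_nhdsWithin_dyadicSet_Iio (t : ℝ) : (𝓝[dyadicSet ∩ Iio t] t).NeBot := by
  rw [← mem_closure_iff_nhdsWithin_neBot, inter_comm]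
  have := closure_mono (dense_dyadicSet.open_subset_closure_inter (isOpen_Iio (a := t)))
  rw [closure_closure, closure_Iio] at this
  exact this self_mem_Iic

lemma dyadicSet_common_level {s : ℝ} (hs : s ∈ dyadicSet) :
    ∃ m₀ : ℕ, ∀ m ≥ m₀, ∃ j : ℤ, s = j / 2 ^ m := by
  obtain ⟨m₀, j, rfl⟩ := hs
  refine ⟨m₀, fun m hm => ?_⟩
  obtain ⟨i, rfl⟩ := Nat.exists_eq_add_of_le hm
  refine ⟨j * 2 ^ i, ?_⟩
  push_cast
  rw [pow_add]
  field_simp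

/-- A function on the dyadics has a left limit at `t` as soon as, close to `t` on the left, one of
the two increments over any two adjacent intervals is small: after one large increment, all later
values stay close to each other. -/
lemma exists_tendsto_left_of_min_le {X : ℝ → ℝ} {t : ℝ}
    (h : ∀ ε > 0, ∃ δ > 0, ∀ s ∈ dyadicSet, ∀ r ∈ dyadicSet, ∀ u ∈ dyadicSet,
      t - δ < s → s ≤ r → r ≤ u → u < t → min |X r - X s| |X u - X r| ≤ ε) :
    ∃ l, Tendsto X (𝓝[dyadicSet ∩ Iio t] t) (𝓝 l) := by
  have hne := neBot_nhdsWithin_dyadicSet_Iio t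
  have hc : Cauchy (map X (𝓝[dyadicSet ∩ Iio t] t)) := by
    rw [Metric.cauchy_iff]
    refine ⟨inferInstance, fun ε hε => ?_⟩
    by_contra! hcon
    have key : ∀ a < t, ∃ r₁ ∈ dyadicSet, ∃ r₂ ∈ dyadicSet, a < r₁ ∧ r₁ ≤ r₂ ∧ r₂ < t ∧
        ε ≤ |X r₂ - X r₁| := by
      intro a ha
      have hmem : X '' (dyadicSet ∩ Iio t ∩ Ioi a) ∈ map X (𝓝[dyadicSet ∩ Iio t] t) :=
        image_mem_map (inter_mem self_mem_nhdsWithin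
          (mem_nhdsWithin_of_mem_nhds (Ioi_mem_nhds ha)))
      obtain ⟨_, ⟨x, ⟨⟨hx1, hx2⟩, hx3⟩, rfl⟩, _, ⟨y, ⟨⟨hy1, hy2⟩, hy3⟩, rfl⟩, hxy⟩ := hcon _ hmem
      rw [Real.dist_eq] at hxy
      rcases le_total x y with hle | hle
      · exact ⟨x, hx1, y, hy1, hx3, hle, hy2, by rwa [abs_sub_comm]⟩
      · exact ⟨y, hy1, x, hx1, hy3, hle, hx2, hxy⟩
    obtain ⟨δ, hδ, hmin⟩ := h (ε / 3) (by positivity)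
    obtain ⟨r₁, h1, r₂, h2, ha1, h12, h2t, hbig⟩ := key (t - δ) (by linarith)
    obtain ⟨r₃, h3, r₄, h4, h23, h34, h4t, hbig'⟩ := key r₂ h2t
    have e3 := hmin r₁ h1 r₂ h2 r₃ h3 ha1 h12 h23.le (by linarith)
    have e4 := hmin r₁ h1 r₂ h2 r₄ h4 ha1 h12 (by linarith) h4t
    rw [min_le_iff] at e3 e4
    have e3' : |X r₃ - X r₂| ≤ ε / 3 := e3.resolve_left (by linarith)
    have e4' : |X r₄ - X r₂| ≤ ε / 3 := e4.resolve_left (by linarith)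
    have := abs_sub_le (X r₄) (X r₂) (X r₃)
    rw [abs_sub_comm (X r₂)] at this
    linarith
  exact CompleteSpace.complete hc

lemma exists_tendsto_right_of_min_le {X : ℝ → ℝ} {t : ℝ}
    (h : ∀ ε > 0, ∃ δ > 0, ∀ s ∈ dyadicSet, ∀ r ∈ dyadicSet, ∀ u ∈ dyadicSet,
      t < s → s ≤ r → r ≤ u → u < t + δ → min |X r - X s| |X u - X r| ≤ ε) :
    ∃ l, Tendsto X (𝓝[dyadicSet ∩ Ioi t] t) (𝓝 l) := by
  have hneg : ∀ x ∈ dyadicSet, -x ∈ dyadicSet := by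
    rintro _ ⟨m, j, rfl⟩
    exact ⟨m, -j, by push_cast; ring⟩
  obtain ⟨l, hl⟩ := exists_tendsto_left_of_min_le (X := fun x => X (-x)) (t := -t) (by
    intro ε hε
    obtain ⟨δ, hδ, H⟩ := h ε hε
    refine ⟨δ, hδ, fun s hs r hr u hu h1 h2 h3 h4 => ?_⟩
    have := H (-u) (hneg u hu) (-r) (hneg r hr) (-s) (hneg s hs) (by linarith) (by linarith)
      (by linarith) (by linarith)
    rwa [min_comm, abs_sub_comm (X (-r)), abs_sub_comm (X (-u))])
  refine ⟨l, ?_⟩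
  have hmap : Tendsto (fun x : ℝ => -x) (𝓝[dyadicSet ∩ Ioi t] t)
      (𝓝[dyadicSet ∩ Iio (-t)] (-t)) := by
    refine tendsto_nhdsWithin_iff.2
      ⟨(continuous_neg.tendsto t).mono_left nhdsWithin_le_nhds, ?_⟩
    filter_upwards [self_mem_nhdsWithin] with x hx
    exact ⟨hneg x hx.1, mem_Iio.2 (neg_lt_neg (mem_Ioi.1 hx.2))⟩
  have := hl.comp hmap
  simpa [Function.comp_def] using this

/-- The right limit of `X` along the dyadics. -/
noncomputable def dyadicRightLim (X : ℝ → ℝ) (t : ℝ) : ℝ :=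
  limUnder (𝓝[dyadicSet ∩ Ioi t] t) X

lemma tendsto_dyadicRightLim {X : ℝ → ℝ} {t : ℝ}
    (h : ∃ l, Tendsto X (𝓝[dyadicSet ∩ Ioi t] t) (𝓝 l)) :
    Tendsto X (𝓝[dyadicSet ∩ Ioi t] t) (𝓝 (dyadicRightLim X t)) :=
  tendsto_nhds_limUnder h

lemma isCadlagPath_dyadicRightLim {X : ℝ → ℝ}
    (hr : ∀ t, ∃ l, Tendsto X (𝓝[dyadicSet ∩ Ioi t] t) (𝓝 l))
    (hl : ∀ t, ∃ l, Tendsto X (𝓝[dyadicSet ∩ Iio t] t) (𝓝 l)) :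
    IsCadlagPath (dyadicRightLim X) := by
  -- values of `X` on the dyadics of an open interval control the right limits in that interval
  have key : ∀ a b c ε : ℝ, (∀ r ∈ dyadicSet, a < r → r < b → |X r - c| ≤ ε) →
      ∀ s, a ≤ s → s < b → |dyadicRightLim X s - c| ≤ ε := by
    intro a b c ε hX s hs1 hs2
    have := neBot_nhdsWithin_dyadicSet_Ioi s
    refine le_of_tendsto ((tendsto_dyadicRightLim (hr s)).sub_const c).abs ?_
    filter_upwards [self_mem_nhdsWithin, mem_nhdsWithin_of_mem_nhds (Iio_mem_nhds hs2)]
      with r hr1 hr2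
    exact hX r hr1.1 (lt_of_le_of_lt hs1 hr1.2) hr2
  intro t
  constructor
  · rw [Metric.continuousWithinAt_iff]
    intro ε hε
    have h1 := (Metric.tendsto_nhds.1 (tendsto_dyadicRightLim (hr t))) (ε / 2) (by positivity)
    obtain ⟨δ, hδ, h2⟩ := Metric.mem_nhdsWithin_iff.1 h1
    refine ⟨δ, hδ, fun s hs hst => ?_⟩
    rw [Real.dist_eq] at hst ⊢
    rw [mem_Ici] at hs
    refine (key t (t + δ) _ (ε / 2) (fun r hr1 hr2 hr3 => ?_) s hs ?_).trans_lt (by linarith)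
    · have : r ∈ Metric.ball t δ ∩ (dyadicSet ∩ Ioi t) :=
        ⟨by rw [Metric.mem_ball, Real.dist_eq, abs_of_pos (by linarith)]; linarith, hr1, hr2⟩
      have := h2 this
      rw [mem_ofPred_eq, Real.dist_eq] at this
      exact this.le
    · rw [abs_of_nonneg (by linarith)] at hst
      linarith
  · obtain ⟨l, hl⟩ := hl t
    refine ⟨l, Metric.tendsto_nhdsWithin_nhds.2 fun ε hε => ?_⟩
    have h1 := (Metric.tendsto_nhds.1 hl) (ε / 2) (by positivity)
    obtain ⟨δ, hδ, h2⟩ := Metric.mem_nhdsWithin_iff.1 h1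
    refine ⟨δ, hδ, fun s hs hst => ?_⟩
    rw [Real.dist_eq] at hst ⊢
    rw [mem_Iio] at hs
    rw [abs_sub_comm, abs_of_pos (by linarith)] at hst
    refine (key (t - δ) t _ (ε / 2) (fun r hr1 hr2 hr3 => ?_) s (by linarith) hs).trans_lt
      (by linarith)
    have : r ∈ Metric.ball t δ ∩ (dyadicSet ∩ Iio t) :=
      ⟨by rw [Metric.mem_ball, Real.dist_eq, abs_sub_comm, abs_of_pos (by linarith)]; linarith,
        hr1, hr3⟩
    have := h2 this
    rw [mem_ofPred_eq, Real.dist_eq] at this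
    exact this.le

/-! ### Chaining over dyadic intervals -/

/-- Chaining inside one dyadic cell. Here `x m j` stands for the value of a function at `j / 2 ^ m`.
If at each level one of the two half-cell increments is small, a point of level `n + i + 1` can be
moved to a neighbouring point of level `n + i` at small cost. After `i` moves only the end points
of the cell remain, so that two of the three points coincide. -/
lemma min_abs_sub_le_of_chain {x : ℕ → ℤ → ℝ} (hx : ∀ m j, x (m + 1) (2 * j) = x m j)
    {c : ℕ → ℝ} (hc : ∀ m, 0 ≤ c m) {n : ℕ} {k : ℤ}
    (h : ∀ (i : ℕ) (j : ℤ), k * 2 ^ i ≤ j → j < (k + 1) * 2 ^ i →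
      min |x (n + i + 1) (2 * j + 1) - x (n + i + 1) (2 * j)|
        |x (n + i + 1) (2 * j + 2) - x (n + i + 1) (2 * j + 1)| ≤ c (n + i + 1)) (i : ℕ) :
    ∀ j₁ j₂ j₃ : ℤ, k * 2 ^ i ≤ j₁ → j₁ ≤ j₂ → j₂ ≤ j₃ → j₃ ≤ (k + 1) * 2 ^ i →
      min |x (n + i) j₂ - x (n + i) j₁| |x (n + i) j₃ - x (n + i) j₂| ≤
        2 * ∑ l ∈ Finset.range i, c (n + l + 1) := by
  induction i with
  | zero =>
    intro j₁ j₂ j₃ h1 h2 h3 h4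
    have : j₁ = j₂ ∨ j₂ = j₃ := by simp at h1 h4; omega
    rcases this with rfl | rfl <;> simp
  | succ i ih =>
    intro j₁ j₂ j₃ h1 h2 h3 h4
    have hnn : 0 ≤ 2 * ∑ l ∈ Finset.range (i + 1), c (n + l + 1) :=
      mul_nonneg zero_le_two (Finset.sum_nonneg fun l _ => hc _)
    rcases h2.eq_or_lt with rfl | h2
    · simpa using hnn
    rcases h3.eq_or_lt with rfl | h3
    · simpa using hnn
    rw [pow_succ] at h1 h4
    have move : ∀ j : ℤ, k * 2 ^ i * 2 ≤ j → j ≤ (k + 1) * 2 ^ i * 2 →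
        ∃ j' : ℤ, k * 2 ^ i ≤ j' ∧ j' ≤ (k + 1) * 2 ^ i ∧ j ≤ 2 * j' + 1 ∧ 2 * j' ≤ j + 1 ∧
          |x (n + (i + 1)) j - x (n + i) j'| ≤ c (n + i + 1) := by
      intro j hj1 hj2
      rcases Int.even_or_odd' j with ⟨l, rfl | rfl⟩
      · refine ⟨l, by linarith, by linarith, by omega, by omega, ?_⟩
        rw [← add_assoc, hx, sub_self, abs_zero]
        exact hc _
      · have hl1 : k * 2 ^ i ≤ l := by omega
        have hl2 : l < (k + 1) * 2 ^ i := by omega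
        rcases min_le_iff.1 (h i l hl1 hl2) with hs | hs
        · exact ⟨l, hl1, hl2.le, by omega, by omega, by rwa [← hx (n + i) l, ← add_assoc]⟩
        · refine ⟨l + 1, by omega, by omega, by omega, by omega, ?_⟩
          rw [← hx (n + i) (l + 1), ← add_assoc, abs_sub_comm, mul_add, mul_one]
          exact hs
    obtain ⟨i₁, a1, b1, c1, d1, e1⟩ := move j₁ (by linarith) (by linarith)
    obtain ⟨i₂, a2, b2, c2, d2, e2⟩ := move j₂ (by linarith) (by linarith)
    obtain ⟨i₃, a3, b3, c3, d3, e3⟩ := move j₃ (by linarith) (by linarith)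
    have := ih i₁ i₂ i₃ a1 (by omega) (by omega) b3
    rw [Finset.sum_range_succ, mul_add]
    rw [abs_le] at e1 e2 e3
    rcases min_le_iff.1 this with hs | hs
    · refine min_le_iff.2 (Or.inl ?_)
      rw [abs_le] at hs ⊢
      constructor <;> linarith
    · refine min_le_iff.2 (Or.inr ?_)
      rw [abs_le] at hs ⊢
      constructor <;> linarith

lemma min_abs_sub_le_of_dyadic_cell {X : ℝ → ℝ} {n : ℕ} {k : ℤ}
    (h : ∀ (i : ℕ) (j : ℤ), k * 2 ^ i ≤ j → j < (k + 1) * 2 ^ i →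
      min |X (((2 * j + 1 : ℤ) : ℝ) / 2 ^ (n + i + 1)) - X (((2 * j : ℤ) : ℝ) / 2 ^ (n + i + 1))|
        |X (((2 * j + 2 : ℤ) : ℝ) / 2 ^ (n + i + 1)) - X (((2 * j + 1 : ℤ) : ℝ) / 2 ^ (n + i + 1))|
        ≤ (9 / 10 : ℝ) ^ (n + i + 1))
    {s r u : ℝ} (hs : s ∈ dyadicSet) (hr : r ∈ dyadicSet) (hu : u ∈ dyadicSet)
    (h1 : (k : ℝ) / 2 ^ n ≤ s) (h2 : s ≤ r) (h3 : r ≤ u) (h4 : u ≤ ((k : ℝ) + 1) / 2 ^ n) :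
    min |X r - X s| |X u - X r| ≤ 20 * (9 / 10 : ℝ) ^ n := by
  obtain ⟨m₁, hm₁⟩ := dyadicSet_common_level hs
  obtain ⟨m₂, hm₂⟩ := dyadicSet_common_level hr
  obtain ⟨m₃, hm₃⟩ := dyadicSet_common_level hu
  set i := m₁ + m₂ + m₃
  obtain ⟨j₁, rfl⟩ := hm₁ (n + i) (by omega)
  obtain ⟨j₂, rfl⟩ := hm₂ (n + i) (by omega)
  obtain ⟨j₃, rfl⟩ := hm₃ (n + i) (by omega)
  have hp : (0 : ℝ) < 2 ^ (n + i) := by positivity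
  have hchain := min_abs_sub_le_of_chain (x := fun m j => X ((j : ℝ) / 2 ^ m))
    (fun m j => by
      congr 1
      push_cast
      rw [pow_succ]
      field_simp)
    (c := fun m => (9 / 10 : ℝ) ^ m) (fun m => by positivity) h i j₁ j₂ j₃
    (by
      rw [div_le_div_iff₀ (by positivity) hp, pow_add] at h1
      have : (k : ℝ) * 2 ^ i ≤ j₁ := by
        refine le_of_mul_le_mul_right (a := (2 : ℝ) ^ n) ?_ (by positivity)
        linarith
      exact_mod_cast this)
    (by rw [div_le_div_iff_of_pos_right hp] at h2; exact_mod_cast h2)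
    (by rw [div_le_div_iff_of_pos_right hp] at h3; exact_mod_cast h3)
    (by
      rw [div_le_div_iff₀ hp (by positivity), pow_add] at h4
      have : (j₃ : ℝ) ≤ (k + 1) * 2 ^ i := by
        refine le_of_mul_le_mul_right (a := (2 : ℝ) ^ n) ?_ (by positivity)
        linarith
      exact_mod_cast this)
  refine hchain.trans ?_
  have hsum : ∑ l ∈ Finset.range i, (9 / 10 : ℝ) ^ (n + l + 1) ≤ 10 * (9 / 10 : ℝ) ^ n := by
    have h5 : ∀ l ∈ Finset.range i, (9 / 10 : ℝ) ^ (n + l + 1) ≤ (9 / 10) ^ n * (9 / 10) ^ l := by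
      intro l _
      rw [← pow_add]
      exact pow_le_pow_of_le_one (by norm_num) (by norm_num) (by omega)
    refine (Finset.sum_le_sum h5).trans ?_
    rw [← Finset.mul_sum, mul_comm]
    have h6 : ∑ l ∈ Finset.range i, (9 / 10 : ℝ) ^ l ≤ 10 := by
      rw [geom_sum_eq (by norm_num)]
      have : (0 : ℝ) ≤ (9 / 10) ^ i := by positivity
      rw [div_le_iff_of_neg (by norm_num)]
      linarith
    gcongr
  linarith

/-- If for all large levels no two adjacent dyadic increments in a bounded interval are both
large, then the function has one-sided limits along the dyadics. -/
lemma exists_dyadic_limits {X : ℝ → ℝ}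
    (h : ∀ N : ℕ, ∀ᶠ n : ℕ in atTop, ∀ j : ℤ, -(N : ℤ) * 2 ^ n ≤ j → j < N * 2 ^ n →
      min |X (((2 * j + 1 : ℤ) : ℝ) / 2 ^ (n + 1)) - X (((2 * j : ℤ) : ℝ) / 2 ^ (n + 1))|
        |X (((2 * j + 2 : ℤ) : ℝ) / 2 ^ (n + 1)) - X (((2 * j + 1 : ℤ) : ℝ) / 2 ^ (n + 1))|
        ≤ (9 / 10 : ℝ) ^ (n + 1)) (t : ℝ) :
    (∃ l, Tendsto X (𝓝[dyadicSet ∩ Ioi t] t) (𝓝 l)) ∧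
      ∃ l, Tendsto X (𝓝[dyadicSet ∩ Iio t] t) (𝓝 l) := by
  obtain ⟨N, hN⟩ := exists_nat_gt |t|
  rw [abs_lt] at hN
  -- a level at which every cell contained in `[-N, N]` satisfies the chaining bound
  have key : ∀ ε > 0, ∃ n : ℕ, ∀ k : ℤ, -(N : ℤ) * 2 ^ n ≤ k → k < N * 2 ^ n →
      ∀ s ∈ dyadicSet, ∀ r ∈ dyadicSet, ∀ u ∈ dyadicSet, (k : ℝ) / 2 ^ n ≤ s → s ≤ r → r ≤ u →
        u ≤ ((k : ℝ) + 1) / 2 ^ n → min |X r - X s| |X u - X r| ≤ ε := by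
    intro ε hε
    obtain ⟨n₀, hn₀⟩ := eventually_atTop.1 (h N)
    have hlim : Tendsto (fun n : ℕ => 20 * (9 / 10 : ℝ) ^ n) atTop (𝓝 0) := by
      simpa using (tendsto_pow_atTop_nhds_zero_of_lt_one (r := (9 / 10 : ℝ)) (by norm_num)
        (by norm_num)).const_mul 20
    obtain ⟨n, hn1, hn2⟩ := ((eventually_ge_atTop n₀).and
      (hlim.eventually (Iic_mem_nhds hε))).exists
    refine ⟨n, fun k hk1 hk2 s hs r hr u hu h1 h2 h3 h4 => ?_⟩
    refine (min_abs_sub_le_of_dyadic_cell (fun i j hj1 hj2 => ?_) hs hr hu h1 h2 h3 h4).trans hn2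
    refine hn₀ (n + i) (by omega) j ?_ ?_
    · refine le_trans ?_ hj1
      rw [pow_add, ← mul_assoc]
      gcongr
    · refine hj2.trans_le ?_
      rw [pow_add, ← mul_assoc]
      gcongr
      omega
  refine ⟨exists_tendsto_right_of_min_le fun ε hε => ?_,
    exists_tendsto_left_of_min_le fun ε hε => ?_⟩
  · obtain ⟨n, hn⟩ := key ε hε
    have hp : (0 : ℝ) < 2 ^ n := by positivity
    have hfl := Int.floor_le (t * 2 ^ n)
    have hlt := Int.lt_floor_add_one (t * 2 ^ n)
    refine ⟨(⌊t * 2 ^ n⌋ + 1) / 2 ^ n - t, sub_pos.2 ((lt_div_iff₀ hp).2 hlt),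
      fun s hs r hr u hu h1 h2 h3 h4 => ?_⟩
    refine hn ⌊t * 2 ^ n⌋ ?_ ?_ s hs r hr u hu ?_ h2 h3 (by linarith)
    · rw [Int.le_floor]
      push_cast
      nlinarith
    · rw [Int.floor_lt]
      push_cast
      nlinarith
    · rw [div_le_iff₀ hp]
      nlinarith
  · obtain ⟨n, hn⟩ := key ε hε
    have hp : (0 : ℝ) < 2 ^ n := by positivity
    have hcl := Int.le_ceil (t * 2 ^ n)
    have hlt := Int.ceil_lt_add_one (t * 2 ^ n)
    refine ⟨t - (((⌈t * 2 ^ n⌉ - 1 : ℤ)) : ℝ) / 2 ^ n, sub_pos.2 ((div_lt_iff₀ hp).2 ?_),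
      fun s hs r hr u hu h1 h2 h3 h4 => ?_⟩
    · push_cast
      linarith
    refine hn (⌈t * 2 ^ n⌉ - 1) ?_ ?_ s hs r hr u hu (by linarith) h2 h3 ?_
    · have : -(N : ℤ) * 2 ^ n < ⌈t * 2 ^ n⌉ := by
        rw [Int.lt_ceil]
        push_cast
        nlinarith
      omega
    · have : ⌈t * 2 ^ n⌉ ≤ (N : ℤ) * 2 ^ n := by
        rw [Int.ceil_le]
        push_cast
        nlinarith
      omega
    · rw [le_div_iff₀ hp]
      push_cast
      nlinarith

/-! ### Existence of a càdlàg version -/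

section CadlagVersion

variable {Ω : Type*} [MeasurableSpace Ω] {P : Measure Ω} {α β : ℝ} {M : Set ℝ → Ω → ℝ}

/-- The process `t ↦ M((0, t])` for `t ≥ 0`, `t ↦ -M((t, 0])` for `t < 0`. Half-open intervals are
used so that increments are measures of half-open intervals. -/
noncomputable def cumulativeMass (M : Set ℝ → Ω → ℝ) (t : ℝ) (ω : Ω) : ℝ :=
  if 0 ≤ t then M (Ioc 0 t) ω else -M (Ioc t 0) ω

lemma IsStableRandomMeasure.measurable_Ioc (hM : IsStableRandomMeasure P α β M) (s t : ℝ) :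
    Measurable (M (Ioc s t)) :=
  hM.measurable _ measurableSet_Ioc measure_Ioc_lt_top

lemma IsStableRandomMeasure.measurable_cumulativeMass (hM : IsStableRandomMeasure P α β M)
    (t : ℝ) : Measurable (cumulativeMass M t) := by
  by_cases h : 0 ≤ t
  · have : cumulativeMass M t = M (Ioc 0 t) := by funext ω; simp [cumulativeMass, h]
    rw [this]; exact hM.measurable_Ioc 0 t
  · have : cumulativeMass M t = fun ω => -M (Ioc t 0) ω := by
      funext ω; simp [cumulativeMass, h]
    rw [this]; exact (hM.measurable_Ioc t 0).neg

lemma IsStableRandomMeasure.ae_Ioc_add [IsProbabilityMeasure P]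
    (hM : IsStableRandomMeasure P α β M) (hα : 0 < α) (hβ : β ∈ Icc (-1 : ℝ) 1) {a b c : ℝ}
    (hab : a ≤ b) (hbc : b ≤ c) :
    ∀ᵐ ω ∂P, M (Ioc a c) ω = M (Ioc a b) ω + M (Ioc b c) ω := by
  rw [← Ioc_union_Ioc_eq_Ioc hab hbc]
  exact hM.ae_union hα hβ measurableSet_Ioc measure_Ioc_lt_top measurableSet_Ioc
    measure_Ioc_lt_top (Ioc_disjoint_Ioc_of_le le_rfl)

lemma IsStableRandomMeasure.cumulativeMass_sub [IsProbabilityMeasure P]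
    (hM : IsStableRandomMeasure P α β M) (hα : 0 < α) (hβ : β ∈ Icc (-1 : ℝ) 1) {s t : ℝ}
    (hst : s ≤ t) :
    ∀ᵐ ω ∂P, cumulativeMass M t ω - cumulativeMass M s ω = M (Ioc s t) ω := by
  by_cases hs : 0 ≤ s
  · filter_upwards [hM.ae_Ioc_add hα hβ hs hst] with ω hω
    simp [cumulativeMass, hs, hs.trans hst, hω]
  · by_cases ht : 0 ≤ t
    · filter_upwards [hM.ae_Ioc_add hα hβ (not_le.1 hs).le ht] with ω hω
      simp [cumulativeMass, hs, ht, hω, add_comm]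
    · filter_upwards [hM.ae_Ioc_add hα hβ hst (not_le.1 ht).le] with ω hω
      simp [cumulativeMass, hs, ht, hω]

lemma IsStableRandomMeasure.measure_lt_abs_Ioc_le [IsProbabilityMeasure P]
    (hM : IsStableRandomMeasure P α β M) (hα : 0 < α) (hβ : β ∈ Icc (-1 : ℝ) 1) {s t r : ℝ}
    (hst : s ≤ t) (hr : 0 < r) :
    P {ω | r < |M (Ioc s t) ω|} ≤
      ENNReal.ofReal (2 * (stableConst α * (t - s)) * (2 / r) ^ α) := by
  have := hM.measure_lt_abs_le hα hβ (measurableSet_Ioc (a := s) (b := t)) measure_Ioc_lt_top hr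
  rwa [Real.volume_Ioc, ENNReal.toReal_ofReal (sub_nonneg.2 hst)] at this

/-- By independence, the probability that two adjacent increments over dyadic intervals are both
large is of the order of the square of the length; this is what makes chaining converge although
the paths jump. -/
lemma IsStableRandomMeasure.measure_two_large_increments_le [IsProbabilityMeasure P]
    (hM : IsStableRandomMeasure P α β M) (hα : 0 < α) (hα2 : α ≤ 2) (hβ : β ∈ Icc (-1 : ℝ) 1)
    {a b c : ℝ} (hab : a ≤ b) (hbc : b - a = c - b) {r : ℝ} (hr : 0 < r) (hr2 : r ≤ 2) :
    P {ω | r < |cumulativeMass M b ω - cumulativeMass M a ω| ∧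
        r < |cumulativeMass M c ω - cumulativeMass M b ω|} ≤
      ENNReal.ofReal ((8 * stableConst α * (b - a) / r ^ 2) ^ 2) := by
  have hbc' : b ≤ c := by linarith
  have hind : IndepFun (M (Ioc a b)) (M (Ioc b c)) P := by
    have h := hM.indep 2 ![Ioc a b, Ioc b c]
      (by intro i; fin_cases i <;> simp) (by intro i; fin_cases i <;> simp)
      (by
        intro i j hij
        fin_cases i <;> fin_cases j <;> simp at hij ⊢)
    exact h.indepFun (i := 0) (j := 1) (by decide)
  have hpow : 2 * (stableConst α * (b - a)) * (2 / r) ^ α ≤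
      8 * stableConst α * (b - a) / r ^ 2 := by
    have h1 : (2 / r) ^ α ≤ (2 / r) ^ (2 : ℝ) :=
      Real.rpow_le_rpow_of_exponent_le ((one_le_div hr).2 hr2) hα2
    have h2 : (2 / r) ^ (2 : ℝ) = 4 / r ^ 2 := by
      rw [Real.rpow_two, div_pow]; norm_num
    rw [h2] at h1
    have h3 : 0 ≤ 2 * (stableConst α * (b - a)) :=
      mul_nonneg zero_le_two (mul_nonneg (stableConst_pos α).le (sub_nonneg.2 hab))
    refine (mul_le_mul_of_nonneg_left h1 h3).trans_eq ?_
    ring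
  have hS : MeasurableSet {x : ℝ | r < |x|} := measurableSet_lt measurable_const measurable_abs
  calc P {ω | r < |cumulativeMass M b ω - cumulativeMass M a ω| ∧
        r < |cumulativeMass M c ω - cumulativeMass M b ω|}
      ≤ P (M (Ioc a b) ⁻¹' {x | r < |x|} ∩ M (Ioc b c) ⁻¹' {x | r < |x|}) := by
        refine measure_mono_ae ?_
        filter_upwards [hM.cumulativeMass_sub hα hβ hab, hM.cumulativeMass_sub hα hβ hbc']
          with ω h1 h2 hω
        have hω' : r < |cumulativeMass M b ω - cumulativeMass M a ω| ∧
          r < |cumulativeMass M c ω - cumulativeMass M b ω| := hω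
        rw [h1, h2] at hω'
        exact hω'
    _ = P {ω | r < |M (Ioc a b) ω|} * P {ω | r < |M (Ioc b c) ω|} :=
        hind.measure_inter_preimage_eq_mul _ _ hS hS
    _ ≤ ENNReal.ofReal (8 * stableConst α * (b - a) / r ^ 2) *
        ENNReal.ofReal (8 * stableConst α * (b - a) / r ^ 2) := by
        gcongr
        · exact (hM.measure_lt_abs_Ioc_le hα hβ hab hr).trans (ENNReal.ofReal_le_ofReal hpow)
        · refine (hM.measure_lt_abs_Ioc_le hα hβ hbc' hr).trans (ENNReal.ofReal_le_ofReal ?_)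
          rwa [← hbc]
    _ = _ := by
        have h0 : 0 ≤ 8 * stableConst α * (b - a) / r ^ 2 :=
          div_nonneg (mul_nonneg (mul_nonneg (by norm_num) (stableConst_pos α).le)
            (sub_nonneg.2 hab)) (by positivity)
        rw [← ENNReal.ofReal_mul h0, pow_two (8 * stableConst α * (b - a) / r ^ 2)]

/-- Borel-Cantelli: at all fine dyadic levels, no two adjacent increments are both large. -/
lemma IsStableRandomMeasure.ae_eventually_dyadic_small [IsProbabilityMeasure P]
    (hM : IsStableRandomMeasure P α β M) (hα : 0 < α) (hα2 : α ≤ 2) (hβ : β ∈ Icc (-1 : ℝ) 1)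
    (N : ℕ) :
    ∀ᵐ ω ∂P, ∀ᶠ n : ℕ in atTop, ∀ j : ℤ, -(N : ℤ) * 2 ^ n ≤ j → j < N * 2 ^ n →
      min |cumulativeMass M (((2 * j + 1 : ℤ) : ℝ) / 2 ^ (n + 1)) ω -
          cumulativeMass M (((2 * j : ℤ) : ℝ) / 2 ^ (n + 1)) ω|
        |cumulativeMass M (((2 * j + 2 : ℤ) : ℝ) / 2 ^ (n + 1)) ω -
          cumulativeMass M (((2 * j + 1 : ℤ) : ℝ) / 2 ^ (n + 1)) ω|
        ≤ (9 / 10 : ℝ) ^ (n + 1) := by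
  set K := stableConst α with hK
  have hKpos : 0 < K := stableConst_pos α
  let B : ℕ → ℤ → Set Ω := fun n j => {ω | (9 / 10 : ℝ) ^ (n + 1) <
      |cumulativeMass M (((2 * j + 1 : ℤ) : ℝ) / 2 ^ (n + 1)) ω -
          cumulativeMass M (((2 * j : ℤ) : ℝ) / 2 ^ (n + 1)) ω| ∧ (9 / 10 : ℝ) ^ (n + 1) <
        |cumulativeMass M (((2 * j + 2 : ℤ) : ℝ) / 2 ^ (n + 1)) ω -
          cumulativeMass M (((2 * j + 1 : ℤ) : ℝ) / 2 ^ (n + 1)) ω|}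
  let A : ℕ → Set Ω := fun n => ⋃ j ∈ Finset.Ico (-(N : ℤ) * 2 ^ n) (N * 2 ^ n), B n j
  -- `2 * (9 / 10) ^ 4 > 1` makes the bound geometric
  set ρ : ℝ := 1 / (2 * (9 / 10) ^ 4) with hρ
  have hB : ∀ n j, P (B n j) ≤ ENNReal.ofReal ((8 * K) ^ 2 * (ρ ^ (n + 1) / 2 ^ (n + 1))) := by
    intro n j
    have hlen : ((2 * j + 1 : ℤ) : ℝ) / 2 ^ (n + 1) - ((2 * j : ℤ) : ℝ) / 2 ^ (n + 1) =
        1 / 2 ^ (n + 1) := by push_cast; ring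
    refine (hM.measure_two_large_increments_le hα hα2 hβ ?_ ?_ (by positivity) ?_).trans_eq ?_
    · rw [← sub_nonneg, hlen]; positivity
    · push_cast; ring
    · exact (pow_le_one₀ (by norm_num) (by norm_num)).trans (by norm_num)
    · have hρn : ρ ^ (n + 1) = 1 / (2 ^ (n + 1) * ((9 / 10) ^ (n + 1)) ^ 4) := by
        rw [hρ, div_pow, one_pow, mul_pow, ← pow_mul, ← pow_mul, mul_comm 4]
      rw [hlen, ← hK, hρn]
      congr 1
      have : (9 / 10 : ℝ) ^ (n + 1) ≠ 0 := by positivity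
      generalize (9 / 10 : ℝ) ^ (n + 1) = y at this ⊢
      field_simp
  have hA : ∀ n, P (A n) ≤ ENNReal.ofReal (N * (8 * K) ^ 2 * ρ * ρ ^ n) := by
    intro n
    refine (measure_biUnion_finset_le _ _).trans ((Finset.sum_le_sum fun j _ => hB n j).trans ?_)
    rw [Finset.sum_const, nsmul_eq_mul, Int.card_Ico]
    have hcard : ((N * 2 ^ n - -(N : ℤ) * 2 ^ n).toNat : ℝ≥0∞) =
        ENNReal.ofReal (N * 2 ^ (n + 1)) := by
      have : (N * 2 ^ n - -(N : ℤ) * 2 ^ n).toNat = N * 2 ^ (n + 1) := by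
        have : (N * 2 ^ n - -(N : ℤ) * 2 ^ n) = ((N * 2 ^ (n + 1) : ℕ) : ℤ) := by
          push_cast; ring
        rw [this, Int.toNat_natCast]
      rw [this, ← ENNReal.ofReal_natCast]
      push_cast
      rfl
    rw [hcard, ← ENNReal.ofReal_mul (by positivity)]
    refine ENNReal.ofReal_le_ofReal (le_of_eq ?_)
    rw [pow_succ ρ]
    field_simp
  have hsum : ∑' n, P (A n) ≠ ∞ := by
    have hs : Summable fun n : ℕ => (N * (8 * K) ^ 2 * ρ * ρ ^ n : ℝ) :=
      (summable_geometric_of_lt_one (by rw [hρ]; norm_num) (by rw [hρ]; norm_num)).mul_left _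
    refine ne_top_of_le_ne_top ?_ (ENNReal.tsum_le_tsum hA)
    exact hs.tsum_ofReal_ne_top
  filter_upwards [ae_eventually_notMem hsum] with ω hω
  filter_upwards [hω] with n hn j hj1 hj2
  by_contra! hcon
  refine hn (mem_biUnion (x := j) (Finset.mem_coe.2 (Finset.mem_Ico.2 ⟨hj1, hj2⟩)) ?_)
  exact lt_min_iff.1 hcon

lemma tendsto_floor_dyadic (t : ℝ) :
    Tendsto (fun n : ℕ => ((⌊t * 2 ^ n⌋ + 1 : ℤ) : ℝ) / 2 ^ n) atTop
      (𝓝[dyadicSet ∩ Ioi t] t) := by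
  have hmem : ∀ n : ℕ, t < ((⌊t * 2 ^ n⌋ + 1 : ℤ) : ℝ) / 2 ^ n ∧
      ((⌊t * 2 ^ n⌋ + 1 : ℤ) : ℝ) / 2 ^ n ≤ t + (1 / 2) ^ n := by
    intro n
    have hp : (0 : ℝ) < 2 ^ n := by positivity
    constructor
    · rw [lt_div_iff₀ hp]
      push_cast
      exact Int.lt_floor_add_one _
    · rw [div_le_iff₀ hp, add_mul, ← mul_pow]
      push_cast
      have := Int.floor_le (t * 2 ^ n)
      norm_num
      linarith
  refine tendsto_nhdsWithin_iff.2 ⟨?_, Eventually.of_forall fun n => ⟨⟨n, _, rfl⟩, (hmem n).1⟩⟩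
  have h1 : Tendsto (fun n : ℕ => t + (1 / 2 : ℝ) ^ n) atTop (𝓝 t) := by
    simpa using (tendsto_pow_atTop_nhds_zero_of_lt_one (r := (1 / 2 : ℝ)) (by norm_num)
      (by norm_num)).const_add t
  exact tendsto_of_tendsto_of_tendsto_of_le_of_le tendsto_const_nhds h1 (fun n => (hmem n).1.le)
    fun n => (hmem n).2

lemma IsStableRandomMeasure.tendstoInMeasure_cumulativeMass [IsProbabilityMeasure P]
    (hM : IsStableRandomMeasure P α β M) (hα : 0 < α) (hβ : β ∈ Icc (-1 : ℝ) 1) {t : ℝ}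
    {s : ℕ → ℝ} (hs : ∀ n, t ≤ s n) (hst : Tendsto s atTop (𝓝 t)) :
    TendstoInMeasure P (fun n => cumulativeMass M (s n)) atTop (cumulativeMass M t) := by
  rw [tendstoInMeasure_iff_norm]
  intro ε hε
  have h1 : Tendsto (fun n => ENNReal.ofReal
      (2 * (stableConst α * (s n - t)) * (2 / (ε / 2)) ^ α)) atTop (𝓝 0) := by
    have := ENNReal.tendsto_ofReal ((((hst.sub_const t).const_mul (stableConst α)).const_mul
      2).mul_const ((2 / (ε / 2)) ^ α))
    simpa using this
  refine tendsto_of_tendsto_of_tendsto_of_le_of_le tendsto_const_nhds h1 (fun _ => zero_le)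
    (fun n => (measure_mono_ae ?_).trans (hM.measure_lt_abs_Ioc_le hα hβ (hs n) (half_pos hε)))
  filter_upwards [hM.cumulativeMass_sub hα hβ (hs n)] with ω h1 hω
  have hω' : ε ≤ ‖cumulativeMass M (s n) ω - cumulativeMass M t ω‖ := hω
  rw [h1, Real.norm_eq_abs] at hω'
  exact show ε / 2 < |M (Ioc t (s n)) ω| by linarith

lemma IsStableRandomMeasure.ae_Icc_eq [IsProbabilityMeasure P]
    (hM : IsStableRandomMeasure P α β M) (hα : 0 < α) (hβ : β ∈ Icc (-1 : ℝ) 1) {s t : ℝ}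
    (hst : s ≤ t) : ∀ᵐ ω ∂P, M (Icc s t) ω = M (Ioc s t) ω := by
  have h1 := hM.ae_union hα hβ (measurableSet_singleton s) (by simp)
    (measurableSet_Ioc (a := s) (b := t)) measure_Ioc_lt_top (by simp)
  have h2 := hM.ae_eq_zero hα hβ (measurableSet_singleton s) (by simp)
  have h3 : ({s} : Set ℝ) ∪ Ioc s t = Icc s t := by
    rw [singleton_union]; exact Ioc_insert_left hst
  rw [h3] at h1
  filter_upwards [h1, h2] with ω h1 h2
  rw [h1, h2, zero_add]

lemma IsStableRandomMeasure.exists_isCadlagVersion [IsProbabilityMeasure P]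
    (hM : IsStableRandomMeasure P α β M) (hα : 0 < α) (hα2 : α ≤ 2) (hβ : β ∈ Icc (-1 : ℝ) 1) :
    ∃ L : ℝ → Ω → ℝ, IsCadlagVersion P M L := by
  let L : ℝ → Ω → ℝ := fun t ω => dyadicRightLim (fun s => cumulativeMass M s ω) t
  have hlim : ∀ᵐ ω ∂P, ∀ t,
      (∃ l, Tendsto (fun s => cumulativeMass M s ω) (𝓝[dyadicSet ∩ Ioi t] t) (𝓝 l)) ∧
      ∃ l, Tendsto (fun s => cumulativeMass M s ω) (𝓝[dyadicSet ∩ Iio t] t) (𝓝 l) := by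
    filter_upwards [ae_all_iff.2 fun N => hM.ae_eventually_dyadic_small hα hα2 hβ N] with ω hω
    exact exists_dyadic_limits hω
  have hL : ∀ t, ∀ᵐ ω ∂P, L t ω = cumulativeMass M t ω := by
    intro t
    have hs := tendsto_floor_dyadic t
    have hs' := tendsto_nhdsWithin_iff.1 hs
    have h1 : ∀ᵐ ω ∂P, Tendsto (fun n : ℕ => cumulativeMass M
        (((⌊t * 2 ^ n⌋ + 1 : ℤ) : ℝ) / 2 ^ n) ω) atTop (𝓝 (L t ω)) := by
      filter_upwards [hlim] with ω hω
      exact (tendsto_dyadicRightLim (hω t).1).comp hs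
    have h2 := tendstoInMeasure_of_tendsto_ae
      (fun n => (hM.measurable_cumulativeMass _).aestronglyMeasurable) h1
    have h3 := hM.tendstoInMeasure_cumulativeMass hα hβ (t := t)
      (s := fun n : ℕ => ((⌊t * 2 ^ n⌋ + 1 : ℤ) : ℝ) / 2 ^ n) (fun n => by
        have hp : (0 : ℝ) < 2 ^ n := by positivity
        rw [le_div_iff₀ hp]
        push_cast
        exact (Int.lt_floor_add_one _).le) hs'.1
    exact tendstoInMeasure_ae_unique h2 h3
  refine ⟨L, fun t ht => ?_, fun t ht => ?_, ?_⟩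
  · filter_upwards [hL t, hM.ae_Icc_eq hα hβ ht] with ω h1 h2
    rw [h1, h2, cumulativeMass, if_pos ht]
  · rcases ht.eq_or_lt with rfl | ht
    · filter_upwards [hL 0, hM.ae_Icc_eq hα hβ le_rfl,
        hM.ae_eq_zero hα hβ (measurableSet_Ioc (a := (0 : ℝ)) (b := 0)) (by simp)] with ω h1 h2 h3
      rw [h1, h2, cumulativeMass, if_pos le_rfl, h3, neg_zero]
    · filter_upwards [hL t, hM.ae_Icc_eq hα hβ ht.le] with ω h1 h2
      rw [h1, h2, cumulativeMass, if_neg ht.not_ge]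
  · filter_upwards [hlim] with ω hω
    exact isCadlagPath_dyadicRightLim (fun t => (hω t).1) fun t => (hω t).2

end CadlagVersion

/-! ### The Lévy process -/

section LevyPath

variable {Ω : Type*} [MeasurableSpace Ω] {P : Measure Ω} {α β : ℝ} {M : Set ℝ → Ω → ℝ}
  {L : ℝ → Ω → ℝ}

lemma IsCadlagVersion.ae_eq_cumulativeMass [IsProbabilityMeasure P]
    (hL : IsCadlagVersion P M L) (hM : IsStableRandomMeasure P α β M)
    (hα : 0 < α) (hβ : β ∈ Icc (-1 : ℝ) 1) (t : ℝ) : L t =ᵐ[P] cumulativeMass M t := by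
  by_cases ht : 0 ≤ t
  · filter_upwards [hL.nonneg t ht, hM.ae_Icc_eq hα hβ ht] with ω h1 h2
    rw [h1, h2, cumulativeMass, if_pos ht]
  · filter_upwards [hL.nonpos t (not_le.1 ht).le, hM.ae_Icc_eq hα hβ (not_le.1 ht).le]
      with ω h1 h2
    rw [h1, h2, cumulativeMass, if_neg ht]

lemma IsStableRandomMeasure.hasIndepIncrements [IsProbabilityMeasure P]
    (hM : IsStableRandomMeasure P α β M) (hα : 0 < α) (hβ : β ∈ Icc (-1 : ℝ) 1) :
    HasIndepIncrements (cumulativeMass M) P := by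
  intro n t ht
  have h := hM.indep n (fun i => Ioc (t i.castSucc) (t i.succ)) (fun _ => measurableSet_Ioc)
    (fun _ => measure_Ioc_lt_top) (by
      intro i j hij
      rcases lt_or_gt_of_ne hij with h | h
      · exact Ioc_disjoint_Ioc_of_le (ht (Fin.succ_le_castSucc_iff.2 h))
      · exact (Ioc_disjoint_Ioc_of_le (ht (Fin.succ_le_castSucc_iff.2 h))).symm)
  refine h.congr fun i => ?_
  filter_upwards [hM.cumulativeMass_sub hα hβ (ht (Fin.castSucc_le_succ i))] with ω hω
  exact hω.symm

lemma IsCadlagVersion.isStableLevyProcess [IsProbabilityMeasure P]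
    (hL : IsCadlagVersion P M L) (hM : IsStableRandomMeasure P α β M)
    (hα : 0 < α) (hβ : β ∈ Icc (-1 : ℝ) 1) : IsStableLevyProcess P α β L where
  aemeasurable t := (hM.measurable_cumulativeMass t).aemeasurable.congr
    (hL.ae_eq_cumulativeMass hM hα hβ t).symm
  zero := by
    filter_upwards [hL.nonneg 0 le_rfl,
      hM.ae_eq_zero hα hβ (measurableSet_Icc (a := (0 : ℝ)) (b := 0)) (by simp)] with ω h1 h2
    rw [h1, h2]
  indep_increments := by
    intro n t ht
    refine (hM.hasIndepIncrements hα hβ n t ht).congr fun i => ?_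
    filter_upwards [hL.ae_eq_cumulativeMass hM hα hβ (t i.succ),
      hL.ae_eq_cumulativeMass hM hα hβ (t i.castSucc)] with ω h1 h2
    rw [h1, h2]
  charFun_increment s t hst θ := by
    have h1 : (fun ω => L t ω - L s ω) =ᵐ[P] M (Ioc s t) := by
      filter_upwards [hL.ae_eq_cumulativeMass hM hα hβ t,
        hL.ae_eq_cumulativeMass hM hα hβ s, hM.cumulativeMass_sub hα hβ hst] with ω h1 h2 h3
      rw [h1, h2, h3]
    rw [Measure.map_congr h1, hM.charFun_eq _ measurableSet_Ioc measure_Ioc_lt_top,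
      Real.volume_Ioc, ENNReal.toReal_ofReal (sub_nonneg.2 hst)]
  cadlag := hL.cadlag

/-! ### The maximal inequality -/

/-- Ottaviani's inequality for partial sums of independent random variables. -/
lemma measure_exists_lt_abs_sum_le [IsProbabilityMeasure P] {D : ℕ → Ω → ℝ}
    (hD : ∀ i, Measurable (D i)) (hind : iIndepFun D P) {n : ℕ} {r : ℝ}
    (h : ∀ k ≤ n, P {ω | r < |∑ i ∈ Finset.range n, D i ω - ∑ i ∈ Finset.range k, D i ω|} ≤ 1 / 2) :
    P {ω | ∃ k ≤ n, 2 * r < |∑ i ∈ Finset.range k, D i ω|} ≤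
      2 * P {ω | r < |∑ i ∈ Finset.range n, D i ω|} := by
  let S : ℕ → Ω → ℝ := fun k ω => ∑ i ∈ Finset.range k, D i ω
  have hS : ∀ k, Measurable (S k) := fun k => Finset.measurable_fun_sum _ fun i _ => hD i
  -- `k` is the first index at which the level `2 * r` is exceeded
  let A : ℕ → Set Ω := fun k => {ω | 2 * r < |S k ω|} ∩ ⋂ j ∈ Finset.range k, {ω | |S j ω| ≤ 2 * r}
  let B : ℕ → Set Ω := fun k => {ω | |S n ω - S k ω| ≤ r}
  have hB : ∀ k, MeasurableSet (B k) := fun k =>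
    measurableSet_le ((hS n).sub (hS k)).abs measurable_const
  have hA : ∀ k, MeasurableSet (A k) := fun k =>
    (measurableSet_lt measurable_const (hS k).abs).inter
      (Finset.measurableSet_biInter _ fun j _ => measurableSet_le (hS j).abs measurable_const)
  have hdisj : ∀ i j, i < j → Disjoint (A i) (A j) := by
    intro i j hij
    refine Set.disjoint_left.2 fun ω h1 h2 => ?_
    have h3 : 2 * r < |S i ω| := h1.1
    have h4 := mem_iInter₂.1 h2.2 i (Finset.mem_range.2 hij)
    exact absurd h3 (not_lt.2 h4)
  have hAB : ∀ k ≤ n, P (A k ∩ B k) = P (A k) * P (B k) := by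
    intro k hk
    let m : ℕ → MeasurableSpace Ω := fun i => MeasurableSpace.comap (D i) inferInstance
    have hI := indep_iSup_of_disjoint (m := m) (fun i => (hD i).comap_le) hind.iIndep
      (S := {i | i < k}) (T := {i | k ≤ i})
      (Set.disjoint_left.2 fun i (h1 : i < k) (h2 : k ≤ i) => absurd h1 (not_lt.2 h2))
    have hm1 : ∀ i, i < k → Measurable[⨆ i ∈ {i | i < k}, m i] (D i) := fun i hi =>
      (comap_measurable (D i)).mono (le_iSup₂_of_le i hi le_rfl) le_rfl
    have hm2 : ∀ i, k ≤ i → Measurable[⨆ i ∈ {i | k ≤ i}, m i] (D i) := fun i hi =>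
      (comap_measurable (D i)).mono (le_iSup₂_of_le i hi le_rfl) le_rfl
    have hS1 : ∀ j, j ≤ k → Measurable[⨆ i ∈ {i | i < k}, m i] (S j) := fun j hj =>
      Finset.measurable_fun_sum _ fun i hi => hm1 i ((Finset.mem_range.1 hi).trans_le hj)
    have hS2 : Measurable[⨆ i ∈ {i | k ≤ i}, m i] (fun ω => S n ω - S k ω) := by
      have : (fun ω => S n ω - S k ω) = fun ω => ∑ i ∈ Finset.Ico k n, D i ω := by
        funext ω
        rw [Finset.sum_Ico_eq_sub _ hk]
      rw [this]
      exact Finset.measurable_fun_sum _ fun i hi => hm2 i (Finset.mem_Ico.1 hi).1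
    refine Indep_iff _ _ P |>.1 hI _ _ ?_ ?_
    · refine MeasurableSet.inter ?_ (Finset.measurableSet_biInter _ fun j hj => ?_)
      · exact (hS1 k le_rfl) (measurableSet_lt measurable_const measurable_abs :
          MeasurableSet {x : ℝ | 2 * r < |x|})
      · exact (hS1 j (Finset.mem_range.1 hj).le) (measurableSet_le measurable_abs measurable_const :
          MeasurableSet {x : ℝ | |x| ≤ 2 * r})
    · exact hS2 (measurableSet_le measurable_abs measurable_const :
          MeasurableSet {x : ℝ | |x| ≤ r})
  have hBhalf : ∀ k ≤ n, 1 ≤ 2 * P (B k) := by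
    intro k hk
    have h1 : P (B k)ᶜ ≤ 1 / 2 := by
      refine le_trans (measure_mono fun ω hω => ?_) (h k hk)
      have hω' : ¬ |S n ω - S k ω| ≤ r := fun h' => hω h'
      exact not_le.1 hω'
    have h2 := prob_add_prob_compl (μ := P) (hB k)
    have h3 : (1 : ℝ≥0∞) ≤ P (B k) + 1 / 2 := h2.symm.le.trans (add_le_add le_rfl h1)
    have h4 : (1 / 2 : ℝ≥0∞) ≤ P (B k) := by
      have := tsub_le_iff_right.2 h3
      rwa [one_div, ENNReal.one_sub_inv_two, ← one_div] at this
    calc (1 : ℝ≥0∞) = 2 * (1 / 2) := by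
          rw [one_div, ENNReal.mul_inv_cancel two_ne_zero (by simp)]
      _ ≤ _ := by gcongr
  have hsub : {ω | ∃ k ≤ n, 2 * r < |∑ i ∈ Finset.range k, D i ω|} ⊆
      ⋃ k ∈ Finset.range (n + 1), A k := by
    intro ω hω
    classical
    obtain ⟨hk1, hk2⟩ := Nat.find_spec hω
    refine mem_biUnion (x := Nat.find hω)
      (Finset.mem_coe.2 (Finset.mem_range.2 (by omega))) ⟨hk2, ?_⟩
    refine mem_iInter₂.2 fun j hj => ?_
    have hj' := Finset.mem_range.1 hj
    by_contra hc
    exact Nat.find_min hω hj' ⟨by omega, not_le.1 hc⟩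
  calc P {ω | ∃ k ≤ n, 2 * r < |∑ i ∈ Finset.range k, D i ω|}
      ≤ ∑ k ∈ Finset.range (n + 1), P (A k) :=
        (measure_mono hsub).trans (measure_biUnion_finset_le _ _)
    _ ≤ ∑ k ∈ Finset.range (n + 1), 2 * P (A k ∩ B k) := by
        refine Finset.sum_le_sum fun k hk => ?_
        have hk' : k ≤ n := by simpa [Nat.lt_succ_iff] using hk
        rw [hAB k hk', mul_left_comm]
        exact le_mul_of_one_le_right zero_le (hBhalf k hk')
    _ = 2 * P (⋃ k ∈ Finset.range (n + 1), A k ∩ B k) := by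
        rw [← Finset.mul_sum, measure_biUnion_finset _ fun k _ => (hA k).inter (hB k)]
        intro i _ j _ hij
        rcases lt_or_gt_of_ne hij with h | h
        · exact (hdisj i j h).mono inter_subset_left inter_subset_left
        · exact (hdisj j i h).symm.mono inter_subset_left inter_subset_left
    _ ≤ 2 * P {ω | r < |∑ i ∈ Finset.range n, D i ω|} := by
        gcongr
        refine iUnion₂_subset fun k _ ω hω => ?_
        have h1 : 2 * r < |S k ω| := hω.1.1
        have h2 : |S n ω - S k ω| ≤ r := hω.2
        have h3 := abs_sub_abs_le_abs_sub (S k ω) (S n ω)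
        rw [abs_sub_comm] at h3
        exact show r < |S n ω| by linarith

lemma IsStableRandomMeasure.measure_lt_abs_increment_le [IsProbabilityMeasure P]
    (hM : IsStableRandomMeasure P α β M) (hα : 0 < α) (hβ : β ∈ Icc (-1 : ℝ) 1) {s t r : ℝ}
    (hst : s ≤ t) (hr : 0 < r) :
    P {ω | r < |cumulativeMass M t ω - cumulativeMass M s ω|} ≤
      ENNReal.ofReal (2 * (stableConst α * (t - s)) * (2 / r) ^ α) := by
  refine (measure_mono_ae ?_).trans (hM.measure_lt_abs_Ioc_le hα hβ hst hr)
  filter_upwards [hM.cumulativeMass_sub hα hβ hst] with ω h1 hω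
  have hω' : r < |cumulativeMass M t ω - cumulativeMass M s ω| := hω
  rw [h1] at hω'
  exact hω'

lemma IsStableRandomMeasure.measure_exists_grid_le [IsProbabilityMeasure P]
    (hM : IsStableRandomMeasure P α β M) (hα : 0 < α) (hβ : β ∈ Icc (-1 : ℝ) 1) {τ : ℕ → ℝ}
    (hτ : Monotone τ) (n : ℕ) {r : ℝ} (hr : 0 < r) :
    P {ω | ∃ k ≤ n, 2 * r < |cumulativeMass M (τ k) ω - cumulativeMass M (τ 0) ω|} ≤
      ENNReal.ofReal (2 * (2 * (stableConst α * (τ n - τ 0)) * (2 / r) ^ α)) := by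
  have hK := stableConst_pos α
  -- the hypothesis of Ottaviani's inequality holds unless the asserted bound is at least `1`
  by_cases hc : 2 * (stableConst α * (τ n - τ 0)) * (2 / r) ^ α ≤ 1 / 2
  · have hsum : ∀ k ω, ∑ i ∈ Finset.range k,
        (cumulativeMass M (τ (i + 1)) ω - cumulativeMass M (τ i) ω) =
        cumulativeMass M (τ k) ω - cumulativeMass M (τ 0) ω := fun k ω =>
      Finset.sum_range_sub (fun i => cumulativeMass M (τ i) ω) k
    have h := measure_exists_lt_abs_sum_le
      (D := fun i ω => cumulativeMass M (τ (i + 1)) ω - cumulativeMass M (τ i) ω)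
      (fun i => (hM.measurable_cumulativeMass _).sub (hM.measurable_cumulativeMass _))
      ((hM.hasIndepIncrements hα hβ).nat hτ) (n := n) (r := r) (by
        intro k hk
        simp only [hsum, sub_sub_sub_cancel_right]
        refine (hM.measure_lt_abs_increment_le hα hβ (hτ hk) hr).trans ?_
        have h1 : (1 / 2 : ℝ≥0∞) = ENNReal.ofReal (1 / 2) := by
          rw [ENNReal.ofReal_div_of_pos two_pos]; simp
        rw [h1]
        refine ENNReal.ofReal_le_ofReal (le_trans ?_ hc)
        gcongr
        exact hτ (Nat.zero_le k))
    simp only [hsum] at h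
    refine h.trans ?_
    rw [ENNReal.ofReal_mul zero_le_two, ENNReal.ofReal_ofNat]
    gcongr
    exact hM.measure_lt_abs_increment_le hα hβ (hτ (Nat.zero_le n)) hr
  · refine prob_le_one.trans ?_
    rw [← ENNReal.ofReal_one]
    exact ENNReal.ofReal_le_ofReal (by linarith)

/-- By right-continuity, an excursion of the path is seen on all fine dyadic grids. -/
lemma IsCadlagVersion.measure_exists_Icc_le [IsProbabilityMeasure P]
    (hL : IsCadlagVersion P M L) (hM : IsStableRandomMeasure P α β M)
    (hα : 0 < α) (hβ : β ∈ Icc (-1 : ℝ) 1) {a b : ℝ} (hab : a < b) {r : ℝ} (hr : 0 < r) :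
    P {ω | ∃ v ∈ Icc a b, 2 * r < |L v ω - L a ω|} ≤
      ENNReal.ofReal (2 * (2 * (stableConst α * (b - a)) * (2 / r) ^ α)) := by
  let τ : ℕ → ℕ → ℝ := fun m k => a + (b - a) / 2 ^ m * k
  have hba : 0 < b - a := sub_pos.2 hab
  have hτ : ∀ m, Monotone (τ m) := fun m i j hij => by
    have : (i : ℝ) ≤ j := by exact_mod_cast hij
    simp only [τ]
    gcongr
  have hτ0 : ∀ m, τ m 0 = a := fun m => by simp [τ]
  have hτn : ∀ m, τ m (2 ^ m) = b := fun m => by simp only [τ]; push_cast; field_simp; ring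
  let G : ℕ → Set Ω := fun m =>
    {ω | ∃ k ≤ 2 ^ m, 2 * r < |cumulativeMass M (τ m k) ω - cumulativeMass M (τ m 0) ω|}
  have hGmono : Monotone G := by
    refine monotone_nat_of_le_succ fun m ω hω => ?_
    obtain ⟨k, hk, hlt⟩ := hω
    refine ⟨2 * k, by rw [pow_succ]; omega, ?_⟩
    have : τ (m + 1) (2 * k) = τ m k := by
      simp only [τ]; push_cast; rw [pow_succ]; field_simp
    rwa [this, hτ0, ← hτ0 m]
  have hG : ∀ m, P (G m) ≤
      ENNReal.ofReal (2 * (2 * (stableConst α * (b - a)) * (2 / r) ^ α)) := by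
    intro m
    have := hM.measure_exists_grid_le hα hβ (hτ m) (2 ^ m) hr
    simpa only [G, hτ0, hτn] using this
  have hGU : P (⋃ m, G m) ≤ ENNReal.ofReal (2 * (2 * (stableConst α * (b - a)) * (2 / r) ^ α)) := by
    rw [hGmono.measure_iUnion]
    exact iSup_le hG
  refine (measure_mono_ae ?_).trans hGU
  have hgrid : ∀ᵐ ω ∂P, ∀ m k : ℕ, L (τ m k) ω = cumulativeMass M (τ m k) ω :=
    ae_all_iff.2 fun m => ae_all_iff.2 fun k => hL.ae_eq_cumulativeMass hM hα hβ _
  filter_upwards [hgrid, hL.cadlag] with ω hg hcad hω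
  obtain ⟨v, ⟨hav, hvb⟩, hv⟩ : ∃ v ∈ Icc a b, 2 * r < |L v ω - L a ω| := hω
  rcases hvb.eq_or_lt with rfl | hvb
  · refine mem_iUnion.2 ⟨0, 2 ^ 0, le_rfl, ?_⟩
    rw [← hg, ← hg, hτ0, hτn]
    exact hv
  · have hcont : ContinuousWithinAt (fun s => |L s ω - L a ω|) (Ici v) v :=
      ((hcad v).1.sub continuousWithinAt_const).abs
    have hev := hcont.eventually (Ioi_mem_nhds hv)
    obtain ⟨δ, hδ, hball⟩ := Metric.mem_nhdsWithin_iff.1 hev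
    obtain ⟨m, hm⟩ := pow_unbounded_of_one_lt ((b - a) / δ) (one_lt_two (α := ℝ))
    have hp : (0 : ℝ) < 2 ^ m := by positivity
    have hstep : (b - a) / 2 ^ m < δ := by
      rw [div_lt_iff₀ hδ] at hm
      rw [div_lt_iff₀ hp]
      linarith
    set h := (b - a) / 2 ^ m with hh
    have hh0 : 0 < h := by positivity
    set k := ⌊(v - a) / h⌋₊ with hk
    have hk1 : (k : ℝ) ≤ (v - a) / h := Nat.floor_le (div_nonneg (by linarith) hh0.le)
    have hk2 : (v - a) / h < k + 1 := Nat.lt_floor_add_one _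
    rw [le_div_iff₀ hh0] at hk1
    rw [div_lt_iff₀ hh0] at hk2
    refine mem_iUnion.2 ⟨m, k + 1, ?_, ?_⟩
    · have hk3 : (k : ℝ) * h < 2 ^ m * h := by
        have : (2 : ℝ) ^ m * h = b - a := by rw [hh]; field_simp
        linarith
      have hk4 : (k : ℝ) < ((2 ^ m : ℕ) : ℝ) := by
        push_cast
        exact lt_of_mul_lt_mul_right hk3 hh0.le
      exact_mod_cast hk4
    · rw [← hg, ← hg, hτ0]
      have hτk : τ m (k + 1) = a + h * (k + 1) := by simp only [τ]; push_cast; rfl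
      have hmem : τ m (k + 1) ∈ Metric.ball v δ ∩ Ici v := by
        rw [hτk]
        refine ⟨?_, ?_⟩
        · rw [Metric.mem_ball, Real.dist_eq, abs_of_pos (by linarith)]
          linarith
        · rw [mem_Ici]; linarith
      exact hball hmem

/-- Maximal inequality: the oscillation of the path around `a` has stable tails. -/
lemma IsCadlagVersion.measure_exists_abs_sub_le [IsProbabilityMeasure P]
    (hL : IsCadlagVersion P M L) (hM : IsStableRandomMeasure P α β M)
    (hα : 0 < α) (hβ : β ∈ Icc (-1 : ℝ) 1) (a : ℝ) {T : ℝ} (hT : 0 < T) {r : ℝ} (hr : 0 < r) :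
    P {ω | ∃ v, |v - a| ≤ T ∧ r < |L v ω - L a ω|} ≤
      ENNReal.ofReal (8 * stableConst α * T * (8 / r) ^ α) := by
  refine (measure_mono fun ω hω => ?_).trans ((hL.measure_exists_Icc_le hM hα hβ
    (a := a - T) (b := a + T) (by linarith) (r := r / 4) (by positivity)).trans_eq ?_)
  · obtain ⟨v, hv, hlt⟩ := hω
    rw [abs_le] at hv
    by_contra hcon
    have hall : ∀ w ∈ Icc (a - T) (a + T), |L w ω - L (a - T) ω| ≤ 2 * (r / 4) := by
      intro w hw
      by_contra hc
      exact hcon ⟨w, hw, not_le.1 hc⟩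
    have h1 := hall v ⟨by linarith, by linarith⟩
    have h2 := hall a ⟨by linarith, by linarith⟩
    have h3 := abs_sub_le (L v ω) (L (a - T) ω) (L a ω)
    rw [abs_sub_comm (L (a - T) ω)] at h3
    linarith
  · congr 1
    have : 2 / (r / 4) = 8 / r := by field_simp; norm_num
    rw [this]
    ring

/-! ### Growth of the paths -/

/-- Union bound over the scales `ρ ^ k`; used with `ρ = 2` for the growth at infinity and with
`ρ = 1 / 2` for the modulus of continuity at the fixed point `a`. -/
lemma IsCadlagVersion.ae_exists_bound_geometric [IsProbabilityMeasure P]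
    (hL : IsCadlagVersion P M L) (hM : IsStableRandomMeasure P α β M)
    (hα : 0 < α) (hβ : β ∈ Icc (-1 : ℝ) 1) (a : ℝ) {ρ γ : ℝ} (hρ : 0 < ρ)
    (hργ : ρ ^ (1 - γ * α) < 1) :
    ∀ᵐ ω ∂P, ∃ C : ℝ, 0 ≤ C ∧ ∀ (k : ℕ) (v : ℝ), |v - a| ≤ ρ ^ k →
      |L v ω - L a ω| ≤ C * (ρ ^ k) ^ γ := by
  have hK := stableConst_pos α
  let E : ℕ → ℕ → Set Ω := fun m k =>
    {ω | ∃ v, |v - a| ≤ ρ ^ k ∧ ((m : ℝ) + 1) * (ρ ^ k) ^ γ < |L v ω - L a ω|}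
  set q := ρ ^ (1 - γ * α) with hq
  have hq0 : 0 ≤ q := by positivity
  set c := 8 * stableConst α * 8 ^ α with hc
  have hE : ∀ m k, P (E m k) ≤ ENNReal.ofReal (c * (1 / ((m : ℝ) + 1)) ^ α * q ^ k) := by
    intro m k
    have hpk : 0 < ρ ^ k := by positivity
    refine (hL.measure_exists_abs_sub_le hM hα hβ a hpk (by positivity)).trans_eq ?_
    congr 1
    have h1 : (8 / (((m : ℝ) + 1) * (ρ ^ k) ^ γ)) ^ α =
        8 ^ α * (1 / ((m : ℝ) + 1)) ^ α * (ρ ^ k) ^ (-(γ * α)) := by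
      rw [Real.rpow_neg hpk.le, Real.rpow_mul hpk.le, ← Real.inv_rpow (by positivity),
        ← Real.mul_rpow (by positivity) (by positivity),
        ← Real.mul_rpow (by positivity) (by positivity)]
      congr 1
      field_simp
    have h2 : ρ ^ k * (ρ ^ k) ^ (-(γ * α)) = q ^ k := by
      nth_rewrite 1 [← Real.rpow_one (ρ ^ k)]
      rw [← Real.rpow_add hpk, hq, ← Real.rpow_natCast, ← Real.rpow_natCast, ← Real.rpow_mul hρ.le,
        ← Real.rpow_mul hρ.le]
      congr 1
      ring
    rw [h1, ← h2, hc]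
    ring
  have hU : ∀ m, P (⋃ k, E m k) ≤
      ENNReal.ofReal (c * (1 / ((m : ℝ) + 1)) ^ α * (1 - q)⁻¹) := by
    intro m
    refine (measure_iUnion_le _).trans ((ENNReal.tsum_le_tsum (hE m)).trans_eq ?_)
    rw [← ENNReal.ofReal_tsum_of_nonneg (fun k => by positivity)
      ((summable_geometric_of_lt_one hq0 hργ).mul_left _), tsum_mul_left,
      tsum_geometric_of_lt_one hq0 hργ]
  have hlim : Tendsto (fun m : ℕ => ENNReal.ofReal (c * (1 / ((m : ℝ) + 1)) ^ α * (1 - q)⁻¹))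
      atTop (𝓝 0) := by
    have h1 := (tendsto_one_div_add_atTop_nhds_zero_nat (𝕜 := ℝ)).rpow_const
      (p := α) (Or.inr hα.le)
    rw [Real.zero_rpow hα.ne'] at h1
    have h2 := ENNReal.tendsto_ofReal ((h1.const_mul c).mul_const (1 - q)⁻¹)
    simpa using h2
  have hnull : P (⋂ m, ⋃ k, E m k) = 0 := by
    refine le_antisymm (ge_of_tendsto' hlim fun m => ?_) zero_le
    exact (measure_mono (iInter_subset _ m)).trans (hU m)
  filter_upwards [measure_eq_zero_iff_ae_notMem.1 hnull] with ω hω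
  simp only [mem_iInter, not_forall] at hω
  obtain ⟨m, hm⟩ := hω
  refine ⟨m + 1, by positivity, fun k v hv => ?_⟩
  by_contra hcon
  exact hm (mem_iUnion.2 ⟨k, v, hv, not_le.1 hcon⟩)

/-- The envelope `|s| ^ γ₁ + |s| ^ γ₂`, of order `γ₁` near `0` and `γ₂` at infinity when
`γ₁ < γ₂`. -/
noncomputable def envelope (γ₁ γ₂ s : ℝ) : ℝ := |s| ^ γ₁ + |s| ^ γ₂

lemma envelope_nonneg (γ₁ γ₂ s : ℝ) : 0 ≤ envelope γ₁ γ₂ s := by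
  unfold envelope; positivity

/-- Almost every path is controlled around a fixed point by an envelope whose exponents lie on
either side of the self-similarity index `1 / α`. -/
lemma IsCadlagVersion.ae_exists_envelope_bound [IsProbabilityMeasure P]
    (hL : IsCadlagVersion P M L) (hM : IsStableRandomMeasure P α β M)
    (hα : 0 < α) (hβ : β ∈ Icc (-1 : ℝ) 1) {γ₁ γ₂ : ℝ} (h1 : 0 < γ₁) (h1α : γ₁ < 1 / α)
    (h2α : 1 / α < γ₂) (a : ℝ) :
    ∀ᵐ ω ∂P, ∃ C : ℝ, 0 ≤ C ∧ ∀ v, |L v ω - L a ω| ≤ C * envelope γ₁ γ₂ (v - a) := by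
  rw [lt_div_iff₀ hα] at h1α
  rw [div_lt_iff₀ hα] at h2α
  have hγ2 : 0 < γ₂ := by
    by_contra hc
    nlinarith [mul_nonneg (neg_nonneg.2 (not_lt.1 hc)) hα.le]
  filter_upwards [hL.ae_exists_bound_geometric hM hα hβ a (ρ := 2) (γ := γ₂) two_pos
      (Real.rpow_lt_one_of_one_lt_of_neg one_lt_two (by linarith)),
    hL.ae_exists_bound_geometric hM hα hβ a (ρ := 1 / 2) (γ := γ₁) (by norm_num)
      (Real.rpow_lt_one (by norm_num) (by norm_num) (by linarith))] with ω hω2 hω1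
  obtain ⟨C₂, hC₂, hb2⟩ := hω2
  obtain ⟨C₁, hC₁, hb1⟩ := hω1
  refine ⟨C₁ * 2 ^ γ₁ + C₂ * 2 ^ γ₂, by positivity, fun v => ?_⟩
  rcases eq_or_ne v a with rfl | hva
  · simp only [sub_self, abs_zero]
    exact mul_nonneg (by positivity) (envelope_nonneg _ _ _)
  have hpos : 0 < |v - a| := abs_pos.2 (sub_ne_zero.2 hva)
  unfold envelope
  have e1 : 0 ≤ |v - a| ^ γ₁ := by positivity
  have e2 : 0 ≤ |v - a| ^ γ₂ := by positivity
  have f1 : 0 ≤ C₁ * 2 ^ γ₁ := by positivity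
  have f2 : 0 ≤ C₂ * 2 ^ γ₂ := by positivity
  rcases le_total 1 |v - a| with hle | hle
  · obtain ⟨n, hn1, hn2⟩ := exists_nat_pow_near hle (one_lt_two (α := ℝ))
    have h3 := hb2 (n + 1) v hn2.le
    have h4 : ((2 : ℝ) ^ (n + 1)) ^ γ₂ ≤ 2 ^ γ₂ * |v - a| ^ γ₂ := by
      rw [← Real.mul_rpow two_pos.le hpos.le]
      refine Real.rpow_le_rpow (by positivity) ?_ hγ2.le
      rw [pow_succ]
      linarith
    have h5 := mul_le_mul_of_nonneg_left h4 hC₂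
    nlinarith [mul_nonneg f1 e1, mul_nonneg f1 e2, mul_nonneg f2 e1]
  · obtain ⟨n, hn1, hn2⟩ := exists_nat_pow_near_of_lt_one hpos hle
      (y := (1 / 2 : ℝ)) (by norm_num) (by norm_num)
    have h3 := hb1 n v hn2
    have h4 : ((1 / 2 : ℝ) ^ n) ^ γ₁ ≤ 2 ^ γ₁ * |v - a| ^ γ₁ := by
      rw [← Real.mul_rpow two_pos.le hpos.le]
      refine Real.rpow_le_rpow (by positivity) ?_ h1.le
      rw [pow_succ] at hn1
      linarith
    have h5 := mul_le_mul_of_nonneg_left h4 hC₁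
    nlinarith [mul_nonneg f1 e2, mul_nonneg f2 e2, mul_nonneg f2 e1]

end LevyPath

/-! ### Mixtures of the values of a right-continuous function -/

section Mixture

/-- The part of `[-n, n]` on which both weights are at most `n`. -/
def cutoffSet (a b : ℝ → ℝ) (n : ℕ) : Set ℝ := {v | |v| ≤ n ∧ |a v| ≤ n ∧ |b v| ≤ n}

/-- The least point of the grid `(m + 1)⁻¹ ℤ` strictly to the right of `v`. -/
noncomputable def gridPoint (m : ℕ) (v : ℝ) : ℝ := ((⌊v * (m + 1)⌋ + 1 : ℤ) : ℝ) / (m + 1)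

/-- The finite linear combination of values of `ℓ` that arises from `∫ (a v • ℓ v + b v • ℓ t) dv`
over `cutoffSet a b n` when `ℓ v` is replaced by the value of `ℓ` at the grid point after `v`. -/
noncomputable def stepSum {E : Type*} [NormedAddCommGroup E] [NormedSpace ℝ E] (a b : ℝ → ℝ)
    (t : ℝ) (n m : ℕ) (ℓ : ℝ → E) : E :=
  ∑ k ∈ Finset.Icc (-((n : ℤ) * (m + 1))) (n * (m + 1) + 1),
    (∫ v in cutoffSet a b n ∩ {v | ⌊v * (m + 1)⌋ + 1 = k}, a v) • ℓ ((k : ℝ) / (m + 1)) +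
  (∫ v in cutoffSet a b n, b v) • ℓ t

variable {E : Type*} [NormedAddCommGroup E] [NormedSpace ℝ E] {a b : ℝ → ℝ} {t : ℝ}

lemma measurableSet_cutoffSet (ha : Measurable a) (hb : Measurable b) (n : ℕ) :
    MeasurableSet (cutoffSet a b n) :=
  (measurableSet_le measurable_abs measurable_const).inter
    ((measurableSet_le ha.abs measurable_const).inter (measurableSet_le hb.abs measurable_const))

lemma volume_cutoffSet_lt_top (a b : ℝ → ℝ) (n : ℕ) : volume (cutoffSet a b n) < ∞ := by
  refine (measure_mono (t := Icc (-(n : ℝ)) n) fun v hv => ?_).trans_lt measure_Icc_lt_top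
  exact abs_le.1 hv.1

lemma monotone_cutoffSet (a b : ℝ → ℝ) : Monotone (cutoffSet a b) := by
  intro i j hij v hv
  have h : (i : ℝ) ≤ j := by exact_mod_cast hij
  exact ⟨hv.1.trans h, hv.2.1.trans h, hv.2.2.trans h⟩

lemma iUnion_cutoffSet (a b : ℝ → ℝ) : ⋃ n, cutoffSet a b n = univ := by
  refine eq_univ_of_forall fun v => ?_
  obtain ⟨n, hn⟩ := exists_nat_ge (|v| + |a v| + |b v|)
  have h1 := abs_nonneg v
  have h2 := abs_nonneg (a v)
  have h3 := abs_nonneg (b v)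
  exact mem_iUnion.2 ⟨n, by linarith, by linarith, by linarith⟩

lemma integrableOn_cutoffSet_left (ha : Measurable a) (hb : Measurable b) (n : ℕ) :
    IntegrableOn a (cutoffSet a b n) :=
  Measure.integrableOn_of_bounded (M := n) (volume_cutoffSet_lt_top a b n).ne
    ha.aestronglyMeasurable
    ((ae_restrict_iff' (measurableSet_cutoffSet ha hb n)).2
      (Eventually.of_forall fun _ hv => hv.2.1))

lemma integrableOn_cutoffSet_right (ha : Measurable a) (hb : Measurable b) (n : ℕ) :
    IntegrableOn b (cutoffSet a b n) :=
  Measure.integrableOn_of_bounded (M := n) (volume_cutoffSet_lt_top a b n).ne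
    hb.aestronglyMeasurable
    ((ae_restrict_iff' (measurableSet_cutoffSet ha hb n)).2
      (Eventually.of_forall fun _ hv => hv.2.2))

lemma lt_gridPoint (m : ℕ) (v : ℝ) : v < gridPoint m v := by
  have hm : (0 : ℝ) < m + 1 := by positivity
  rw [gridPoint, lt_div_iff₀ hm]
  push_cast
  exact Int.lt_floor_add_one _

lemma gridPoint_le (m : ℕ) (v : ℝ) : gridPoint m v ≤ v + 1 / ((m : ℝ) + 1) := by
  have hm : (0 : ℝ) < m + 1 := by positivity
  rw [gridPoint, div_le_iff₀ hm, add_mul, one_div, inv_mul_cancel₀ hm.ne']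
  push_cast
  linarith [Int.floor_le (v * (m + 1))]

lemma tendsto_gridPoint (v : ℝ) : Tendsto (fun m => gridPoint m v) atTop (𝓝[≥] v) := by
  refine tendsto_nhdsWithin_iff.2 ⟨?_, Eventually.of_forall fun m => (lt_gridPoint m v).le⟩
  have h1 : Tendsto (fun m : ℕ => v + 1 / ((m : ℝ) + 1)) atTop (𝓝 v) := by
    simpa using (tendsto_one_div_add_atTop_nhds_zero_nat (𝕜 := ℝ)).const_add v
  exact tendsto_of_tendsto_of_tendsto_of_le_of_le tendsto_const_nhds h1
    (fun m => (lt_gridPoint m v).le) fun m => gridPoint_le m v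

lemma measurable_floor_mul (m : ℕ) : Measurable fun v : ℝ => ⌊v * (m + 1)⌋ + 1 :=
  (Int.measurable_floor.comp (measurable_id.mul_const _)).add_const 1

lemma stronglyMeasurable_comp_gridPoint {F : Type*} [NormedAddCommGroup F] (ℓ : ℝ → F) (m : ℕ) :
    StronglyMeasurable fun v => ℓ (gridPoint m v) :=
  (StronglyMeasurable.of_discrete (f := fun k : ℤ => ℓ ((k : ℝ) / (m + 1)))).comp_measurable
    (measurable_floor_mul m)

lemma stronglyMeasurable_of_rightContinuous {F : Type*} [NormedAddCommGroup F] {ℓ : ℝ → F}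
    (hℓ : ∀ v, ContinuousWithinAt ℓ (Ici v) v) : StronglyMeasurable ℓ :=
  stronglyMeasurable_of_tendsto atTop (fun m => stronglyMeasurable_comp_gridPoint ℓ m)
    (tendsto_pi_nhds.2 fun v => (hℓ v).tendsto.comp (tendsto_gridPoint v))

lemma stepSum_eq_setIntegral [CompleteSpace E] (ha : Measurable a) (hb : Measurable b) (n m : ℕ)
    (ℓ : ℝ → E) :
    stepSum a b t n m ℓ =
      ∫ v in cutoffSet a b n, (a v • ℓ (gridPoint m v) + b v • ℓ t) := by
  classical
  have hC := measurableSet_cutoffSet ha hb n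
  have hia := integrableOn_cutoffSet_left ha hb n
  have hib := integrableOn_cutoffSet_right ha hb n
  set K := Finset.Icc (-((n : ℤ) * (m + 1))) (n * (m + 1) + 1) with hK
  have hD : ∀ k : ℤ, MeasurableSet {v : ℝ | ⌊v * (m + 1)⌋ + 1 = k} := fun k =>
    measurable_floor_mul m (measurableSet_singleton k)
  have hterm : ∀ k : ℤ, IntegrableOn
      (fun v => {v : ℝ | ⌊v * (m + 1)⌋ + 1 = k}.indicator a v • ℓ ((k : ℝ) / (m + 1)))
      (cutoffSet a b n) := fun k => (hia.indicator (hD k)).smul_const _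
  have hpt : ∀ v ∈ cutoffSet a b n, a v • ℓ (gridPoint m v) =
      ∑ k ∈ K, {v : ℝ | ⌊v * (m + 1)⌋ + 1 = k}.indicator a v • ℓ ((k : ℝ) / (m + 1)) := by
    intro v hv
    have hmem : ⌊v * (m + 1)⌋ + 1 ∈ K := by
      have hv1 := abs_le.1 hv.1
      have hm : (0 : ℝ) ≤ m + 1 := by positivity
      have h1 : -((n : ℤ) * (m + 1)) ≤ ⌊v * (m + 1)⌋ := by
        rw [Int.le_floor]; push_cast; nlinarith
      have h2 : ⌊v * (m + 1)⌋ ≤ (n : ℤ) * (m + 1) := by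
        have h3 : (⌊v * (m + 1)⌋ : ℝ) ≤ n * (m + 1) := (Int.floor_le _).trans (by nlinarith)
        exact_mod_cast h3
      rw [hK, Finset.mem_Icc]
      constructor <;> linarith
    rw [Finset.sum_eq_single_of_mem _ hmem]
    · rw [indicator_of_mem (by rfl)]
      rfl
    · intro k _ hk
      have hk' : v ∉ {v : ℝ | ⌊v * (m + 1)⌋ + 1 = k} := fun h => hk (Eq.symm h)
      rw [indicator_of_notMem hk', zero_smul]
  have hsplit : ∫ v in cutoffSet a b n, (a v • ℓ (gridPoint m v) + b v • ℓ t) =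
      ∫ v in cutoffSet a b n, ((∑ k ∈ K,
        {v : ℝ | ⌊v * (m + 1)⌋ + 1 = k}.indicator a v • ℓ ((k : ℝ) / (m + 1))) + b v • ℓ t) :=
    setIntegral_congr_fun hC fun v hv => by
      simp only [hpt v hv]
  rw [hsplit, integral_add (integrable_finsetSum _ fun k _ => hterm k) (hib.smul_const _),
    integral_finsetSum _ fun k _ => hterm k, integral_smul_const, stepSum]
  congr 1
  refine Finset.sum_congr rfl fun k _ => ?_
  rw [integral_smul_const, setIntegral_indicator (hD k)]

lemma tendsto_stepSum [CompleteSpace E] (ha : Measurable a) (hb : Measurable b) (n : ℕ)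
    {ℓ : ℝ → E} (hℓ : ∀ v, ContinuousWithinAt ℓ (Ici v) v)
    (hbd : ∀ N : ℕ, ∃ B, ∀ v : ℝ, |v| ≤ N → ‖ℓ v‖ ≤ B) :
    Tendsto (fun m => stepSum a b t n m ℓ) atTop
      (𝓝 (∫ v in cutoffSet a b n, (a v • ℓ v + b v • ℓ t))) := by
  have hC := measurableSet_cutoffSet ha hb n
  obtain ⟨B, hB⟩ := hbd (n + 1)
  have : IsFiniteMeasure (volume.restrict (cutoffSet a b n)) :=
    ⟨by rw [Measure.restrict_apply_univ]; exact volume_cutoffSet_lt_top a b n⟩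
  simp only [stepSum_eq_setIntegral ha hb]
  refine tendsto_integral_of_dominated_convergence (fun _ => n * B + n * ‖ℓ t‖) (fun m => ?_)
    (integrable_const _) (fun m => ?_) ?_
  · exact ((ha.aestronglyMeasurable.smul
      (stronglyMeasurable_comp_gridPoint ℓ m).aestronglyMeasurable)).add
      (hb.aestronglyMeasurable.smul aestronglyMeasurable_const)
  · rw [ae_restrict_iff' hC]
    refine Eventually.of_forall fun v hv => ?_
    refine (norm_add_le _ _).trans (add_le_add ?_ ?_)
    · rw [norm_smul, Real.norm_eq_abs]
      refine mul_le_mul hv.2.1 (hB _ ?_) (norm_nonneg _) (Nat.cast_nonneg n)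
      have h1 := lt_gridPoint m v
      have h2 := gridPoint_le m v
      have h3 : 1 / ((m : ℝ) + 1) ≤ 1 := by
        rw [div_le_one (by positivity)]
        linarith [Nat.cast_nonneg (α := ℝ) m]
      have h4 := abs_le.1 hv.1
      rw [abs_le]
      push_cast
      constructor <;> linarith
    · rw [norm_smul, Real.norm_eq_abs]
      exact mul_le_mul_of_nonneg_right hv.2.2 (norm_nonneg _)
  · refine Eventually.of_forall fun v => ?_
    exact (((hℓ v).tendsto.comp (tendsto_gridPoint v)).const_smul (a v)).add_const _

lemma tendsto_setIntegral_cutoffSet (ha : Measurable a) (hb : Measurable b) {g : ℝ → E}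
    (hg : Integrable g) :
    Tendsto (fun n => ∫ v in cutoffSet a b n, g v) atTop (𝓝 (∫ v, g v)) := by
  have := tendsto_setIntegral_of_monotone (f := g) (μ := volume)
    (fun n => measurableSet_cutoffSet ha hb n) (monotone_cutoffSet a b) hg.integrableOn
  rwa [iUnion_cutoffSet, setIntegral_univ] at this

/-- The common majorant, up to a constant, of `‖a v • ℓ v + b v • ℓ t‖` for all `ℓ` with
`‖ℓ v‖ ≤ C e(v)` and `‖ℓ v - ℓ t‖ ≤ C e(v - t)`, where `e` is the envelope. The first bound is used
near the singularities of the weights, the second one at infinity. -/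
noncomputable def majorant (γ₁ γ₂ : ℝ) (a b : ℝ → ℝ) (t v : ℝ) : ℝ :=
  min (|a v + b v| * envelope γ₁ γ₂ v + |b v| * envelope γ₁ γ₂ (v - t))
    (|a v| * envelope γ₁ γ₂ v + |b v| * envelope γ₁ γ₂ t)

/-- `ℓ` is right-continuous and has increments around `0` and `t` dominated by the envelope. -/
structure HasEnvelope (γ₁ γ₂ t : ℝ) (ℓ : ℝ → E) : Prop where
  rightContinuous : ∀ v, ContinuousWithinAt ℓ (Ici v) v
  exists_bound : ∃ C, 0 ≤ C ∧ ∀ v, ‖ℓ v‖ ≤ C * envelope γ₁ γ₂ v ∧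
    ‖ℓ v - ℓ t‖ ≤ C * envelope γ₁ γ₂ (v - t)

lemma HasEnvelope.locally_bounded {F : Type*} [NormedAddCommGroup F] {γ₁ γ₂ : ℝ} (h1 : 0 < γ₁)
    (h2 : 0 < γ₂) {ℓ : ℝ → F}
    (hℓ : HasEnvelope γ₁ γ₂ t ℓ) (N : ℕ) : ∃ B, ∀ v : ℝ, |v| ≤ N → ‖ℓ v‖ ≤ B := by
  obtain ⟨C, hC, hb⟩ := hℓ.exists_bound
  refine ⟨C * ((N : ℝ) ^ γ₁ + (N : ℝ) ^ γ₂), fun v hv => (hb v).1.trans ?_⟩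
  unfold envelope
  gcongr

lemma HasEnvelope.integrable {γ₁ γ₂ : ℝ} {ℓ : ℝ → E} (hℓ : HasEnvelope γ₁ γ₂ t ℓ)
    (ha : Measurable a) (hb : Measurable b) (hm : Integrable (majorant γ₁ γ₂ a b t)) :
    Integrable fun v => a v • ℓ v + b v • ℓ t := by
  obtain ⟨C, hC, hbd⟩ := hℓ.exists_bound
  refine (hm.const_mul C).mono' ?_ (Eventually.of_forall fun v => ?_)
  · exact (ha.aestronglyMeasurable.smul
      (stronglyMeasurable_of_rightContinuous hℓ.rightContinuous).aestronglyMeasurable).add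
      (hb.aestronglyMeasurable.smul aestronglyMeasurable_const)
  · have h1 := hbd v
    have h2 := (hbd t).1
    rw [majorant, mul_min_of_nonneg _ _ hC]
    refine le_min ?_ ?_
    · have h3 : a v • ℓ v + b v • ℓ t = (a v + b v) • ℓ v - b v • (ℓ v - ℓ t) := by module
      rw [h3]
      refine (norm_sub_le _ _).trans ?_
      rw [norm_smul, norm_smul, Real.norm_eq_abs, Real.norm_eq_abs]
      have h4 := mul_le_mul_of_nonneg_left h1.1 (abs_nonneg (a v + b v))
      have h5 := mul_le_mul_of_nonneg_left h1.2 (abs_nonneg (b v))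
      linarith
    · refine (norm_add_le _ _).trans ?_
      rw [norm_smul, norm_smul, Real.norm_eq_abs, Real.norm_eq_abs]
      have h4 := mul_le_mul_of_nonneg_left h1.1 (abs_nonneg (a v))
      have h5 := mul_le_mul_of_nonneg_left h2 (abs_nonneg (b v))
      linarith

lemma rpow_le_envelope {γ₁ γ γ₂ : ℝ} (h1 : γ₁ ≤ γ) (h2 : γ ≤ γ₂) (hγ : 0 < γ) (x : ℝ) :
    |x| ^ γ ≤ envelope γ₁ γ₂ x := by
  unfold envelope
  have e1 : 0 ≤ |x| ^ γ₁ := by positivity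
  have e2 : 0 ≤ |x| ^ γ₂ := by positivity
  rcases (abs_nonneg x).eq_or_lt with h | h
  · rw [← h, Real.zero_rpow hγ.ne', h]
    linarith
  rcases le_total |x| 1 with h' | h'
  · have := Real.rpow_le_rpow_of_exponent_ge h h' h1
    linarith
  · have := Real.rpow_le_rpow_of_exponent_le h' h2
    linarith

end Mixture

/-! ### The indicator kernel of the Lévy process -/

section IndicatorKernel

/-- The integrand `1_{(0, v]} - 1_{(v, 0]}`, whose stochastic integral is `L_v`. -/
noncomputable def levyKernel (v u : ℝ) : ℝ :=
  (Ioc 0 v).indicator 1 u - (Ioc v 0).indicator 1 u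

lemma levyKernel_sub {s v : ℝ} (hsv : s ≤ v) (u : ℝ) :
    levyKernel v u - levyKernel s u = (Ioc s v).indicator (fun _ => (1 : ℝ)) u := by
  simp only [levyKernel, indicator, mem_Ioc, Pi.one_apply]
  split_ifs <;> first | (exfalso; grind) | norm_num

lemma levyKernel_eventually_eq (v u : ℝ) :
    ∀ᶠ s in 𝓝[≥] v, levyKernel s u = levyKernel v u := by
  rcases le_or_gt u v with h | h
  · filter_upwards [self_mem_nhdsWithin] with s hs
    have hs' : v ≤ s := hs
    have h0 := levyKernel_sub hs' u
    rw [indicator_of_notMem (fun h' => absurd h'.1 (not_lt.2 h))] at h0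
    linarith
  · filter_upwards [self_mem_nhdsWithin, mem_nhdsWithin_of_mem_nhds (Iio_mem_nhds h)] with s hs hs2
    have hs' : v ≤ s := hs
    have h0 := levyKernel_sub hs' u
    rw [indicator_of_notMem (fun h' => absurd h'.2 (not_le.2 hs2))] at h0
    linarith

lemma abs_levyKernel_sub_le (v s u : ℝ) : |levyKernel v u - levyKernel s u| ≤ 1 := by
  rcases le_total s v with h | h
  · rw [levyKernel_sub h, indicator]; split_ifs <;> simp
  · rw [abs_sub_comm, levyKernel_sub h, indicator]; split_ifs <;> simp

lemma levyKernel_sub_eq_zero {v s u : ℝ} (h : |v - s| < |u - s|) :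
    levyKernel v u - levyKernel s u = 0 := by
  rcases le_total s v with h' | h'
  · rw [levyKernel_sub h', indicator_of_notMem]
    rintro ⟨h1, h2⟩
    rw [abs_of_nonneg (by linarith), abs_of_pos (by linarith)] at h
    linarith
  · rw [← neg_sub, levyKernel_sub h', indicator_of_notMem, neg_zero]
    rintro ⟨h1, h2⟩
    rw [abs_of_nonpos (by linarith), abs_of_nonpos (by linarith)] at h
    linarith

lemma levyKernel_zero (u : ℝ) : levyKernel 0 u = 0 := by simp [levyKernel]

lemma hasEnvelope_levyKernel_apply {γ₁ γ₂ t u : ℝ} (h1 : 0 < γ₁) (hu : u ≠ 0) (hut : u ≠ t) :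
    HasEnvelope γ₁ γ₂ t (fun v => levyKernel v u) where
  rightContinuous v := by
    refine (continuousWithinAt_const (b := levyKernel v u)).congr_of_eventuallyEq
      (levyKernel_eventually_eq v u) rfl
  exists_bound := by
    have key : ∀ s, u ≠ s → ∀ v, |levyKernel v u - levyKernel s u| ≤
        1 / |u - s| ^ γ₁ * envelope γ₁ γ₂ (v - s) := by
      intro s hus v
      have hpos : 0 < |u - s| := abs_pos.2 (sub_ne_zero.2 hus)
      rcases lt_or_ge |v - s| |u - s| with h | h
      · rw [levyKernel_sub_eq_zero h, abs_zero]
        exact mul_nonneg (by positivity) (envelope_nonneg _ _ _)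
      · refine (abs_levyKernel_sub_le v s u).trans ?_
        rw [one_div, inv_mul_eq_div, one_le_div (by positivity)]
        have h3 := Real.rpow_le_rpow hpos.le h h1.le
        have h4 : 0 ≤ |v - s| ^ γ₂ := by positivity
        unfold envelope
        linarith
    refine ⟨1 / |u| ^ γ₁ + 1 / |u - t| ^ γ₁, by positivity, fun v => ⟨?_, ?_⟩⟩
    · have h3 := key 0 hu v
      rw [levyKernel_zero, sub_zero, sub_zero, sub_zero] at h3
      rw [Real.norm_eq_abs, add_mul]
      have : 0 ≤ 1 / |u - t| ^ γ₁ * envelope γ₁ γ₂ v :=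
        mul_nonneg (by positivity) (envelope_nonneg _ _ _)
      linarith
    · have h3 := key t hut v
      rw [Real.norm_eq_abs, add_mul]
      have : 0 ≤ 1 / |u| ^ γ₁ * envelope γ₁ γ₂ (v - t) :=
        mul_nonneg (by positivity) (envelope_nonneg _ _ _)
      linarith

variable {α : ℝ}

lemma memLp_indicator_Ioc (p : ℝ≥0∞) (s v : ℝ) :
    MemLp ((Ioc s v).indicator fun _ => (1 : ℝ)) p volume :=
  memLp_indicator_const p measurableSet_Ioc 1 (Or.inr measure_Ioc_lt_top.ne)

lemma memLp_levyKernel (p : ℝ≥0∞) (v : ℝ) : MemLp (levyKernel v) p volume :=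
  (memLp_indicator_Ioc p 0 v).sub (memLp_indicator_Ioc p v 0)

/-- `levyKernel v` as an element of `L^α`. -/
noncomputable def levyKernelLp (α v : ℝ) : Lp ℝ (ENNReal.ofReal α) (volume : Measure ℝ) :=
  (memLp_levyKernel (ENNReal.ofReal α) v).toLp _

lemma norm_levyKernelLp_sub_of_le (hα : 0 < α) {s v : ℝ} (hsv : s ≤ v) :
    ‖levyKernelLp α v - levyKernelLp α s‖ = |v - s| ^ (1 / α) := by
  rw [levyKernelLp, levyKernelLp, ← MemLp.toLp_sub, Lp.norm_toLp]
  have h1 : (levyKernel v - levyKernel s) = (Ioc s v).indicator fun _ => (1 : ℝ) :=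
    funext fun u => levyKernel_sub hsv u
  rw [h1, eLpNorm_indicator_const measurableSet_Ioc (by simpa using hα) (by simp),
    enorm_one, one_mul, Real.volume_Ioc, ENNReal.toReal_ofReal hα.le,
    ← ENNReal.toReal_rpow, ENNReal.toReal_ofReal (sub_nonneg.2 hsv),
    abs_of_nonneg (sub_nonneg.2 hsv)]

lemma norm_levyKernelLp_sub [Fact (1 ≤ ENNReal.ofReal α)] (hα : 0 < α) (s v : ℝ) :
    ‖levyKernelLp α v - levyKernelLp α s‖ = |v - s| ^ (1 / α) := by
  rcases le_total s v with h | h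
  · exact norm_levyKernelLp_sub_of_le hα h
  · rw [norm_sub_rev, abs_sub_comm]
    exact norm_levyKernelLp_sub_of_le hα h

lemma levyKernelLp_zero (α : ℝ) : levyKernelLp α 0 = 0 := by
  refine Lp.ext ?_
  filter_upwards [(memLp_levyKernel (ENNReal.ofReal α) 0).coeFn_toLp,
    Lp.coeFn_zero ℝ (ENNReal.ofReal α) (volume : Measure ℝ)] with u h1 h2
  rw [levyKernelLp, h1, h2, levyKernel_zero, Pi.zero_apply]

lemma hasEnvelope_levyKernelLp [Fact (1 ≤ ENNReal.ofReal α)] {γ₁ γ₂ t : ℝ} (hα : 0 < α)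
    (h1 : γ₁ ≤ 1 / α) (h2 : 1 / α ≤ γ₂) :
    HasEnvelope γ₁ γ₂ t (levyKernelLp α) where
  rightContinuous v := by
    refine ContinuousAt.continuousWithinAt ?_
    rw [ContinuousAt, tendsto_iff_norm_sub_tendsto_zero]
    simp only [norm_levyKernelLp_sub hα]
    have h3 : Tendsto (fun s : ℝ => |s - v|) (𝓝 v) (𝓝 0) := by
      have : Continuous fun s : ℝ => |s - v| := by fun_prop
      simpa using this.tendsto v
    have h4 := h3.rpow_const (p := 1 / α) (Or.inr (by positivity))
    rwa [Real.zero_rpow (by positivity)] at h4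
  exists_bound := by
    refine ⟨1, zero_le_one, fun v => ⟨?_, ?_⟩⟩
    · have := norm_levyKernelLp_sub hα 0 v
      rw [levyKernelLp_zero, sub_zero, sub_zero] at this
      rw [this, one_mul]
      exact rpow_le_envelope h1 h2 (by positivity) v
    · rw [norm_levyKernelLp_sub hα, one_mul]
      exact rpow_le_envelope h1 h2 (by positivity) _

lemma Lp_ae_eq_of_tendsto [Fact (1 ≤ ENNReal.ofReal α)]
    {G : ℕ → Lp ℝ (ENNReal.ofReal α) (volume : Measure ℝ)}
    {F : Lp ℝ (ENNReal.ofReal α) (volume : Measure ℝ)}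
    (hG : Tendsto G atTop (𝓝 F)) {g : ℕ → ℝ → ℝ} {f : ℝ → ℝ}
    (hg : ∀ n, (G n : ℝ → ℝ) =ᵐ[volume] g n)
    (hf : ∀ᵐ u, Tendsto (fun n => g n u) atTop (𝓝 (f u))) : (F : ℝ → ℝ) =ᵐ[volume] f := by
  obtain ⟨ns, hns, hlim⟩ := (tendstoInMeasure_of_tendsto_Lp hG).exists_seq_tendsto_ae
  filter_upwards [hlim, hf, ae_all_iff.2 hg] with u h1 h2 h3
  refine tendsto_nhds_unique h1 ?_
  simp only [h3]
  exact h2.comp hns.tendsto_atTop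

lemma coeFn_stepSum_levyKernelLp [Fact (1 ≤ ENNReal.ofReal α)] (a b : ℝ → ℝ) (t : ℝ) (n m : ℕ) :
    ((stepSum a b t n m (levyKernelLp α) : Lp ℝ (ENNReal.ofReal α) (volume : Measure ℝ)) :
      ℝ → ℝ) =ᵐ[volume]
      fun u => stepSum a b t n m (fun v => levyKernel v u) := by
  have hJ : ∀ v, (levyKernelLp α v : ℝ → ℝ) =ᵐ[volume] levyKernel v := fun v =>
    MemLp.coeFn_toLp _
  have hsum : ∀ (s : Finset ℤ) (c : ℤ → ℝ),
      ((∑ k ∈ s, c k • levyKernelLp α ((k : ℝ) / (m + 1)) :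
        Lp ℝ (ENNReal.ofReal α) (volume : Measure ℝ)) : ℝ → ℝ) =ᵐ[volume]
        fun u => ∑ k ∈ s, c k • levyKernel ((k : ℝ) / (m + 1)) u := by
    intro s c
    induction s using Finset.induction_on with
    | empty =>
      simp only [Finset.sum_empty]
      exact Lp.coeFn_zero ℝ (ENNReal.ofReal α) (volume : Measure ℝ)
    | insert k s hk ih =>
      rw [Finset.sum_insert hk]
      filter_upwards [Lp.coeFn_add (c k • levyKernelLp α ((k : ℝ) / (m + 1)))
        (∑ k ∈ s, c k • levyKernelLp α ((k : ℝ) / (m + 1))), ih,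
        Lp.coeFn_smul (c k) (levyKernelLp α ((k : ℝ) / (m + 1))), hJ ((k : ℝ) / (m + 1))]
        with u h1 h2 h3 h4
      rw [h1, Pi.add_apply, h2, h3, Pi.smul_apply, h4, Finset.sum_insert hk]
  unfold stepSum
  set c0 := ∫ v in cutoffSet a b n, b v
  filter_upwards [Lp.coeFn_add (∑ k ∈ Finset.Icc (-((n : ℤ) * (m + 1))) (n * (m + 1) + 1),
    (∫ v in cutoffSet a b n ∩ {v | ⌊v * (m + 1)⌋ + 1 = k}, a v) •
      levyKernelLp α ((k : ℝ) / (m + 1))) (c0 • levyKernelLp α t), hsum _ _,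
    Lp.coeFn_smul c0 (levyKernelLp α t), hJ t] with u h1 h2 h3 h4
  rw [h1, Pi.add_apply, h2, h3, Pi.smul_apply, h4]

end IndicatorKernel

/-! ### Exchanging the stochastic integral and a Lebesgue integral -/

section StochasticFubini

variable {Ω : Type*} [MeasurableSpace Ω] {P : Measure Ω} {α β : ℝ} {M : Set ℝ → Ω → ℝ}
  {L : ℝ → Ω → ℝ}

lemma IsStableRandomMeasure.isStableIntegral_indicator [IsProbabilityMeasure P]
    (hM : IsStableRandomMeasure P α β M) (hα : 0 < α) (hβ : β ∈ Icc (-1 : ℝ) 1) {A : Set ℝ}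
    (hA : MeasurableSet A) (hA' : volume A < ∞) :
    IsStableIntegral P α M (A.indicator 1) (M A) := by
  classical
  let g : SimpleFunc ℝ ℝ := SimpleFunc.piecewise A hA (SimpleFunc.const ℝ 1) (SimpleFunc.const ℝ 0)
  have hgA : ∀ u, g u = A.indicator 1 u := fun u => by
    simp [g, SimpleFunc.piecewise_apply, indicator]
  have hg : MemLp g (ENNReal.ofReal α) volume := by
    have : (g : ℝ → ℝ) = A.indicator fun _ => (1 : ℝ) := funext hgA
    rw [this]
    exact memLp_indicator_const _ hA 1 (Or.inr hA'.ne)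
  refine (isStableIntegral_simpleFunc hg).congr (Eventually.of_forall hgA) ?_
  filter_upwards [hM.ae_eq_zero hα hβ MeasurableSet.empty (by simp)] with ω h0
  have hsub : g.range ⊆ {0, 1} := by
    intro c hc
    obtain ⟨u, rfl⟩ := SimpleFunc.mem_range.1 hc
    rw [hgA, indicator]
    split_ifs <;> simp
  have hpre : g ⁻¹' {1} = A := by
    ext u
    rw [mem_preimage, hgA, mem_singleton_iff, indicator]
    split_ifs with h <;> simp [h]
  rw [simpleStableIntegral, Finset.sum_subset hsub, Finset.sum_pair zero_ne_one, zero_mul,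
    zero_add, one_mul, hpre]
  intro c _ hc
  rw [(SimpleFunc.preimage_eq_empty_iff g c).2 hc, h0,
    mul_zero]

lemma IsCadlagVersion.isStableIntegral_levyKernel [IsProbabilityMeasure P]
    (hL : IsCadlagVersion P M L) (hM : IsStableRandomMeasure P α β M)
    (hα : 1 ≤ α) (hβ : β ∈ Icc (-1 : ℝ) 1) (v : ℝ) :
    IsStableIntegral P α M (levyKernel v) (L v) := by
  have hα0 : 0 < α := by linarith
  have h1 := (hM.isStableIntegral_indicator hα0 hβ (measurableSet_Ioc (a := 0) (b := v))
    measure_Ioc_lt_top).lincomb hM hα hβ (hM.isStableIntegral_indicator hα0 hβ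
      (measurableSet_Ioc (a := v) (b := 0)) measure_Ioc_lt_top) 1 (-1)
  refine h1.congr (Eventually.of_forall fun u => by simp [levyKernel, sub_eq_add_neg]) ?_
  have h0 := hM.ae_eq_zero hα0 hβ MeasurableSet.empty (by simp)
  filter_upwards [h0, hL.ae_eq_cumulativeMass hM hα0 hβ v] with ω h0 h2
  rw [h2, cumulativeMass]
  split_ifs with hv
  · rw [Ioc_eq_empty (not_lt.2 hv), h0]; ring
  · rw [Ioc_eq_empty (fun h => hv h.le), h0]; ring

lemma IsCadlagVersion.isStableIntegral_stepSum [IsProbabilityMeasure P]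
    (hL : IsCadlagVersion P M L) (hM : IsStableRandomMeasure P α β M)
    (hα : 1 ≤ α) (hβ : β ∈ Icc (-1 : ℝ) 1) (a b : ℝ → ℝ) (t : ℝ) (n m : ℕ) :
    IsStableIntegral P α M (fun u => stepSum a b t n m (fun v => levyKernel v u))
      (fun ω => stepSum a b t n m (fun v => L v ω)) := by
  have hJ := hL.isStableIntegral_levyKernel hM hα hβ
  have hsum : ∀ (s : Finset ℤ) (c : ℤ → ℝ), IsStableIntegral P α M
      (fun u => ∑ k ∈ s, c k • levyKernel ((k : ℝ) / (m + 1)) u)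
      (fun ω => ∑ k ∈ s, c k • L ((k : ℝ) / (m + 1)) ω) := by
    intro s c
    induction s using Finset.induction_on with
    | empty => simpa using (hJ 0).lincomb hM hα hβ (hJ 0) 0 0
    | insert k s hk ih =>
      simp only [Finset.sum_insert hk, smul_eq_mul] at ih ⊢
      simpa using (hJ ((k : ℝ) / (m + 1))).lincomb hM hα hβ ih (c k) 1
  have h := (hsum (Finset.Icc (-((n : ℤ) * (m + 1))) (n * (m + 1) + 1)) fun k =>
    ∫ v in cutoffSet a b n ∩ {v | ⌊v * (m + 1)⌋ + 1 = k}, a v).lincomb hM hα hβ (hJ t) 1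
    (∫ v in cutoffSet a b n, b v)
  simp only [one_mul] at h
  exact h

lemma IsStableIntegral.of_tendsto_Lp [IsProbabilityMeasure P] [Fact (1 ≤ ENNReal.ofReal α)]
    (hM : IsStableRandomMeasure P α β M) (hα : 1 ≤ α)
    {G : ℕ → Lp ℝ (ENNReal.ofReal α) (volume : Measure ℝ)}
    {F : Lp ℝ (ENNReal.ofReal α) (volume : Measure ℝ)}
    (hG : Tendsto G atTop (𝓝 F)) {Y : ℕ → Ω → ℝ} {Y' : Ω → ℝ}
    (h : ∀ n, IsStableIntegral P α M (G n) (Y n))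
    (hY : ∀ᵐ ω ∂P, Tendsto (fun n => Y n ω) atTop (𝓝 (Y' ω))) :
    IsStableIntegral P α M F Y' := by
  refine IsStableIntegral.of_tendsto hM hα h (Lp.memLp F) ?_ hY
  have h1 := (Lp.tendsto_Lp_iff_tendsto_eLpNorm' G F).1 hG
  refine h1.congr fun n => ?_
  rw [← eLpNorm_neg]
  congr 1
  funext u
  simp

/-- A stochastic Fubini theorem. The mixture `∫ (a v J_v + b v J_t) dv` of the integrands
`J_v = levyKernel v` has the stochastic integral `∫ (a v L_v + b v L_t) dv`. Both sides are iterated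
limits of the same finite linear combinations, of the `J_v` in `L^α` and of the `L_v` along almost
every path; the integrand is identified by taking the same limits pointwise. -/
theorem IsCadlagVersion.isStableIntegral_mixture [IsProbabilityMeasure P]
    (hL : IsCadlagVersion P M L) (hM : IsStableRandomMeasure P α β M)
    (hα : 1 ≤ α) (hβ : β ∈ Icc (-1 : ℝ) 1) {γ₁ γ₂ t : ℝ} (h1 : 0 < γ₁) (h1α : γ₁ < 1 / α)
    (h2α : 1 / α < γ₂) {a b : ℝ → ℝ} (ha : Measurable a) (hb : Measurable b)
    (hm : Integrable (majorant γ₁ γ₂ a b t)) :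
    (∀ᵐ ω ∂P, Integrable fun v => a v * L v ω + b v * L t ω) ∧
      IsStableIntegral P α M (fun u => ∫ v, (a v * levyKernel v u + b v * levyKernel t u))
        (fun ω => ∫ v, (a v * L v ω + b v * L t ω)) := by
  have hα0 : 0 < α := by linarith
  have hfact : Fact (1 ≤ ENNReal.ofReal α) := ⟨by simpa using hα⟩
  have hγ2 : 0 < γ₂ := by linarith
  have hJp : HasEnvelope γ₁ γ₂ t (levyKernelLp α) :=
    hasEnvelope_levyKernelLp hα0 h1α.le h2α.le
  have hJu : ∀ᵐ u : ℝ, HasEnvelope γ₁ γ₂ t (fun v => levyKernel v u) := by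
    filter_upwards [compl_mem_ae_iff.2 (measure_singleton (0 : ℝ)),
      compl_mem_ae_iff.2 (measure_singleton t)] with u hu hut
    exact hasEnvelope_levyKernel_apply h1 hu hut
  have hLω : ∀ᵐ ω ∂P, HasEnvelope γ₁ γ₂ t (fun v => L v ω) := by
    filter_upwards [hL.cadlag, hL.ae_exists_envelope_bound hM hα0 hβ h1 h1α h2α 0,
      hL.ae_exists_envelope_bound hM hα0 hβ h1 h1α h2α t,
      (hL.isStableLevyProcess hM hα0 hβ).zero] with ω hcad hω0 hωt hz
    obtain ⟨C₀, hC₀, hb₀⟩ := hω0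
    obtain ⟨C₁, hC₁, hb₁⟩ := hωt
    refine ⟨fun v => (hcad v).1, C₀ + C₁, by positivity, fun v => ⟨?_, ?_⟩⟩
    · have h3 := hb₀ v
      rw [hz, sub_zero, sub_zero] at h3
      rw [Real.norm_eq_abs, add_mul]
      linarith [mul_nonneg hC₁ (envelope_nonneg γ₁ γ₂ v)]
    · rw [Real.norm_eq_abs, add_mul]
      linarith [hb₁ v, mul_nonneg hC₀ (envelope_nonneg γ₁ γ₂ (v - t))]
  have hLint : ∀ᵐ ω ∂P, Integrable fun v => a v * L v ω + b v * L t ω := by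
    filter_upwards [hLω] with ω hω
    exact hω.integrable ha hb hm
  refine ⟨hLint, ?_⟩
  -- the inner limit, in which the grid is refined
  have hn : ∀ n : ℕ, IsStableIntegral P α M
      ((∫ v in cutoffSet a b n, (a v • levyKernelLp α v + b v • levyKernelLp α t) :
        Lp ℝ (ENNReal.ofReal α) (volume : Measure ℝ)) : ℝ → ℝ)
      (fun ω => ∫ v in cutoffSet a b n, (a v • L v ω + b v • L t ω)) := by
    intro n
    refine IsStableIntegral.of_tendsto_Lp hM hα
      (tendsto_stepSum ha hb n hJp.rightContinuous (hJp.locally_bounded h1 hγ2))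
      (Y := fun m ω => stepSum a b t n m (fun v => L v ω)) (fun m => ?_) ?_
    · exact (hL.isStableIntegral_stepSum hM hα hβ a b t n m).congr
        (coeFn_stepSum_levyKernelLp a b t n m).symm EventuallyEq.rfl
    · filter_upwards [hLω] with ω hω
      exact tendsto_stepSum ha hb n hω.rightContinuous (hω.locally_bounded h1 hγ2)
  have hn' : ∀ n : ℕ,
      ((∫ v in cutoffSet a b n, (a v • levyKernelLp α v + b v • levyKernelLp α t) :
        Lp ℝ (ENNReal.ofReal α) (volume : Measure ℝ)) : ℝ → ℝ) =ᵐ[volume]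
      fun u => ∫ v in cutoffSet a b n, (a v • levyKernel v u + b v • levyKernel t u) := by
    intro n
    refine Lp_ae_eq_of_tendsto (α := α)
      (tendsto_stepSum ha hb n hJp.rightContinuous (hJp.locally_bounded h1 hγ2))
      (coeFn_stepSum_levyKernelLp a b t n) ?_
    filter_upwards [hJu] with u hu
    exact tendsto_stepSum ha hb n hu.rightContinuous (hu.locally_bounded h1 hγ2)
  -- the outer limit, in which the cutoff is removed
  have hlim := tendsto_setIntegral_cutoffSet ha hb (hJp.integrable ha hb hm)
  have hF : IsStableIntegral P α M
      ((∫ v, (a v • levyKernelLp α v + b v • levyKernelLp α t) :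
        Lp ℝ (ENNReal.ofReal α) (volume : Measure ℝ)) : ℝ → ℝ)
      (fun ω => ∫ v, (a v • L v ω + b v • L t ω)) := by
    refine IsStableIntegral.of_tendsto_Lp hM hα hlim hn ?_
    filter_upwards [hLω] with ω hω
    exact tendsto_setIntegral_cutoffSet ha hb (hω.integrable ha hb hm)
  refine hF.congr (Lp_ae_eq_of_tendsto hlim hn' ?_) EventuallyEq.rfl
  filter_upwards [hJu] with u hu
  exact tendsto_setIntegral_cutoffSet ha hb (hu.integrable ha hb hm)

end StochasticFubini

/-! ### The kernel of linear fractional stable motion as a mixture -/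

section Kernel

lemma measurable_posPow (p : ℝ) : Measurable fun x => posPow x p :=
  Measurable.ite (measurableSet_lt measurable_const measurable_id) (measurable_id.pow_const p)
    measurable_const

lemma posPow_nonneg (x p : ℝ) : 0 ≤ posPow x p := by
  unfold posPow
  split_ifs with h
  · positivity
  · exact le_rfl

lemma posPow_of_nonpos {x : ℝ} (hx : x ≤ 0) (p : ℝ) : posPow x p = 0 := if_neg (not_lt.2 hx)

lemma posPow_of_pos {x : ℝ} (hx : 0 < x) (p : ℝ) : posPow x p = x ^ p := if_pos hx

lemma intervalIntegrable_posPow {p : ℝ} (hp : -1 < p) (x y : ℝ) :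
    IntervalIntegrable (fun z => posPow z p) volume x y := by
  rw [intervalIntegrable_iff]
  have h := (intervalIntegral.intervalIntegrable_rpow' hp (a := x) (b := y)).def'
  have h2 := h.indicator (measurableSet_Ioi (a := (0 : ℝ)))
  refine h2.congr (Eventually.of_forall fun z => ?_)
  simp [indicator, posPow]

lemma intervalIntegrable_posPow_sub {p : ℝ} (hp : -1 < p) (s x y : ℝ) :
    IntervalIntegrable (fun v => posPow (s - v) p) volume x y := by
  have := (intervalIntegrable_posPow hp (s - x) (s - y)).comp_sub_left s
  simpa using this

lemma integrableOn_Icc_posPow_sub {p : ℝ} (hp : -1 < p) (s x y : ℝ) :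
    IntegrableOn (fun v => posPow (s - v) p) (Icc x y) := by
  rcases le_total x y with h | h
  · rw [← intervalIntegrable_iff_integrableOn_Icc_of_le h]
    exact intervalIntegrable_posPow_sub hp s x y
  · rcases h.eq_or_lt with rfl | h
    · simp
    · rw [Icc_eq_empty (not_le.2 h)]
      exact integrableOn_empty

lemma posPow_sub_mul_rpow (s v p γ : ℝ) :
    posPow (s - v) p * |v - s| ^ γ = posPow (s - v) (p + γ) := by
  unfold posPow
  split_ifs with h
  · rw [abs_sub_comm, abs_of_pos h, Real.rpow_add h]
  · rw [zero_mul]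

lemma abs_add_rpow_sub_rpow_le {p x t : ℝ} (hp : p ≤ 1) (hx : 0 < x) (hxt : 2 * |t| ≤ x) :
    |(x + t) ^ p - x ^ p| ≤ |p| * (1 / 2) ^ (p - 1) * |t| * x ^ (p - 1) := by
  have h1 : ∀ y ∈ Ici (x / 2), HasDerivWithinAt (fun z : ℝ => z ^ p) (p * y ^ (p - 1))
      (Ici (x / 2)) y := fun y hy =>
    (Real.hasDerivAt_rpow_const (Or.inl
      (ne_of_gt ((half_pos hx).trans_le hy)))).hasDerivWithinAt
  have h2 : ∀ y ∈ Ici (x / 2), ‖p * y ^ (p - 1)‖ ≤ |p| * (x / 2) ^ (p - 1) := by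
    intro y hy
    have hy0 : 0 < y := (half_pos hx).trans_le hy
    rw [norm_mul, Real.norm_eq_abs, Real.norm_eq_abs,
      abs_of_nonneg (by positivity : 0 ≤ y ^ (p - 1))]
    exact mul_le_mul_of_nonneg_left
      (Real.rpow_le_rpow_of_nonpos (half_pos hx) hy (by linarith)) (abs_nonneg p)
  have h3 := (convex_Ici (x / 2)).norm_image_sub_le_of_norm_hasDerivWithin_le h1 h2
    (x := x) (y := x + t) (by rw [mem_Ici]; linarith)
    (by rw [mem_Ici]; linarith [neg_abs_le t])
  rw [Real.norm_eq_abs, Real.norm_eq_abs, add_sub_cancel_left] at h3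
  refine h3.trans_eq ?_
  rw [div_eq_mul_one_div x 2, mul_comm x, Real.mul_rpow (by norm_num) hx.le]
  ring

/-- The weight `d (s - v)_+ ^ (d - 1)`. -/
noncomputable def powWeight (d s v : ℝ) : ℝ := d * posPow (s - v) (d - 1)

lemma measurable_powWeight (d s : ℝ) : Measurable (powWeight d s) :=
  ((measurable_posPow (d - 1)).comp (measurable_const.sub measurable_id)).const_mul d

lemma powWeight_of_le {d s v : ℝ} (h : s ≤ v) : powWeight d s v = 0 := by
  rw [powWeight, posPow_of_nonpos (by linarith), mul_zero]

lemma integrableOn_Iio_neg_rpow {p R : ℝ} (hp : p < -1) (hR : 0 < R) :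
    IntegrableOn (fun v : ℝ => (-v) ^ p) (Iio (-R)) := by
  have h := integrableOn_Ioi_rpow_of_lt hp hR
  have := (Measure.measurePreserving_neg (volume : Measure ℝ)).integrableOn_comp_preimage
    (Homeomorph.neg ℝ).measurableEmbedding (f := fun v : ℝ => v ^ p) (s := Ioi R)
  have h2 := this.2 h
  rw [show (Neg.neg ⁻¹' Ioi R : Set ℝ) = Iio (-R) by ext; simp] at h2
  exact h2

lemma integrable_of_three_pieces {g : ℝ → ℝ} {R : ℝ} (h1 : IntegrableOn g (Iio (-R)))
    (h2 : IntegrableOn g (Icc (-R) R)) (h3 : IntegrableOn g (Ioi R)) : Integrable g := by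
  rw [← integrableOn_univ]
  refine ((h1.union h2).union h3).mono_set fun v _ => ?_
  rcases lt_or_ge v (-R) with h | h
  · exact Or.inl (Or.inl h)
  · rcases le_or_gt v R with h' | h'
    · exact Or.inl (Or.inr ⟨h, h'⟩)
    · exact Or.inr h'

lemma measurable_envelope (γ₁ γ₂ c : ℝ) : Measurable fun v => envelope γ₁ γ₂ (v - c) :=
  ((measurable_id.sub_const c).abs.pow_const γ₁).add ((measurable_id.sub_const c).abs.pow_const γ₂)

lemma measurable_majorant {γ₁ γ₂ : ℝ} {a b : ℝ → ℝ} (ha : Measurable a) (hb : Measurable b)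
    (t : ℝ) : Measurable (majorant γ₁ γ₂ a b t) := by
  have h0 := measurable_envelope γ₁ γ₂ 0
  simp only [sub_zero] at h0
  exact (((ha.add hb).abs.mul h0).add (hb.abs.mul (measurable_envelope γ₁ γ₂ t))).min
    ((ha.abs.mul h0).add (hb.abs.mul_const _))

lemma majorant_nonneg (γ₁ γ₂ : ℝ) (a b : ℝ → ℝ) (t v : ℝ) : 0 ≤ majorant γ₁ γ₂ a b t v := by
  have h0 := envelope_nonneg γ₁ γ₂
  refine le_min (add_nonneg ?_ ?_) (add_nonneg ?_ ?_) <;>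
    exact mul_nonneg (abs_nonneg _) (h0 _)

/-- At `-∞` the two weights cancel to order `d - 2`. -/
lemma abs_powWeight_sub_le {d t v : ℝ} (hd1 : d < 1) (hv : v < -(2 * |t| + 1)) :
    |powWeight d t v - powWeight d 0 v| ≤
      |d| * (|d - 1| * (1 / 2) ^ (d - 2) * |t|) * (-v) ^ (d - 2) := by
  have ht := abs_nonneg t
  have hv0 : 0 < -v := by linarith
  have hvt : 0 < t - v := by linarith [neg_abs_le t]
  unfold powWeight
  rw [posPow_of_pos hvt, zero_sub, posPow_of_pos hv0, ← mul_sub, abs_mul]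
  have := abs_add_rpow_sub_rpow_le (p := d - 1) (x := -v) (t := t) (by linarith) hv0 (by linarith)
  rw [show -v + t = t - v by ring, show d - 1 - 1 = d - 2 by ring] at this
  calc _ ≤ |d| * (|d - 1| * (1 / 2) ^ (d - 2) * |t| * (-v) ^ (d - 2)) := by gcongr
    _ = _ := by ring

lemma integrableOn_far_left {d t γ₁ γ₂ : ℝ} (hd1 : d < 1) (h1d : γ₁ < 1 - d) (h2d : γ₂ < 1 - d) :
    IntegrableOn (fun v => |powWeight d t v - powWeight d 0 v| * envelope γ₁ γ₂ v)
      (Iio (-(2 * |t| + 1))) := by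
  have hR : 0 < 2 * |t| + 1 := by positivity
  set C := |d| * (|d - 1| * (1 / 2) ^ (d - 2) * |t|) with hC
  have hg := ((integrableOn_Iio_neg_rpow (p := d - 2 + γ₁) (by linarith) hR).add
    (integrableOn_Iio_neg_rpow (p := d - 2 + γ₂) (by linarith) hR)).const_mul C
  refine Integrable.mono' hg ?_ ?_
  · have h0 := measurable_envelope γ₁ γ₂ 0
    simp only [sub_zero] at h0
    exact (((measurable_powWeight d t).sub (measurable_powWeight d 0)).abs.mul
      h0).aestronglyMeasurable
  · rw [ae_restrict_iff' measurableSet_Iio]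
    refine Eventually.of_forall fun v hv => ?_
    have hv' : v < -(2 * |t| + 1) := hv
    have hv0 : 0 < -v := by linarith
    rw [Real.norm_of_nonneg (mul_nonneg (abs_nonneg _) (envelope_nonneg _ _ _))]
    refine (mul_le_mul_of_nonneg_right (abs_powWeight_sub_le hd1 hv')
      (envelope_nonneg _ _ _)).trans_eq ?_
    rw [envelope, ← abs_neg v, abs_of_pos hv0, Pi.add_apply, Real.rpow_add hv0, Real.rpow_add hv0]
    ring

/-- For `0 < d`, the singularities of order `d - 1` at `0` and `t` are integrable by themselves, and
the cancellation at `-∞` leaves `|v| ^ (d - 2 + γ)`. -/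
lemma integrable_majorant_of_pos {d t γ₁ γ₂ : ℝ} (hd : 0 < d) (hd1 : d < 1) (h1 : 0 < γ₁)
    (h2 : 0 < γ₂) (h1d : γ₁ < 1 - d) (h2d : γ₂ < 1 - d) :
    Integrable (majorant γ₁ γ₂ (fun v => powWeight d t v - powWeight d 0 v) (fun _ => 0) t) := by
  set R := 2 * |t| + 1 with hR
  have ht := abs_nonneg t
  have heq : majorant γ₁ γ₂ (fun v => powWeight d t v - powWeight d 0 v) (fun _ => 0) t =
      fun v => |powWeight d t v - powWeight d 0 v| * envelope γ₁ γ₂ v := by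
    funext v
    simp [majorant]
  have hmeas : Measurable fun v => |powWeight d t v - powWeight d 0 v| * envelope γ₁ γ₂ v := by
    have h0 := measurable_envelope γ₁ γ₂ 0
    simp only [sub_zero] at h0
    exact ((measurable_powWeight d t).sub (measurable_powWeight d 0)).abs.mul h0
  rw [heq]
  refine integrable_of_three_pieces (R := R) (integrableOn_far_left hd1 h1d h2d) ?_ ?_
  · have hw : ∀ s, IntegrableOn (powWeight d s) (Icc (-R) R) := fun s =>
      (integrableOn_Icc_posPow_sub (p := d - 1) (by linarith) s (-R) R).const_mul d
    refine Integrable.mono' (((hw t).sub (hw 0)).abs.mul_const (R ^ γ₁ + R ^ γ₂))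
      hmeas.aestronglyMeasurable ?_
    rw [ae_restrict_iff' measurableSet_Icc]
    refine Eventually.of_forall fun v hv => ?_
    rw [Real.norm_of_nonneg (mul_nonneg (abs_nonneg _) (envelope_nonneg _ _ _))]
    refine mul_le_mul_of_nonneg_left ?_ (abs_nonneg _)
    have hvR : |v| ≤ R := abs_le.2 hv
    unfold envelope
    gcongr
  · refine integrableOn_zero.congr_fun (fun v hv => ?_) measurableSet_Ioi
    have hv' : R < v := hv
    simp only
    rw [powWeight_of_le (by linarith [le_abs_self t]), powWeight_of_le (by linarith), sub_zero,
      abs_zero, zero_mul]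

lemma abs_powWeight_mul_envelope (d s v γ₁ γ₂ : ℝ) :
    |powWeight d s v| * envelope γ₁ γ₂ (v - s) =
      |d| * (posPow (s - v) (d - 1 + γ₁) + posPow (s - v) (d - 1 + γ₂)) := by
  rw [powWeight, abs_mul, abs_of_nonneg (posPow_nonneg _ _), envelope, mul_add,
    mul_assoc, mul_assoc, posPow_sub_mul_rpow, posPow_sub_mul_rpow]
  ring

/-- For `d < 0`, the weight `powWeight d s` is not integrable at `s`; each singularity is
compensated by an increment of order `|v - s| ^ γ` with `γ > -d`. -/
lemma integrable_majorant_of_neg {d t γ₁ γ₂ : ℝ} (hd : d < 0) (h1 : -d < γ₁) (h2 : -d < γ₂)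
    (h1d : γ₁ < 1 - d) (h2d : γ₂ < 1 - d) :
    Integrable (majorant γ₁ γ₂ (fun v => powWeight d t v - powWeight d 0 v)
      (fun v => -powWeight d t v) t) := by
  set R := 2 * |t| + 1 with hR
  have ht := abs_nonneg t
  have hR0 : 0 < R := by positivity
  have hmeas := measurable_majorant (γ₁ := γ₁) (γ₂ := γ₂)
    ((measurable_powWeight d t).sub (measurable_powWeight d 0)) (measurable_powWeight d t).neg t
  refine integrable_of_three_pieces (R := R) ?_ ?_ ?_
  · have hw : IntegrableOn (fun v => |powWeight d t v| * envelope γ₁ γ₂ t) (Iio (-R)) := by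
      refine Integrable.mul_const ?_ _
      refine Integrable.mono' ((integrableOn_Iio_neg_rpow (p := d - 1) (by linarith)
        hR0).const_mul (|d| * (1 / 2) ^ (d - 1)))
        (measurable_powWeight d t).abs.aestronglyMeasurable ?_
      rw [ae_restrict_iff' measurableSet_Iio]
      refine Eventually.of_forall fun v hv => ?_
      have hv' : v < -R := hv
      have hv0 : 0 < -v := by linarith
      have hvt : -v * (1 / 2) ≤ t - v := by linarith [neg_abs_le t]
      rw [Real.norm_eq_abs, abs_abs, powWeight, abs_mul, abs_of_nonneg (posPow_nonneg _ _),
        posPow_of_pos (by linarith), mul_assoc, ← Real.mul_rpow (by norm_num) hv0.le]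
      refine mul_le_mul_of_nonneg_left ?_ (abs_nonneg d)
      exact Real.rpow_le_rpow_of_nonpos (by linarith) (by linarith) (by linarith)
    refine Integrable.mono' ((integrableOn_far_left (t := t) (by linarith) h1d h2d).add hw)
      hmeas.aestronglyMeasurable (Eventually.of_forall fun v => ?_)
    rw [Real.norm_of_nonneg (majorant_nonneg _ _ _ _ _ _)]
    refine (min_le_right _ _).trans_eq ?_
    rw [abs_neg]
    rfl
  · have hw : ∀ s, IntegrableOn (fun v => |powWeight d s v| * envelope γ₁ γ₂ (v - s))
        (Icc (-R) R) := by
      intro s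
      simp only [abs_powWeight_mul_envelope]
      exact ((integrableOn_Icc_posPow_sub (by linarith) s (-R) R).add
        (integrableOn_Icc_posPow_sub (by linarith) s (-R) R)).const_mul |d|
    refine Integrable.mono' ((hw 0).add (hw t)) hmeas.aestronglyMeasurable
      (Eventually.of_forall fun v => ?_)
    rw [Real.norm_of_nonneg (majorant_nonneg _ _ _ _ _ _)]
    refine (min_le_left _ _).trans_eq ?_
    rw [abs_neg,
      show powWeight d t v - powWeight d 0 v + -powWeight d t v = -powWeight d 0 v by ring,
      abs_neg, Pi.add_apply, sub_zero]
  · refine integrableOn_zero.congr_fun (fun v hv => ?_) measurableSet_Ioi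
    have hv' : R < v := hv
    simp only [majorant]
    rw [powWeight_of_le (by linarith [le_abs_self t]), powWeight_of_le (by linarith)]
    simp

lemma continuous_posPow {d : ℝ} (hd : 0 < d) : Continuous fun x => posPow x d := by
  have : (fun x => posPow x d) = fun x => (max x 0) ^ d := by
    funext x
    unfold posPow
    split_ifs with h
    · rw [max_eq_left h.le]
    · rw [max_eq_right (not_lt.1 h), Real.zero_rpow hd.ne']
  rw [this]
  exact (continuous_id.max continuous_const).rpow_const fun _ => Or.inr hd.le

lemma hasDerivAt_posPow {x : ℝ} (hx : x ≠ 0) (d : ℝ) :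
    HasDerivAt (fun z => posPow z d) (d * posPow x (d - 1)) x := by
  rcases lt_or_gt_of_ne hx with h | h
  · rw [posPow_of_nonpos h.le, mul_zero]
    refine (hasDerivAt_const x (0 : ℝ)).congr_of_eventuallyEq ?_
    filter_upwards [Iio_mem_nhds h] with z hz
    exact posPow_of_nonpos (le_of_lt hz) d
  · rw [posPow_of_pos h]
    refine (Real.hasDerivAt_rpow_const (Or.inl hx)).congr_of_eventuallyEq ?_
    filter_upwards [Ioi_mem_nhds h] with z hz
    exact posPow_of_pos hz d

lemma intervalIntegrable_powWeight {d : ℝ} (hd : 0 < d) (s x y : ℝ) :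
    IntervalIntegrable (powWeight d s) volume x y :=
  (intervalIntegrable_posPow_sub (by linarith) s x y).const_mul d

lemma intervalIntegral_powWeight {d : ℝ} (hd : 0 < d) (s x y : ℝ) :
    ∫ v in x..y, powWeight d s v = posPow (s - x) d - posPow (s - y) d := by
  have h1 := intervalIntegral.integral_comp_sub_left (a := x) (b := y)
    (fun z => d * posPow z (d - 1)) s
  have h2 := integral_eq_of_hasDerivAt_off_countable (fun z => posPow z d)
    (fun z => d * posPow z (d - 1)) (countable_singleton (0 : ℝ))
    (continuous_posPow hd).continuousOn
    (fun z hz => hasDerivAt_posPow (fun h => hz.2 h) d)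
    ((intervalIntegrable_posPow (p := d - 1) (by linarith) (s - y) (s - x)).const_mul d)
  exact h1.trans h2

/-- For `0 < d`, the kernel of linear fractional stable motion is a mixture of the
`levyKernel v`. -/
lemma integral_powWeight_sub_mul_levyKernel {d t u : ℝ} (hd : 0 < d) (hd1 : d < 1) (hu : u ≠ 0)
    (hint : Integrable fun v => (powWeight d t v - powWeight d 0 v) * levyKernel v u) :
    ∫ v, (powWeight d t v - powWeight d 0 v) * levyKernel v u =
      posPow (t - u) d - posPow (-u) d := by
  have hFTC : ∀ x y, ∫ v in x..y, (powWeight d t v - powWeight d 0 v) =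
      posPow (t - x) d - posPow (t - y) d - (posPow (-x) d - posPow (-y) d) := by
    intro x y
    rw [intervalIntegral.integral_sub (intervalIntegrable_powWeight hd t x y)
      (intervalIntegrable_powWeight hd 0 x y), intervalIntegral_powWeight hd,
      intervalIntegral_powWeight hd, zero_sub, zero_sub]
  rcases lt_or_gt_of_ne hu with hu | hu
  · have hpt : ∀ v, (powWeight d t v - powWeight d 0 v) * levyKernel v u =
        -(Iio u).indicator (fun v => powWeight d t v - powWeight d 0 v) v := by
      intro v
      simp only [levyKernel, indicator, mem_Ioc, mem_Iio, Pi.one_apply]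
      split_ifs <;> first | (exfalso; grind) | ring
    simp only [hpt] at hint ⊢
    have hint' : IntegrableOn (fun v => powWeight d t v - powWeight d 0 v) (Iic u) := by
      rw [integrableOn_Iic_iff_integrableOn_Iio, ← integrable_indicator_iff measurableSet_Iio]
      simpa using hint.neg
    rw [integral_neg, integral_indicator measurableSet_Iio, ← integral_Iic_eq_integral_Iio]
    have hlim := (intervalIntegral_tendsto_integral_Iic u hint' tendsto_neg_atTop_atBot).neg
    refine tendsto_nhds_unique hlim ?_
    simp only [hFTC]
    have h0 : Tendsto (fun R : ℝ => posPow (t - -R) d - posPow (- -R) d) atTop (𝓝 0) := by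
      have hdec : Tendsto (fun R : ℝ => |d| * (1 / 2) ^ (d - 1) * |t| * R ^ (d - 1)) atTop
          (𝓝 0) := by
        have := (tendsto_rpow_neg_atTop (y := 1 - d) (by linarith)).const_mul
          (|d| * (1 / 2) ^ (d - 1) * |t|)
        simpa using this
      refine squeeze_zero_norm' ?_ hdec
      filter_upwards [eventually_ge_atTop (2 * |t|), eventually_gt_atTop 0] with R hR hR0
      have hRt : 0 < t - -R := by
        rcases (abs_nonneg t).eq_or_lt with h | h
        · rw [eq_comm, abs_eq_zero] at h
          linarith
        · linarith [neg_abs_le t]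
      rw [neg_neg, posPow_of_pos hRt, posPow_of_pos hR0, Real.norm_eq_abs,
        show t - -R = R + t by ring]
      exact abs_add_rpow_sub_rpow_le hd1.le hR0 hR
    have h1 := (tendsto_const_nhds (x := posPow (t - u) d - posPow (-u) d)).sub h0
    rw [sub_zero] at h1
    refine h1.congr fun R => ?_
    ring
  · set R := max t u with hR
    have hRt : t ≤ R := le_max_left _ _
    have hRu : u ≤ R := le_max_right _ _
    have hpt : (fun v => (powWeight d t v - powWeight d 0 v) * levyKernel v u) =ᵐ[volume]
        (Ioc u R).indicator (fun v => powWeight d t v - powWeight d 0 v) := by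
      filter_upwards [compl_mem_ae_iff.2 (measure_singleton u)] with v hv
      have hv' : v ≠ u := hv
      rcases le_or_gt v R with h | h
      · simp only [levyKernel, indicator, mem_Ioc, Pi.one_apply]
        split_ifs <;> first | (exfalso; grind) | ring
      · rw [indicator_of_notMem (fun h' => absurd h'.2 (not_le.2 h)),
          powWeight_of_le (by linarith), powWeight_of_le (by linarith), sub_zero, zero_mul]
    rw [integral_congr_ae hpt, integral_indicator measurableSet_Ioc,
      ← intervalIntegral.integral_of_le hRu, hFTC, posPow_of_nonpos (x := t - R) (by linarith),
      posPow_of_nonpos (x := -R) (by linarith)]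
    ring

/-- For `d < 0`, the negative power `(s - u)_+ ^ d` is a mixture of the indicators
`1_{(v, s]}(u)`. -/
lemma powWeight_mul_levyKernel_sub {d s u : ℝ} (hd : d < 0) (hus : u ≠ s) :
    Integrable (fun v => powWeight d s v * (levyKernel v u - levyKernel s u)) ∧
      ∫ v, powWeight d s v * (levyKernel v u - levyKernel s u) = posPow (s - u) d := by
  rcases lt_or_gt_of_ne hus with hus | hus
  · have hpos : 0 < s - u := sub_pos.2 hus
    let F : ℝ → ℝ := (Ioi (s - u)).indicator fun y => -d * y ^ (d - 1)
    have hF : (fun v => powWeight d s v * (levyKernel v u - levyKernel s u)) =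
        fun v => F (s - v) := by
      funext v
      rcases lt_or_ge v s with hv | hv
      · rw [← neg_sub (levyKernel s u), levyKernel_sub hv.le, powWeight,
          posPow_of_pos (sub_pos.2 hv)]
        simp only [F, indicator, mem_Ioc, mem_Ioi]
        split_ifs <;> first | (exfalso; grind) | ring
      · rw [powWeight_of_le hv, zero_mul]
        simp only [F]
        rw [indicator_of_notMem]
        exact fun h => absurd (mem_Ioi.1 h) (by linarith)
    have hFint : Integrable F :=
      (integrable_indicator_iff measurableSet_Ioi).2
        ((integrableOn_Ioi_rpow_of_lt (by linarith) hpos).const_mul (-d))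
    rw [hF]
    refine ⟨hFint.comp_sub_left s, ?_⟩
    rw [integral_sub_left_eq_self F volume s, integral_indicator measurableSet_Ioi,
      integral_const_mul, integral_Ioi_rpow_of_lt (by linarith) hpos, posPow_of_pos hpos,
      sub_add_cancel]
    field_simp
    exact div_self hd.ne
  · have h0 : (fun v => powWeight d s v * (levyKernel v u - levyKernel s u)) = fun _ => 0 := by
      funext v
      rcases lt_or_ge v s with hv | hv
      · rw [← neg_sub (levyKernel s u), levyKernel_sub hv.le, indicator_of_notMem, neg_zero,
          mul_zero]
        exact fun h => absurd h.2 (not_le.2 hus)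
      · rw [powWeight_of_le hv, zero_mul]
    rw [h0, posPow_of_nonpos (by linarith)]
    exact ⟨integrable_zero _ _ _, integral_zero _ _⟩

end Kernel

/-! ### Linear fractional stable motion -/

section Lfsm

variable {Ω : Type*} [MeasurableSpace Ω] {P : Measure Ω} {α β : ℝ} {M : Set ℝ → Ω → ℝ}
  {L : ℝ → Ω → ℝ}

/-- Here the mixture has weights `a v = d ((t - v)_+ ^ (d - 1) - (-v)_+ ^ (d - 1))` and `b = 0`. -/
lemma IsCadlagVersion.lfsm_of_lt [IsProbabilityMeasure P]
    (hL : IsCadlagVersion P M L) (hM : IsStableRandomMeasure P α β M)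
    (hα : 1 ≤ α) (hα2 : α < 2) (hβ : β ∈ Icc (-1 : ℝ) 1) {H : ℝ} (hH : H ∈ Ioo (0 : ℝ) 1)
    (hHα : 1 / α < H) (t : ℝ) :
    (∀ᵐ ω ∂P, Integrable (fun u => L u ω *
      (posPow (t - u) (H - 1 / α - 1) - posPow (-u) (H - 1 / α - 1))) volume) ∧
    IsStableIntegral P α M (lfsmKernel α H t) (fun ω => (H - 1 / α) * ∫ u, L u ω *
      (posPow (t - u) (H - 1 / α - 1) - posPow (-u) (H - 1 / α - 1))) := by
  obtain ⟨hH0, hH1⟩ := hH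
  have hα0 : 0 < α := by linarith
  have hinv : 1 / 2 < 1 / α := one_div_lt_one_div_of_lt hα0 hα2
  set d := H - 1 / α with hd
  have hd0 : 0 < d := by linarith
  have hd1 : d < 1 := by linarith
  -- the envelope has exponents `1 / α - H / 2` and `1 / α + (1 - H) / 2`, which lie strictly
  -- between `0` and `1 - d`, on either side of `1 / α`
  have h1 : 0 < 1 / α - H / 2 := by linarith
  have h1α : 1 / α - H / 2 < 1 / α := by linarith
  have h2α : 1 / α < 1 / α + (1 - H) / 2 := by linarith
  have hm := integrable_majorant_of_pos (t := t) hd0 hd1 h1 (h1.trans (h1α.trans h2α))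
    (by linarith) (by linarith)
  have hmeas := (measurable_powWeight d t).sub (measurable_powWeight d 0)
  obtain ⟨hi, hI⟩ := hL.isStableIntegral_mixture hM hα hβ h1 h1α h2α hmeas measurable_const hm
  have hfactor : ∀ ω u, (powWeight d t u - powWeight d 0 u) * L u ω + 0 * L t ω =
      d * (L u ω * (posPow (t - u) (d - 1) - posPow (-u) (d - 1))) := by
    intro ω u
    simp only [powWeight, zero_sub]
    ring
  constructor
  · filter_upwards [hi] with ω hω
    have h3 := hω.const_mul d⁻¹
    refine h3.congr (Eventually.of_forall fun u => ?_)
    have := hfactor ω u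
    simp only [Pi.sub_apply]
    rw [this, inv_mul_cancel_left₀ hd0.ne']
  · refine hI.congr ?_ (Eventually.of_forall fun ω => ?_)
    · filter_upwards [compl_mem_ae_iff.2 (measure_singleton (0 : ℝ)),
        compl_mem_ae_iff.2 (measure_singleton t)] with u hu hut
      have h4 := (hasEnvelope_levyKernel_apply (γ₂ := 1 / α + (1 - H) / 2) h1 hu hut).integrable
        hmeas measurable_const hm
      simp only [smul_eq_mul, zero_mul, add_zero, Pi.sub_apply] at h4
      simp only [zero_mul, add_zero, Pi.sub_apply]
      rw [integral_powWeight_sub_mul_levyKernel hd0 hd1 hu h4]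
      rfl
    · simp only [Pi.sub_apply]
      rw [← integral_const_mul]
      exact integral_congr_ae (Eventually.of_forall fun u => hfactor ω u)

/-- Here the mixture has the same weight `a`, and `b v = -d (t - v)_+ ^ (d - 1)`, which subtracts
`L_t` at the singularity at `t`. -/
lemma IsCadlagVersion.lfsm_of_gt [IsProbabilityMeasure P]
    (hL : IsCadlagVersion P M L) (hM : IsStableRandomMeasure P α β M)
    (hα : 1 ≤ α) (hα2 : α < 2) (hβ : β ∈ Icc (-1 : ℝ) 1) {H : ℝ} (hH : H ∈ Ioo (0 : ℝ) 1)
    (hHα : H < 1 / α) (t : ℝ) :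
    (∀ᵐ ω ∂P, Integrable (fun u => (L u ω - L t ω) * posPow (t - u) (H - 1 / α - 1)
      - L u ω * posPow (-u) (H - 1 / α - 1)) volume) ∧
    IsStableIntegral P α M (lfsmKernel α H t) (fun ω => (H - 1 / α) *
      ∫ u, ((L u ω - L t ω) * posPow (t - u) (H - 1 / α - 1)
        - L u ω * posPow (-u) (H - 1 / α - 1))) := by
  obtain ⟨hH0, hH1⟩ := hH
  have hα0 : 0 < α := by linarith
  have hinv : 1 / 2 < 1 / α := one_div_lt_one_div_of_lt hα0 hα2
  set d := H - 1 / α with hd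
  have hd0 : d < 0 := by linarith
  -- the envelope has exponents `1 / α - H / 2` and `1 / α + (1 - H) / 2`, which lie strictly
  -- between `-d` and `1 - d`, on either side of `1 / α`
  have h1 : 0 < 1 / α - H / 2 := by linarith
  have h1α : 1 / α - H / 2 < 1 / α := by linarith
  have h2α : 1 / α < 1 / α + (1 - H) / 2 := by linarith
  have hm := integrable_majorant_of_neg (t := t) (γ₁ := 1 / α - H / 2)
    (γ₂ := 1 / α + (1 - H) / 2) hd0 (by linarith) (by linarith) (by linarith) (by linarith)
  have hmeas := (measurable_powWeight d t).sub (measurable_powWeight d 0)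
  obtain ⟨hi, hI⟩ := hL.isStableIntegral_mixture hM hα hβ h1 h1α h2α hmeas
    (measurable_powWeight d t).neg hm
  have hfactor : ∀ ω u, (powWeight d t u - powWeight d 0 u) * L u ω + -powWeight d t u * L t ω =
      d * ((L u ω - L t ω) * posPow (t - u) (d - 1) - L u ω * posPow (-u) (d - 1)) := by
    intro ω u
    simp only [powWeight, zero_sub]
    ring
  constructor
  · filter_upwards [hi] with ω hω
    have h3 := hω.const_mul d⁻¹
    refine h3.congr (Eventually.of_forall fun u => ?_)
    have := hfactor ω u
    simp only [Pi.sub_apply, Pi.neg_apply]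
    rw [this, inv_mul_cancel_left₀ hd0.ne]
  · refine hI.congr ?_ (Eventually.of_forall fun ω => ?_)
    · filter_upwards [compl_mem_ae_iff.2 (measure_singleton (0 : ℝ)),
        compl_mem_ae_iff.2 (measure_singleton t)] with u hu hut
      obtain ⟨i1, e1⟩ := powWeight_mul_levyKernel_sub (s := t) (u := u) hd0 hut
      obtain ⟨i0, e0⟩ := powWeight_mul_levyKernel_sub (s := 0) (u := u) hd0 hu
      have h5 : ∀ v, (powWeight d t v - powWeight d 0 v) * levyKernel v u +
          -powWeight d t v * levyKernel t u =
          powWeight d t v * (levyKernel v u - levyKernel t u) -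
            powWeight d 0 v * (levyKernel v u - levyKernel 0 u) := by
        intro v
        rw [levyKernel_zero]
        ring
      simp only [Pi.sub_apply, Pi.neg_apply, h5]
      rw [integral_sub i1 i0, e1, e0, zero_sub]
      rfl
    · simp only [Pi.sub_apply, Pi.neg_apply]
      rw [← integral_const_mul]
      exact integral_congr_ae (Eventually.of_forall fun u => hfactor ω u)

/-- For `H = 1 / α` the kernel agrees with `levyKernel t` off `{0, t}`, since `x ^ 0 = 1` for
`x > 0`. -/
lemma IsCadlagVersion.lfsm_of_eq [IsProbabilityMeasure P]
    (hL : IsCadlagVersion P M L) (hM : IsStableRandomMeasure P α β M)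
    (hα : 1 ≤ α) (hβ : β ∈ Icc (-1 : ℝ) 1) {H : ℝ} (hHα : H = 1 / α) (t : ℝ) :
    IsStableIntegral P α M (lfsmKernel α H t) (L t) := by
  refine (hL.isStableIntegral_levyKernel hM hα hβ t).congr ?_ EventuallyEq.rfl
  filter_upwards [compl_mem_ae_iff.2 (measure_singleton (0 : ℝ)),
    compl_mem_ae_iff.2 (measure_singleton t)] with u hu hut
  have hu' : u ≠ 0 := hu
  have hut' : u ≠ t := hut
  simp only [lfsmKernel, posPow, levyKernel, indicator, mem_Ioc, Pi.one_apply, hHα, sub_self,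
    Real.rpow_zero]
  split_ifs <;> first | (exfalso; grind) | norm_num

end Lfsm

theorem mainTheorem6 {Ω : Type*} [MeasurableSpace Ω] (P : Measure Ω) [IsProbabilityMeasure P]
    (α β : ℝ) (hα : α ∈ Ico (1 : ℝ) 2) (hβ : β ∈ Icc (-1 : ℝ) 1) (hαβ : α = 1 → β = 0)
    (M : Set ℝ → Ω → ℝ) (hM : IsStableRandomMeasure P α β M) :
    (∃ L : ℝ → Ω → ℝ, IsCadlagVersion P M L) ∧
    ∀ L : ℝ → Ω → ℝ, IsCadlagVersion P M L →
      IsStableLevyProcess P α β L ∧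
      ∀ t : ℝ, ∀ H ∈ Ioo (0 : ℝ) 1,
        (∃ X : Ω → ℝ, IsStableIntegral P α M (lfsmKernel α H t) X) ∧
        ∀ X : Ω → ℝ, IsStableIntegral P α M (lfsmKernel α H t) X →
          (1 / α < H → ∀ᵐ ω ∂P,
            Integrable (fun u => L u ω *
              (posPow (t - u) (H - 1 / α - 1) - posPow (-u) (H - 1 / α - 1))) volume ∧
            X ω = (H - 1 / α) * ∫ u, L u ω *
              (posPow (t - u) (H - 1 / α - 1) - posPow (-u) (H - 1 / α - 1))) ∧
          (H = 1 / α → ∀ᵐ ω ∂P, X ω = L t ω) ∧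
          (H < 1 / α → ∀ᵐ ω ∂P,
            Integrable (fun u => (L u ω - L t ω) * posPow (t - u) (H - 1 / α - 1)
              - L u ω * posPow (-u) (H - 1 / α - 1)) volume ∧
            X ω = (H - 1 / α) * ∫ u, ((L u ω - L t ω) * posPow (t - u) (H - 1 / α - 1)
              - L u ω * posPow (-u) (H - 1 / α - 1))) := by
  obtain ⟨hα1, hα2⟩ := hα
  have hα0 : 0 < α := by linarith
  refine ⟨hM.exists_isCadlagVersion hα0 hα2.le hβ, fun L hL =>
    ⟨hL.isStableLevyProcess hM hα0 hβ, fun t H hH => ⟨?_, fun X hX => ⟨fun h => ?_, fun h => ?_,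
      fun h => ?_⟩⟩⟩⟩
  · rcases lt_trichotomy H (1 / α) with h | h | h
    · exact ⟨_, (hL.lfsm_of_gt hM hα1 hα2 hβ hH h t).2⟩
    · exact ⟨_, hL.lfsm_of_eq hM hα1 hβ h t⟩
    · exact ⟨_, (hL.lfsm_of_lt hM hα1 hα2 hβ hH h t).2⟩
  · obtain ⟨h1, h2⟩ := hL.lfsm_of_lt hM hα1 hα2 hβ hH h t
    filter_upwards [h1, hX.ae_unique hM hα1 hβ h2] with ω h3 h4
    exact ⟨h3, h4⟩
  · exact hX.ae_unique hM hα1 hβ (hL.lfsm_of_eq hM hα1 hβ h t)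
  · obtain ⟨h1, h2⟩ := hL.lfsm_of_gt hM hα1 hα2 hβ hH h t
    filter_upwards [h1, hX.ae_unique hM hα1 hβ h2] with ω h3 h4
    exact ⟨h3, h4⟩
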